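/- **Setting.** Let $T^n=\mathbb R^n/\mathbb Z^n$ act continuously on a compact space $X$, preserving a finite measure $\mu$. A continuous function $f$ is isotypic of weight $r\in\mathbb Z^n$ if $f(t\cdot x)=e^{2\pi i\,t\cdot r}f(x)$ for all $t$ and $x$. For a real skew-symmetric $n\times n$ matrix $\Theta$, the deformed product of isotypic functions $f,g$ of weights $r,s$ is $f\times_\Theta g=e^{\pi i\,r\cdot\Theta s}fg$, and $C(X_\Theta)$ is the C*-algebra of operators on $L^2(X,\mu)$ generated by the left multiplications $g\mapsto f\times_\Theta g$ by isotypic continuous functions $f$. Let $\theta\in\mathbb R$. Let $H=C(SU(3)_\theta)$ be the deformation of $C(SU(3))$ (with Haar measure) along the action of $\mathbb T^2\times\mathbb T^2$ given by $f(g)\mapsto f(\exp(-x)\,g\exp(s))$, where $\exp(s)=\mathrm{diag}(e^{2\pi i s_1},e^{2\pi i s_2},e^{-2\pi i(s_1+s_2)})$, by the matrix $J=\begin{pmatrix}0&-\theta\\ \theta&0\end{pmatrix}\oplus\begin{pmatrix}0&\theta\\-\theta&0\end{pmatrix}$. Write $u_{ij}\in H$ for the matrix coordinates. Let $\theta'=(\theta'_{jk})$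 be a real skew-symmetric $3\times3$ matrix and let $A=C(S^5_{\theta'})$ be the deformation of $C(S^5)$, $S^5\subset\mathbb C^3$ (with surface measure), along the action $(t\cdot z)_k=e^{2\pi i t_k}z_k$ of $\mathbb T^3$, with coordinates $z_1,z_2,z_3\in A$; thus $z_jz_k=e^{2\pi i\theta'_{jk}}z_kz_j$, the $z_k$ are normal, and $\sum_k z_kz_k^*=1$. Tensor products are spatial C*-tensor products. **Theorem 5.1.** 1. There are a unique $*$-homomorphism $\Delta:H\to H\otimes H$ with $\Delta(u_{ij})=\sum_k u_{ik}\otimes u_{kj}$ and a unique $*$-homomorphism $\varepsilon:H\to\mathbb C$ with $\varepsilon(u_{ij})=\delta_{ij}$. 2. Suppose that $-\theta'_{12}=\theta'_{13}=-\theta'_{23}=\theta$. Then there is a unique $*$-homomorphism $\delta:A\to H\otimes A$ with $\delta(z_j)=\sum_{k=1}^3u_{jk}\otimes z_k$ for $j=1,2,3$. It is a left coaction of $H$ on $A$, that is, $(\Delta\otimes\mathrm{id})\circ\delta=(\mathrm{id}\otimes\delta)\circ\delta$ and $(\varepsilon\otimes\mathrm{id})\circ\delta=\mathrm{id}$. It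 is cotransitive: $A^{\mathrm{co}H}=\{a\in A:\delta(a)=1\otimes a\}=\mathbb C1$. 3. Conversely, for arbitrary $\theta'$, if there is an algebra homomorphism $\delta:A\to H\otimes A$ with $\delta(z_j)=\sum_{k=1}^3u_{jk}\otimes z_k$ for $j=1,2,3$, then $-\theta'_{12}$, $\theta'_{13}$ and $-\theta'_{23}$ are all congruent to $\theta$ modulo $\mathbb Z$. -/

import Mathlib

open MeasureTheory
open scoped TensorProduct ENNReal

noncomputable section

namespace ToricDeformation

/-! ### Spatial tensor products of operator algebras -/

section Spatial

variable (E F : Type*)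
  [NormedAddCommGroup E] [InnerProductSpace ℂ E]
  [NormedAddCommGroup F] [InnerProductSpace ℂ F]

/-- The Hilbert space tensor product: the completion of the algebraic tensor product for the inner
product `⟪a ⊗ b, c ⊗ d⟫ = ⟪a, c⟫ ⟪b, d⟫`. -/
def HilbertTensor : Type _ := UniformSpace.Completion (E ⊗[ℂ] F)

instance : NormedAddCommGroup (HilbertTensor E F) :=
  inferInstanceAs (NormedAddCommGroup (UniformSpace.Completion (E ⊗[ℂ] F)))

instance : InnerProductSpace ℂ (HilbertTensor E F) :=
  inferInstanceAs (InnerProductSpace ℂ (UniformSpace.Completion (E ⊗[ℂ] F)))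

instance : CompleteSpace (HilbertTensor E F) :=
  inferInstanceAs (CompleteSpace (UniformSpace.Completion (E ⊗[ℂ] F)))

/-- The inclusion of the algebraic tensor product. -/
def HilbertTensor.of : E ⊗[ℂ] F →ₗᵢ[ℂ] HilbertTensor E F :=
  UniformSpace.Completion.toComplₗᵢ

theorem HilbertTensor.denseRange_of : DenseRange (HilbertTensor.of E F) :=
  UniformSpace.Completion.denseRange_coe

variable {E F}

/-- The operator `S ⊗ T` on the Hilbert space tensor product (the continuous extension of the
algebraic tensor product of `S` and `T`). -/
def opTensor (S : E →L[ℂ] E) (T : F →L[ℂ] F) : HilbertTensor E F →L[ℂ] HilbertTensor E F :=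
  ((HilbertTensor.of E F).toContinuousLinearMap ∘L TensorProduct.mapL S T).extend
    (HilbertTensor.of E F).toContinuousLinearMap

theorem opTensor_of_tmul (S : E →L[ℂ] E) (T : F →L[ℂ] F) (x : E) (y : F) :
    opTensor S T (HilbertTensor.of E F (x ⊗ₜ[ℂ] y)) = HilbertTensor.of E F (S x ⊗ₜ[ℂ] T y) :=
  ContinuousLinearMap.extend_eq _ (HilbertTensor.denseRange_of E F)
    (HilbertTensor.of E F).isometry.isUniformInducing _

variable [CompleteSpace E] [CompleteSpace F]

/-- The spatial (minimal) tensor product of two algebras of bounded operators: the C*-algebra on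
the Hilbert space tensor product which is generated by all `a ⊗ b`. -/
def spatialTensor (A : StarSubalgebra ℂ (E →L[ℂ] E)) (B : StarSubalgebra ℂ (F →L[ℂ] F)) :
    StarSubalgebra ℂ (HilbertTensor E F →L[ℂ] HilbertTensor E F) :=
  (StarAlgebra.adjoin ℂ {T | ∃ a ∈ A, ∃ b ∈ B, T = opTensor a b}).topologicalClosure

/-- The elementary tensor `a ⊗ b` as an element of the spatial tensor product. -/
def elemTensor {A : StarSubalgebra ℂ (E →L[ℂ] E)} {B : StarSubalgebra ℂ (F →L[ℂ] F)}
    (a : A) (b : B) : spatialTensor A B :=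
  ⟨opTensor (a : E →L[ℂ] E) (b : F →L[ℂ] F),
    StarSubalgebra.le_topologicalClosure _
      (StarAlgebra.subset_adjoin ℂ _ ⟨a, a.2, b, b.2, rfl⟩)⟩

/-- The axioms of a left coaction `δ : A → H ⊗ A` for `(H, Δ, ε)`:
`(Δ ⊗ id) ∘ δ = (id ⊗ δ) ∘ δ` and `(ε ⊗ id) ∘ δ = id`. The maps `assoc`, `Δ₁ = Δ ⊗ id`,
`δ₁ = id ⊗ δ` and `ε₁ = ε ⊗ id` are the *-homomorphisms on the completed tensor products which are
prescribed on elementary tensors (each of them is determined by these values, since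
*-homomorphisms between C*-algebras are continuous). -/
structure IsLeftCoaction (H : StarSubalgebra ℂ (E →L[ℂ] E)) (A : StarSubalgebra ℂ (F →L[ℂ] F))
    (Δ : H →⋆ₐ[ℂ] spatialTensor H H) (ε : H →⋆ₐ[ℂ] ℂ) (δ : A →⋆ₐ[ℂ] spatialTensor H A) :
    Prop where
  coassoc : ∃ (assoc : spatialTensor (spatialTensor H H) A ≃⋆ₐ[ℂ]
        spatialTensor H (spatialTensor H A))
      (Δ₁ : spatialTensor H A →⋆ₐ[ℂ] spatialTensor (spatialTensor H H) A)
      (δ₁ : spatialTensor H A →⋆ₐ[ℂ] spatialTensor H (spatialTensor H A)),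
      (∀ (h k : H) (a : A),
        assoc (elemTensor (elemTensor h k) a) = elemTensor h (elemTensor k a)) ∧
      (∀ (h : H) (a : A), Δ₁ (elemTensor h a) = elemTensor (Δ h) a) ∧
      (∀ (h : H) (a : A), δ₁ (elemTensor h a) = elemTensor h (δ a)) ∧
      ∀ a : A, assoc (Δ₁ (δ a)) = δ₁ (δ a)
  counit : ∃ ε₁ : spatialTensor H A →⋆ₐ[ℂ] A,
      (∀ (h : H) (a : A), ε₁ (elemTensor h a) = ε h • a) ∧ ∀ a : A, ε₁ (δ a) = a

/-- The set of coinvariants `{a | δ a = 1 ⊗ a}`. -/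
def coinvariants {H : StarSubalgebra ℂ (E →L[ℂ] E)} {A : StarSubalgebra ℂ (F →L[ℂ] F)}
    (δ : A →⋆ₐ[ℂ] spatialTensor H A) : Set A :=
  {a | δ a = elemTensor 1 a}

end Spatial

/-! ### Deformation quantization along a torus action -/

/-- A continuous action of the torus `ℝⁿ / ℤⁿ` on `X`, written as a periodic action of `ℝⁿ`,
which preserves the measure `μ`. -/
structure TorusAction (n : ℕ) (X : Type*) [TopologicalSpace X] [MeasurableSpace X]
    (μ : Measure X) where
  act : (Fin n → ℝ) → X → X
  continuous_act : Continuous fun p : (Fin n → ℝ) × X => act p.1 p.2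
  act_zero : ∀ x, act 0 x = x
  act_add : ∀ s t x, act (s + t) x = act s (act t x)
  act_int : ∀ (m : Fin n → ℤ) x, act (fun i => (m i : ℝ)) x = x
  measurePreserving : ∀ t, MeasurePreserving (act t) μ μ

/-- `e^{2πi s}`. -/
def e2pi (s : ℝ) : ℂ := Complex.exp (2 * Real.pi * Complex.I * s)

theorem e2pi_zero : e2pi 0 = 1 := by simp [e2pi]

theorem e2pi_add (s t : ℝ) : e2pi (s + t) = e2pi s * e2pi t := by
  simp [e2pi, mul_add, Complex.exp_add]

theorem e2pi_int (m : ℤ) : e2pi m = 1 := by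
  rw [e2pi, Complex.exp_eq_one_iff]
  exact ⟨m, by push_cast; ring⟩

theorem norm_e2pi (s : ℝ) : ‖e2pi s‖ = 1 := by
  rw [e2pi, Complex.norm_exp]
  simp

theorem star_e2pi (s : ℝ) : star (e2pi s) = e2pi (-s) := by
  rw [e2pi, e2pi, Complex.star_def, ← Complex.exp_conj]
  simp [Complex.conj_ofNat]

theorem continuous_e2pi : Continuous e2pi := by unfold e2pi; fun_prop

section Deformation

variable {n : ℕ} {X : Type*} [TopologicalSpace X] [CompactSpace X] [MeasurableSpace X]
  [BorelSpace X] {μ : Measure X} [IsFiniteMeasure μ]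

/-- `f` lies in the isotypic component of weight `r ∈ ℤⁿ`: `α_t(f) = e^{2πi t·r} f`, where
`α_t(f)(x) = f(t · x)`. -/
def IsIsotypic (T : TorusAction n X μ) (r : Fin n → ℤ) (f : C(X, ℂ)) : Prop :=
  ∀ (t : Fin n → ℝ) (x : X),
    f (T.act t x) = e2pi (∑ j, t j * r j) * f x

variable (μ) in
/-- Multiplication by a continuous function, as an operator on `L²`. -/
def mulOp (f : C(X, ℂ)) : Lp ℂ 2 μ →L[ℂ] Lp ℂ 2 μ :=
  (ContinuousLinearMap.mul ℂ ℂ).holderL μ ∞ 2 2 (ContinuousMap.toLp ∞ μ ℂ f)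

/-- The operator `ξ ↦ ξ (t · -)` on `L²`. -/
def translateOp (T : TorusAction n X μ) (t : Fin n → ℝ) : Lp ℂ 2 μ →L[ℂ] Lp ℂ 2 μ :=
  (Lp.compMeasurePreservingₗᵢ ℂ (T.act t) (T.measurePreserving t)).toContinuousLinearMap

/-- The operator of left multiplication `g ↦ f ×_θ g` by a function `f` of weight `r`, extended to
`L²`. The deformed product is `f ×_θ g = e^{πi r·θs} f g` for `g` of weight `s`
(see `leftMul_isotypic`); since `e^{πi r·θs} g = g (t · -)` for `t = ½ rᵀθ`, it is the
multiplication by `f` after the translation by `½ rᵀθ`. -/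
def leftMul (T : TorusAction n X μ) (θ : Matrix (Fin n) (Fin n) ℝ) (r : Fin n → ℤ)
    (f : C(X, ℂ)) : Lp ℂ 2 μ →L[ℂ] Lp ℂ 2 μ :=
  mulOp μ f ∘L
    translateOp T ((1 / 2 : ℝ) • Matrix.vecMul (fun i => (r i : ℝ)) θ)

/-- The deformed product formula `f ×_θ g = e^{πi r·θs} f g` for isotypic `f` and `g`. -/
theorem leftMul_isotypic (T : TorusAction n X μ) (θ : Matrix (Fin n) (Fin n) ℝ)
    (r s : Fin n → ℤ) (f g : C(X, ℂ)) (hg : IsIsotypic T s g) :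
    leftMul T θ r f (ContinuousMap.toLp 2 μ ℂ g) =
      e2pi (1 / 2 * ((fun i => (r i : ℝ)) ⬝ᵥ θ.mulVec fun i => (s i : ℝ))) •
        ContinuousMap.toLp 2 μ ℂ (f * g) := by
  set t : Fin n → ℝ := (1 / 2 : ℝ) • Matrix.vecMul (fun i => (r i : ℝ)) θ with ht
  have hsum : ∑ j, t j * s j
      = 1 / 2 * ((fun i => (r i : ℝ)) ⬝ᵥ θ.mulVec fun i => (s i : ℝ)) := by
    rw [Matrix.dotProduct_mulVec, dotProduct, Finset.mul_sum]
    simp [ht, mul_assoc]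
  have h1 := ContinuousMap.coeFn_toLp (p := ∞) (𝕜 := ℂ) μ f
  have h2 := ContinuousMap.coeFn_toLp (p := 2) (𝕜 := ℂ) μ g
  have h3 := ContinuousMap.coeFn_toLp (p := 2) (𝕜 := ℂ) μ (f * g)
  have h4 := (T.measurePreserving t).quasiMeasurePreserving.ae_eq_comp h2
  have h5 := Lp.coeFn_compMeasurePreserving (ContinuousMap.toLp 2 μ ℂ g) (T.measurePreserving t)
  have h6 := (ContinuousLinearMap.mul ℂ ℂ).coeFn_holder (r := 2) (ContinuousMap.toLp ∞ μ ℂ f)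
    (translateOp T t (ContinuousMap.toLp 2 μ ℂ g))
  apply Lp.ext
  filter_upwards [h1, h3, h4, h5, h6, Lp.coeFn_smul (e2pi (∑ j, t j * s j))
    (ContinuousMap.toLp 2 μ ℂ (f * g))] with x h1 h3 h4 h5 h6 h7
  rw [← hsum, h7, Pi.smul_apply, h3]
  refine h6.trans ?_
  have : (translateOp T t (ContinuousMap.toLp 2 μ ℂ g)) x = g (T.act t x) := h5.trans h4
  rw [this, h1, hg t x]
  simp only [ContinuousLinearMap.mul_apply', ContinuousMap.mul_apply, smul_eq_mul]
  ring

/-- The deformed C*-algebra `C(X_θ)`: the C*-algebra of operators on `L²(X, μ)` which is generated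
by the left multiplications by isotypic continuous functions for the deformed product. -/
def deformedAlgebra (T : TorusAction n X μ) (θ : Matrix (Fin n) (Fin n) ℝ) :
    StarSubalgebra ℂ (Lp ℂ 2 μ →L[ℂ] Lp ℂ 2 μ) :=
  (StarAlgebra.adjoin ℂ
    {S | ∃ (r : Fin n → ℤ) (f : C(X, ℂ)), IsIsotypic T r f ∧ S = leftMul T θ r f}
    ).topologicalClosure

/-- An isotypic function as an element of the deformed algebra. -/
def toDeformed (T : TorusAction n X μ) (θ : Matrix (Fin n) (Fin n) ℝ) (r : Fin n → ℤ)
    (f : C(X, ℂ)) (hf : IsIsotypic T r f) : deformedAlgebra T θ :=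
  ⟨leftMul T θ r f, StarSubalgebra.le_topologicalClosure _
    (StarAlgebra.subset_adjoin ℂ _ ⟨r, f, hf, rfl⟩)⟩

end Deformation

/-! ### The quantum group `SU(3)_θ` -/

/-- The compact group `SU(3)`. -/
abbrev SU3 : Type := Matrix.specialUnitaryGroup (Fin 3) ℂ

instance : MeasurableSpace SU3 := borel SU3

instance : BorelSpace SU3 := ⟨rfl⟩

instance : IsTopologicalGroup SU3 where
  continuous_mul := by
    refine Continuous.subtype_mk ?_ _
    exact (continuous_subtype_val.comp continuous_fst).matrix_mul
      (continuous_subtype_val.comp continuous_snd)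
  continuous_inv := by
    refine Continuous.subtype_mk ?_ _
    exact continuous_subtype_val.matrix_conjTranspose

instance : CompactSpace SU3 := by
  have hsub : (Matrix.specialUnitaryGroup (Fin 3) ℂ : Set (Matrix (Fin 3) (Fin 3) ℂ)) ⊆
      Set.pi Set.univ fun _ => Set.pi Set.univ fun _ => Metric.closedBall (0 : ℂ) 1 := by
    intro U hU i _ j _
    rw [mem_closedBall_zero_iff]
    exact entry_norm_bound_of_unitary (Matrix.mem_specialUnitaryGroup_iff.1 hU).1 i j
  have hclosed :
      IsClosed (Matrix.specialUnitaryGroup (Fin 3) ℂ : Set (Matrix (Fin 3) (Fin 3) ℂ)) := by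
    have h1 : IsClosed {U : Matrix (Fin 3) (Fin 3) ℂ | U * U.conjTranspose = 1} :=
      isClosed_eq (continuous_id.matrix_mul continuous_id.matrix_conjTranspose) continuous_const
    have h2 : IsClosed {U : Matrix (Fin 3) (Fin 3) ℂ | U.det = 1} :=
      isClosed_eq continuous_id.matrix_det continuous_const
    convert h1.inter h2 using 1
    ext U
    simp only [SetLike.mem_coe, Matrix.mem_specialUnitaryGroup_iff, Matrix.mem_unitaryGroup_iff,
      Set.mem_inter_iff, Set.mem_ofPred_eq, Matrix.star_eq_conjTranspose]
  exact isCompact_iff_compactSpace.1 ((isCompact_univ_pi fun _ =>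
    isCompact_univ_pi fun _ => isCompact_closedBall (0 : ℂ) 1).of_isClosed_subset hclosed hsub)

/-- The normalized Haar measure of `SU(3)`. -/
def haarSU3 : Measure SU3 := Measure.haarMeasure ⊤

instance : haarSU3.IsHaarMeasure := by unfold haarSU3; infer_instance

instance : IsProbabilityMeasure haarSU3 := ⟨Measure.haarMeasure_self⟩

instance : haarSU3.IsMulRightInvariant where
  map_mul_right_eq_self g := by
    have : IsProbabilityMeasure (haarSU3.map (· * g)) :=
      Measure.isProbabilityMeasure_map (measurable_mul_const g).aemeasurable
    exact Measure.isHaarMeasure_eq_of_isProbabilityMeasure _ _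

/-- The element `diag(e^{2πi s₁}, e^{2πi s₂}, e^{-2πi (s₁ + s₂)})` of the maximal torus. -/
def maxTorus (s : Fin 2 → ℝ) : SU3 :=
  ⟨Matrix.diagonal ![e2pi (s 0), e2pi (s 1), e2pi (-(s 0 + s 1))], by
    rw [Matrix.mem_specialUnitaryGroup_iff, Matrix.mem_unitaryGroup_iff]
    constructor
    · rw [Matrix.star_eq_conjTranspose, Matrix.diagonal_conjTranspose, Matrix.diagonal_mul_diagonal,
        ← Matrix.diagonal_one]
      congr 1
      ext i
      fin_cases i <;> simp [star_e2pi, ← e2pi_add, e2pi_zero, -RCLike.star_def]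
    · rw [Matrix.det_diagonal, Fin.prod_univ_three]
      simp [← e2pi_add, e2pi_zero]⟩

theorem maxTorus_zero : maxTorus 0 = 1 := by
  apply Subtype.ext
  change Matrix.diagonal _ = (1 : Matrix (Fin 3) (Fin 3) ℂ)
  rw [← Matrix.diagonal_one]
  congr 1
  ext i
  fin_cases i <;> simp [e2pi_zero]

theorem maxTorus_add (s t : Fin 2 → ℝ) : maxTorus (s + t) = maxTorus s * maxTorus t := by
  apply Subtype.ext
  change Matrix.diagonal _ = Matrix.diagonal _ * Matrix.diagonal _
  rw [Matrix.diagonal_mul_diagonal]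
  congr 1
  ext i
  fin_cases i <;> simp [← e2pi_add]
  congr 1
  ring

theorem maxTorus_int (m : Fin 2 → ℤ) : maxTorus (fun i => (m i : ℝ)) = 1 := by
  apply Subtype.ext
  change Matrix.diagonal _ = (1 : Matrix (Fin 3) (Fin 3) ℂ)
  rw [← Matrix.diagonal_one]
  congr 1
  ext i
  fin_cases i
  · simp [e2pi_int]
  · simp [e2pi_int]
  · have h := e2pi_int (-(m 0 + m 1))
    push_cast at h
    simpa using h

theorem continuous_maxTorus : Continuous maxTorus := by
  refine Continuous.subtype_mk (Continuous.matrix_diagonal ?_) _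
  refine continuous_pi fun i => ?_
  fin_cases i
  · exact continuous_e2pi.comp (continuous_apply 0)
  · exact continuous_e2pi.comp (continuous_apply 1)
  · exact continuous_e2pi.comp ((continuous_apply 0).add (continuous_apply 1)).neg

/-- The action of `𝕋² × 𝕋²` on `SU(3)` underlying `α_{(x,s)}(f)(g) = f(exp(-x) g exp(s))`; the
parameters are ordered as `(x₁, x₂, s₁, s₂)`. -/
def actSU3 : TorusAction 4 SU3 haarSU3 where
  act t g := maxTorus ![-t 0, -t 1] * g * maxTorus ![t 2, t 3]
  continuous_act := by
    refine ((continuous_maxTorus.comp ?_).mul continuous_snd).mul (continuous_maxTorus.comp ?_)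
    · refine continuous_pi fun i => ?_
      fin_cases i
      · exact ((continuous_apply 0).comp continuous_fst).neg
      · exact ((continuous_apply 1).comp continuous_fst).neg
    · refine continuous_pi fun i => ?_
      fin_cases i
      · exact (continuous_apply (2 : Fin 4)).comp
          (continuous_fst (X := Fin 4 → ℝ) (Y := SU3))
      · exact (continuous_apply (3 : Fin 4)).comp
          (continuous_fst (X := Fin 4 → ℝ) (Y := SU3))
  act_zero g := by
    have h : (![0, 0] : Fin 2 → ℝ) = 0 := by ext i; fin_cases i <;> rfl
    simp [h, maxTorus_zero]
  act_add s t g := by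
    have h1 : (![-(s + t) 0, -(s + t) 1] : Fin 2 → ℝ) = ![-s 0, -s 1] + ![-t 0, -t 1] := by
      ext i; fin_cases i <;> simp <;> ring
    have h2 : (![(s + t) 2, (s + t) 3] : Fin 2 → ℝ) = ![t 2, t 3] + ![s 2, s 3] := by
      ext i; fin_cases i <;> simp <;> ring
    rw [h1, h2, maxTorus_add, maxTorus_add]
    simp only [mul_assoc]
  act_int m g := by
    have h1 : (![-(m 0 : ℝ), -(m 1 : ℝ)] : Fin 2 → ℝ) = fun i => ((![-m 0, -m 1] i : ℤ) : ℝ) := by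
      ext i; fin_cases i <;> simp
    have h2 : (![(m 2 : ℝ), (m 3 : ℝ)] : Fin 2 → ℝ) = fun i => ((![m 2, m 3] i : ℤ) : ℝ) := by
      ext i; fin_cases i <;> simp
    rw [h1, h2, maxTorus_int, maxTorus_int, one_mul, mul_one]
  measurePreserving t :=
    (measurePreserving_mul_right haarSU3 _).comp (measurePreserving_mul_left haarSU3 _)

/-- The skew matrix `J = θ ⊕ (-θ)` with `θ` the matrix `!![0, -θ; θ, 0]`. -/
def matJ (θ : ℝ) : Matrix (Fin 4) (Fin 4) ℝ :=
  !![0, -θ, 0, 0;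
     θ, 0, 0, 0;
     0, 0, 0, θ;
     0, 0, -θ, 0]

/-- The C*-algebra `C(SU(3)_θ)`. -/
def CSU3 (θ : ℝ) : StarSubalgebra ℂ (Lp ℂ 2 haarSU3 →L[ℂ] Lp ℂ 2 haarSU3) :=
  deformedAlgebra actSU3 (matJ θ)

/-- The coordinate function `u_{ij}` on `SU(3)`. -/
def coordU (i j : Fin 3) : C(SU3, ℂ) where
  toFun g := (g : Matrix (Fin 3) (Fin 3) ℂ) i j
  continuous_toFun := by
    exact (continuous_apply_apply i j).comp continuous_subtype_val

/-- The weights of the maximal torus on `ℂ³`. -/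
def wt : Fin 3 → Fin 2 → ℤ := ![![1, 0], ![0, 1], ![-1, -1]]

/-- The weight of `u_{ij}` under `𝕋² × 𝕋²`. -/
def weightU (i j : Fin 3) : Fin 4 → ℤ := ![-wt i 0, -wt i 1, wt j 0, wt j 1]

theorem isIsotypic_coordU (i j : Fin 3) : IsIsotypic actSU3 (weightU i j) (coordU i j) := by
  intro t g
  have h : coordU i j (actSU3.act t g) =
      ![e2pi (-t 0), e2pi (-t 1), e2pi (-(-t 0 + -t 1))] i * coordU i j g *
        ![e2pi (t 2), e2pi (t 3), e2pi (-(t 2 + t 3))] j := by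
    change ((Matrix.diagonal _ * (g : Matrix (Fin 3) (Fin 3) ℂ) * Matrix.diagonal _ :
      Matrix (Fin 3) (Fin 3) ℂ)) i j = _
    rw [Matrix.mul_diagonal, Matrix.diagonal_mul]
    rfl
  rw [h, mul_right_comm]
  congr 1
  simp only [weightU, wt, Fin.sum_univ_four]
  fin_cases i <;> fin_cases j <;> simp [← e2pi_add] <;> congr 1 <;> ring

/-- The generator `u_{ij}` of `C(SU(3)_θ)`. -/
def u (θ : ℝ) (i j : Fin 3) : CSU3 θ :=
  toDeformed actSU3 (matJ θ) (weightU i j) (coordU i j) (isIsotypic_coordU i j)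

/-! ### The noncommutative 5-sphere -/

/-- The unit sphere of `ℂ³`. -/
abbrev S5 : Type := Metric.sphere (0 : EuclideanSpace ℂ (Fin 3)) 1

/-- The surface measure of the 5-sphere. -/
def surfS5 : Measure S5 := (volume : Measure (EuclideanSpace ℂ (Fin 3))).toSphere

instance : IsFiniteMeasure surfS5 := by unfold surfS5; infer_instance

open scoped Pointwise in
/-- The surface measure is invariant under linear isometries. -/
theorem measurePreserving_surfS5
    (L : EuclideanSpace ℂ (Fin 3) ≃ₗᵢ[ℝ] EuclideanSpace ℂ (Fin 3)) (f : S5 → S5)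
    (hf : Continuous f) (h : ∀ x, (f x : EuclideanSpace ℂ (Fin 3)) = L x) :
    MeasurePreserving f surfS5 surfS5 := by
  refine ⟨hf.measurable, Measure.ext fun s hs => ?_⟩
  rw [Measure.map_apply hf.measurable hs, surfS5, Measure.toSphere_apply' _ hs,
    Measure.toSphere_apply' _ (hf.measurable hs)]
  have key : Set.Ioo (0 : ℝ) 1 • ((↑) '' (f ⁻¹' s) : Set (EuclideanSpace ℂ (Fin 3))) =
      L ⁻¹' (Set.Ioo (0 : ℝ) 1 • ((↑) '' s : Set (EuclideanSpace ℂ (Fin 3)))) := by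
    ext x
    simp only [Set.mem_smul, Set.mem_image, Set.mem_preimage]
    constructor
    · rintro ⟨c, hc, _, ⟨y, hy, rfl⟩, rfl⟩
      exact ⟨c, hc, _, ⟨f y, hy, rfl⟩, by rw [h, map_smul]⟩
    · rintro ⟨c, hc, _, ⟨y, hy, rfl⟩, hx⟩
      have hmem : L.symm (y : EuclideanSpace ℂ (Fin 3)) ∈
          Metric.sphere (0 : EuclideanSpace ℂ (Fin 3)) 1 := by
        rw [mem_sphere_zero_iff_norm, L.symm.norm_map]
        exact mem_sphere_zero_iff_norm.1 y.2
      refine ⟨c, hc, _, ⟨⟨L.symm y, hmem⟩, ?_, rfl⟩, ?_⟩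
      · have : f ⟨L.symm y, hmem⟩ = y := Subtype.ext (by rw [h]; exact L.apply_symm_apply _)
        rw [this]
        exact hy
      · apply L.injective
        rw [← hx, map_smul]
        exact congrArg _ (L.apply_symm_apply _)
  rw [key, L.measurePreserving.measure_preimage_emb
    L.toHomeomorph.measurableEmbedding]

/-- The action of `𝕋³` on the 5-sphere, `(t · z)_k = e^{2πi t_k} z_k`. -/
def actS5 : TorusAction 3 S5 surfS5 where
  act t z := ⟨WithLp.toLp 2 fun k => e2pi (t k) * (z : EuclideanSpace ℂ (Fin 3)) k, by
    have hz := mem_sphere_zero_iff_norm.1 z.2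
    rw [mem_sphere_zero_iff_norm, EuclideanSpace.norm_eq]
    rw [EuclideanSpace.norm_eq] at hz
    simpa [norm_e2pi] using hz⟩
  continuous_act := by
    refine Continuous.subtype_mk ((PiLp.continuous_toLp 2 _).comp (continuous_pi fun k => ?_)) _
    exact (continuous_e2pi.comp ((continuous_apply k).comp continuous_fst)).mul
      ((PiLp.continuous_apply 2 _ k).comp (continuous_subtype_val.comp continuous_snd))
  act_zero z := by
    apply Subtype.ext
    ext k
    simp [e2pi_zero]
  act_add s t z := by
    apply Subtype.ext
    ext k
    simp [e2pi_add, mul_assoc]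
  act_int m z := by
    apply Subtype.ext
    ext k
    simp [e2pi_int]
  measurePreserving t := by
    let c (k : Fin 3) : Circle := ⟨e2pi (t k), mem_sphere_zero_iff_norm.2 (norm_e2pi _)⟩
    refine measurePreserving_surfS5
      (LinearIsometryEquiv.piLpCongrRight 2 fun k => rotation (c k)) _ ?_ ?_
    · refine Continuous.subtype_mk ((PiLp.continuous_toLp 2 _).comp (continuous_pi fun k => ?_)) _
      exact continuous_const.mul
        ((PiLp.continuous_apply 2 _ k).comp continuous_subtype_val)
    · intro x
      ext k
      rw [LinearIsometryEquiv.piLpCongrRight_apply]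
      exact (rotation_apply (c k) _).symm

/-- The C*-algebra `C(S⁵_θ)` for a skew symmetric `3 × 3` matrix `θ`. -/
def CS5 (θ : Matrix (Fin 3) (Fin 3) ℝ) : StarSubalgebra ℂ (Lp ℂ 2 surfS5 →L[ℂ] Lp ℂ 2 surfS5) :=
  deformedAlgebra actS5 θ

/-- The coordinate function `z_k` on the 5-sphere. -/
def coordZ (k : Fin 3) : C(S5, ℂ) where
  toFun z := (z : EuclideanSpace ℂ (Fin 3)) k
  continuous_toFun := by fun_prop

theorem isIsotypic_coordZ (k : Fin 3) : IsIsotypic actS5 (Pi.single k 1) (coordZ k) := by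
  intro t z
  have h : ∑ j, t j * ((Pi.single k 1 : Fin 3 → ℤ) j : ℝ) = t k := by
    simp [Pi.single_apply]
  rw [h]
  rfl

/-- The generator `z_k` of `C(S⁵_θ)`. -/
def z (θ : Matrix (Fin 3) (Fin 3) ℝ) (k : Fin 3) : CS5 θ :=
  toDeformed actS5 θ (Pi.single k 1) (coordZ k) (isIsotypic_coordZ k)

/-! ### The structure maps -/

/-- `Δ` is the coproduct of `C(SU(3)_θ)`: `Δ(u_{ij}) = ∑ₖ u_{ik} ⊗ u_{kj}`. -/
def IsCoproduct (θ : ℝ) (Δ : CSU3 θ →⋆ₐ[ℂ] spatialTensor (CSU3 θ) (CSU3 θ)) : Prop :=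
  ∀ i j, Δ (u θ i j) = ∑ k, elemTensor (u θ i k) (u θ k j)

/-- `ε` is the counit of `C(SU(3)_θ)`: `ε(u_{ij}) = δ_{ij}`. -/
def IsCounit (θ : ℝ) (ε : CSU3 θ →⋆ₐ[ℂ] ℂ) : Prop :=
  ∀ i j, ε (u θ i j) = if i = j then 1 else 0

end ToricDeformation

end

open MeasureTheory
open scoped TensorProduct ENNReal

noncomputable section

namespace ToricDeformation

set_option linter.unusedSectionVars false

/-! ### Extension of maps given on generators -/

section Extension

/-! The algebras are concrete and are not given by a presentation, so a *-homomorphism prescribed on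
generators needs a norm estimate. It comes from intertwiners. Suppose that bounded operators `T k`
satisfy `b ∘ T k = T k ∘ a` for all pairs `(a, b)` in a *-algebra, and that their ranges span a
dense subspace. Then `‖b‖ ≤ ‖a‖` (`norm_snd_le_of_intertwine`), and the assignment on generators
extends to the C*-algebra (`exists_starAlgHom_of_intertwine`).

For the coproduct and the coaction the basic intertwiner is the undeformed pullback `U : P ↦ P (m x
y)` from `L²(Y)` to `L²(X) ⊗ L²(Y)`, where `m` is the group law of SU(3) or its action on the
sphere. A deformed generator is a multiplication after a translation by half of its twisted weight.
On SU(3) the translation belonging to `u_jk` is `g ↦ t_j g t_k⁻¹`, with elements `t_j` of the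
maximal torus (`twist`). The condition on `θ'` says that the translation belonging to `z_k` is `y ↦
t_k y`. Since `(t_j x t_k⁻¹)(t_k y) = t_j (x y)`, the inner twists cancel and `U` intertwines `z_j`
with `∑ u_jk ⊗ z_k`. The range of `U` is too small, but composing `U` with deformed right
multiplications, which commute with the deformed algebras, gives enough intertwiners
(`DeformedAction.exists_coaction`).

Cotransitivity: if `δ a = 1 ⊗ a`, then `U (a 1) = 1 ⊗ a 1`. Integrating over the group turns `U (a
1)` into a constant, because the action is transitive. So `a 1` is a scalar, and then `a` is one
because it commutes with right multiplications.

The counit is evaluation at the unit element, obtained from normalised bump functions shrinking to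
`1`, which are approximate joint eigenvectors of the generators and their adjoints.

For the converse, `δ` is applied to the commutation relation of `z_i` and `z_j`. A matrix
coefficient that sees only the term with `z_0 z_0` compares the phase of that relation with the
phase between `u_i0` and `u_j0`. -/

/-- The family `g` generates the C*-algebra `A`. -/
def Generates {A : Type*} [CStarAlgebra A] {ι : Type*} (g : ι → A) : Prop :=
  (StarAlgebra.adjoin ℂ (Set.range g)).topologicalClosure = ⊤

theorem StarAlgHom.continuous_of_cstar {A B : Type*} [CStarAlgebra A] [CStarAlgebra B]
    (φ : A →⋆ₐ[ℂ] B) : Continuous φ :=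
  AddMonoidHomClass.continuous_of_bound φ 1 fun a => by
    simpa using NonUnitalStarAlgHom.norm_apply_le φ a

theorem Generates.ext {A B : Type*} [CStarAlgebra A] [CStarAlgebra B] {ι : Type*} {g : ι → A}
    (hg : Generates g) {φ ψ : A →⋆ₐ[ℂ] B} (h : ∀ i, φ (g i) = ψ (g i)) : φ = ψ := by
  have h1 : (StarAlgebra.adjoin ℂ (Set.range g)).topologicalClosure ≤ StarAlgHom.equalizer φ ψ := by
    refine StarSubalgebra.topologicalClosure_minimal ?_ ?_
    · refine StarAlgebra.adjoin_le ?_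
      rintro _ ⟨i, rfl⟩
      exact h i
    · exact isClosed_eq (StarAlgHom.continuous_of_cstar φ) (StarAlgHom.continuous_of_cstar ψ)
  rw [hg] at h1
  ext a
  exact h1 (StarSubalgebra.mem_top (x := a))

theorem Generates.mem_of_isClosed {A : Type*} [CStarAlgebra A] {ι : Type*} {g : ι → A}
    (hg : Generates g) (S : StarSubalgebra ℂ A) (hS : IsClosed (S : Set A)) (h : ∀ i, g i ∈ S)
    (a : A) : a ∈ S := by
  have h1 : (StarAlgebra.adjoin ℂ (Set.range g)).topologicalClosure ≤ S := by
    refine StarSubalgebra.topologicalClosure_minimal (StarAlgebra.adjoin_le ?_) hS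
    rintro _ ⟨i, rfl⟩
    exact h i
  rw [hg] at h1
  exact h1 (StarSubalgebra.mem_top (x := a))

/-- A family in a closed *-subalgebra generates it if the algebra is contained in the closed
*-algebra generated by the family in the ambient C*-algebra. -/
theorem generates_of_le {B : Type*} [CStarAlgebra B] (A : StarSubalgebra ℂ B)
    [IsClosed (A : Set B)] {ι : Type*} (g : ι → A)
    (h : A ≤ (StarAlgebra.adjoin ℂ (Set.range fun i => (g i : B))).topologicalClosure) :
    Generates g := by
  rw [Generates, StarSubalgebra.eq_top_iff]
  intro a
  have h1 := h a.2
  have h2 : StarAlgebra.adjoin ℂ (Set.range fun i => (g i : B)) =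
      (StarAlgebra.adjoin ℂ (Set.range g)).map A.subtype := by
    rw [StarAlgHom.map_adjoin, ← Set.range_comp]
    rfl
  rw [← SetLike.mem_coe, StarSubalgebra.topologicalClosure_coe, h2, StarSubalgebra.coe_map] at h1
  rw [← SetLike.mem_coe, StarSubalgebra.topologicalClosure_coe]
  exact closure_subtype.2 h1

/-- If the map `g i ↦ h i` is norm decreasing on the *-algebra generated by the `g i`, then it
extends to the C*-algebra which they generate. -/
theorem exists_starAlgHom_of_norm_le {A B : Type*} [CStarAlgebra A] [CStarAlgebra B] {ι : Type*}
    (g : ι → A) (hg : Generates g) (h : ι → B)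
    (bound : ∀ x ∈ StarAlgebra.adjoin ℂ (Set.range fun i => (g i, h i)), ‖x.2‖ ≤ ‖x.1‖) :
    ∃ φ : A →⋆ₐ[ℂ] B, ∀ i, φ (g i) = h i := by
  set 𝒢 := (StarAlgebra.adjoin ℂ (Set.range fun i => (g i, h i))).topologicalClosure with h𝒢
  have hcl : IsClosed (𝒢 : Set (A × B)) := StarSubalgebra.isClosed_topologicalClosure _
  have hb : ∀ x ∈ 𝒢, ‖x.2‖ ≤ ‖x.1‖ := by
    have : closure ((StarAlgebra.adjoin ℂ (Set.range fun i => (g i, h i)) : Set (A × B))) ⊆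
        {x | ‖x.2‖ ≤ ‖x.1‖} :=
      closure_minimal bound (isClosed_le (by fun_prop) (by fun_prop))
    exact this
  -- On the graph the maximum norm of a pair is the norm of its first entry. So the projection to
  -- `A` is isometric, its range is closed, and it is onto because the range contains the
  -- generators.
  let p : 𝒢 →⋆ₐ[ℂ] A := (StarAlgHom.fst ℂ A B).comp 𝒢.subtype
  have hp : Isometry p := by
    refine AddMonoidHomClass.isometry_of_norm p fun x => ?_
    change ‖(x : A × B).1‖ = ‖(x : A × B)‖
    rw [Prod.norm_def, max_eq_left (hb x x.2)]
  have hmem : ∀ i, (g i, h i) ∈ 𝒢 := fun i =>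
    StarSubalgebra.le_topologicalClosure _ (StarAlgebra.subset_adjoin ℂ _ ⟨i, rfl⟩)
  have hsurj : Function.Surjective p := by
    intro a
    have hr : IsClosed (p.range : Set A) := by
      have : CompleteSpace 𝒢 := hcl.completeSpace_coe
      have := hp.isClosedEmbedding.isClosed_range
      exact this
    have := hg.mem_of_isClosed p.range hr (fun i => ⟨⟨_, hmem i⟩, rfl⟩) a
    exact this
  let e : 𝒢 ≃⋆ₐ[ℂ] A := StarAlgEquiv.ofBijective p ⟨hp.injective, hsurj⟩
  refine ⟨((StarAlgHom.snd ℂ A B).comp 𝒢.subtype).comp (e.symm : A →⋆ₐ[ℂ] 𝒢), fun i => ?_⟩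
  have : e.symm (g i) = ⟨_, hmem i⟩ := by
    rw [← e.injective.eq_iff]
    exact e.apply_symm_apply _
  change ((e.symm (g i) : 𝒢) : A × B).2 = h i
  rw [this]

/-- Taking roots of order `2 ^ n` removes the constant. It is this that makes bounded intertwiners
as good as isometric ones. -/
theorem le_of_pow_two_pow_le {x y C : ℝ} (hy : 0 ≤ y)
    (h : ∀ n : ℕ, x ^ 2 ^ n ≤ C * y ^ 2 ^ n) : x ≤ y := by
  by_contra! hlt
  rcases hy.eq_or_lt with rfl | hy
  · have := h 0
    simp at this
    linarith
  · have h1 : 1 < x / y := (one_lt_div hy).2 hlt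
    obtain ⟨n, hn⟩ := pow_unbounded_of_one_lt C h1
    have h2 : (x / y) ^ 2 ^ n ≤ C := by
      rw [div_pow, div_le_iff₀ (by positivity)]
      exact h n
    have h3 : (x / y) ^ n ≤ (x / y) ^ 2 ^ n := pow_le_pow_right₀ h1.le Nat.lt_two_pow_self.le
    linarith

variable {E K : Type*} [NormedAddCommGroup E] [InnerProductSpace ℂ E] [CompleteSpace E]
  [NormedAddCommGroup K] [InnerProductSpace ℂ K] [CompleteSpace K]

/-- Repeated squaring by Cauchy–Schwarz: `‖c ξ‖² = ⟪ξ, c² ξ⟫ ≤ ‖c² ξ‖` for self-adjoint `c` and a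
unit vector `ξ`. -/
theorem norm_apply_pow_two_pow_le (b : K →L[ℂ] K) (hb : IsSelfAdjoint b) (ξ : K) (hξ : ‖ξ‖ = 1)
    (n : ℕ) : ‖b ξ‖ ^ 2 ^ n ≤ ‖(b ^ 2 ^ n) ξ‖ := by
  induction n with
  | zero => simp
  | succ n ih =>
    have hc : IsSelfAdjoint (b ^ 2 ^ n) := hb.pow _
    calc ‖b ξ‖ ^ 2 ^ (n + 1) = (‖b ξ‖ ^ 2 ^ n) ^ 2 := by rw [← pow_mul, pow_succ]
      _ ≤ ‖(b ^ 2 ^ n) ξ‖ ^ 2 := by gcongr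
      _ = ‖inner ℂ ξ ((b ^ 2 ^ (n + 1)) ξ)‖ := by
        have h2 : (b ^ 2 ^ n * b ^ 2 ^ n) ξ = (b ^ 2 ^ n) ((b ^ 2 ^ n) ξ) := rfl
        rw [pow_succ 2 n, pow_mul, pow_two (b ^ 2 ^ n), h2, ← ContinuousLinearMap.adjoint_inner_left, ← ContinuousLinearMap.star_eq_adjoint,
          hc.star_eq, inner_self_eq_norm_sq_to_K]
        simp
      _ ≤ ‖ξ‖ * ‖(b ^ 2 ^ (n + 1)) ξ‖ := norm_inner_le_norm _ _
      _ = _ := by rw [hξ, one_mul]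

variable (A : StarSubalgebra ℂ (E →L[ℂ] E)) (B : StarSubalgebra ℂ (K →L[ℂ] K))

/-- If the elements `(a, b)` of a *-algebra of pairs of operators are intertwined by bounded
operators whose ranges span a dense subspace, then `‖b‖ ≤ ‖a‖`. -/
theorem norm_snd_le_of_intertwine (𝒢 : StarSubalgebra ℂ (A × B)) {κ : Type*}
    (T : κ → E →L[ℂ] K)
    (hT : ∀ x ∈ 𝒢, ∀ k, (x.2 : K →L[ℂ] K) ∘L T k = T k ∘L (x.1 : E →L[ℂ] E))
    (hd : Dense (Submodule.span ℂ (⋃ k, Set.range (T k)) : Set K)) :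
    ∀ x ∈ 𝒢, ‖x.2‖ ≤ ‖x.1‖ := by
  -- The constant depends on the vector but not on the pair `x`, because `b (T F) = T (a F)` is
  -- bounded by `‖T‖ ‖F‖ ‖a‖`.
  have hbdd : ∀ ξ ∈ Submodule.span ℂ (⋃ k, Set.range (T k)), ∃ C : ℝ, ∀ x ∈ 𝒢,
      ‖(x.2 : K →L[ℂ] K) ξ‖ ≤ C * ‖x.1‖ := by
    intro ξ hξ
    induction hξ using Submodule.span_induction with
    | mem ξ hξ =>
      obtain ⟨k, F, rfl⟩ := Set.mem_iUnion.1 hξ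
      refine ⟨‖T k‖ * ‖F‖, fun x hx => ?_⟩
      have : (x.2 : K →L[ℂ] K) (T k F) = T k ((x.1 : E →L[ℂ] E) F) :=
        DFunLike.congr_fun (hT x hx k) F
      rw [this, mul_assoc, mul_comm ‖F‖]
      exact (T k).le_of_opNorm_le_of_le le_rfl ((x.1 : E →L[ℂ] E).le_opNorm F)
    | zero => exact ⟨0, fun x _ => by simp⟩
    | add ξ η _ _ h1 h2 =>
      obtain ⟨C, hC⟩ := h1
      obtain ⟨D, hD⟩ := h2
      refine ⟨C + D, fun x hx => ?_⟩
      rw [map_add, add_mul]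
      exact (norm_add_le _ _).trans (add_le_add (hC x hx) (hD x hx))
    | smul c ξ _ h1 =>
      obtain ⟨C, hC⟩ := h1
      refine ⟨‖c‖ * C, fun x hx => ?_⟩
      rw [map_smul, norm_smul, mul_assoc]
      exact mul_le_mul_of_nonneg_left (hC x hx) (norm_nonneg _)
  have key : ∀ x ∈ 𝒢, IsSelfAdjoint x → ‖x.2‖ ≤ ‖x.1‖ := by
    intro x hx hsa
    have hb : IsSelfAdjoint (x.2 : K →L[ℂ] K) :=
      congrArg (fun y : A × B => (y.2 : K →L[ℂ] K)) hsa
    refine (x.2 : K →L[ℂ] K).opNorm_le_bound (norm_nonneg _) fun ξ => ?_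
    refine closure_minimal (s := (Submodule.span ℂ (⋃ k, Set.range (T k)) : Set K))
      (t := {ξ | ‖(x.2 : K →L[ℂ] K) ξ‖ ≤ ‖x.1‖ * ‖ξ‖}) ?_
      (isClosed_le (by fun_prop) (by fun_prop)) (hd ξ)
    have hunit : ∀ ξ ∈ Submodule.span ℂ (⋃ k, Set.range (T k)), ‖ξ‖ = 1 →
        ‖(x.2 : K →L[ℂ] K) ξ‖ ≤ ‖x.1‖ := by
      intro ξ hξ h1
      obtain ⟨C, hC⟩ := hbdd ξ hξ
      -- All powers of `x` lie in `𝒢`, so the same `C` serves for every `x ^ 2 ^ n`.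
      refine le_of_pow_two_pow_le (C := |C|) (norm_nonneg _) fun n => ?_
      refine (norm_apply_pow_two_pow_le _ hb ξ h1 n).trans ?_
      refine (hC (x ^ 2 ^ n) (pow_mem hx _)).trans ?_
      refine mul_le_mul (le_abs_self C) ?_ (norm_nonneg _) (abs_nonneg C)
      exact norm_pow_le' _ (by positivity)
    intro ξ hξ
    rcases eq_or_ne ξ 0 with rfl | hne
    · simp
    · have hpos : 0 < ‖ξ‖ := norm_pos_iff.2 hne
      have := hunit (((‖ξ‖⁻¹ : ℝ) : ℂ) • ξ) (Submodule.smul_mem _ _ hξ)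
        (by rw [norm_smul]; simp [hpos.ne'])
      rw [map_smul, norm_smul] at this
      simp only [Complex.norm_real, norm_inv, norm_norm] at this
      rwa [inv_mul_le_iff₀ hpos, mul_comm] at this
  intro x hx
  have h1 := key (star x * x) (mul_mem (star_mem hx) hx) (IsSelfAdjoint.star_mul_self x)
  have h2 : ‖(star x * x).2‖ = ‖x.2‖ * ‖x.2‖ := CStarRing.norm_star_mul_self (x := (x.2 : K →L[ℂ] K))
  have h3 : ‖(star x * x).1‖ = ‖x.1‖ * ‖x.1‖ := CStarRing.norm_star_mul_self (x := (x.1 : E →L[ℂ] E))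
  rw [h2, h3] at h1
  exact (mul_self_le_mul_self_iff (norm_nonneg _) (norm_nonneg _)).2 h1

variable {A B}

/-- A pair `(a, b)` is intertwined by `T`, and so is the pair of the adjoints. -/
def Intertwines (T : E →L[ℂ] K) (a : E →L[ℂ] E) (b : K →L[ℂ] K) : Prop :=
  b ∘L T = T ∘L a ∧ star b ∘L T = T ∘L star a

theorem Intertwines.comp {L : Type*} [NormedAddCommGroup L] [InnerProductSpace ℂ L]
    [CompleteSpace L] {T : E →L[ℂ] K} {S : K →L[ℂ] L} {a : E →L[ℂ] E} {b : K →L[ℂ] K}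
    {c : L →L[ℂ] L} (hS : Intertwines S b c) (hT : Intertwines T a b) :
    Intertwines (S ∘L T) a c := by
  constructor
  · rw [← ContinuousLinearMap.comp_assoc, hS.1, ContinuousLinearMap.comp_assoc, hT.1,
      ContinuousLinearMap.comp_assoc]
  · rw [← ContinuousLinearMap.comp_assoc, hS.2, ContinuousLinearMap.comp_assoc, hT.2,
      ContinuousLinearMap.comp_assoc]

/-- The *-algebra of all pairs which are intertwined by `T`. -/
def intertwined (T : E →L[ℂ] K) : StarSubalgebra ℂ ((E →L[ℂ] E) × (K →L[ℂ] K)) where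
  carrier := {x | Intertwines T x.1 x.2}
  mul_mem' := by
    rintro ⟨a, b⟩ ⟨c, d⟩ ⟨h1, h2⟩ ⟨h3, h4⟩
    simp only at h1 h2 h3 h4
    constructor
    · change (b ∘L d) ∘L T = T ∘L (a ∘L c)
      rw [ContinuousLinearMap.comp_assoc, h3, ← ContinuousLinearMap.comp_assoc, h1,
        ContinuousLinearMap.comp_assoc]
    · change star (b * d) ∘L T = T ∘L star (a * c)
      rw [star_mul, star_mul]
      change (star d ∘L star b) ∘L T = T ∘L (star c ∘L star a)
      rw [ContinuousLinearMap.comp_assoc, h2, ← ContinuousLinearMap.comp_assoc, h4,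
        ContinuousLinearMap.comp_assoc]
  add_mem' := by
    rintro ⟨a, b⟩ ⟨c, d⟩ ⟨h1, h2⟩ ⟨h3, h4⟩
    simp only at h1 h2 h3 h4
    constructor
    · change (b + d) ∘L T = T ∘L (a + c)
      rw [ContinuousLinearMap.add_comp, ContinuousLinearMap.comp_add, h1, h3]
    · change star (b + d) ∘L T = T ∘L star (a + c)
      rw [star_add, star_add, ContinuousLinearMap.add_comp, ContinuousLinearMap.comp_add, h2, h4]
  algebraMap_mem' r := by
    constructor
    · ext x
      simp [Algebra.algebraMap_eq_smul_one]
    · ext x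
      simp [Algebra.algebraMap_eq_smul_one]
  star_mem' := by
    rintro ⟨a, b⟩ ⟨h1, h2⟩
    exact ⟨h2, by simpa using h1⟩

theorem mem_intertwined {T : E →L[ℂ] K} {x : (E →L[ℂ] E) × (K →L[ℂ] K)} :
    x ∈ intertwined T ↔ Intertwines T x.1 x.2 := Iff.rfl

theorem isClosed_intertwined (T : E →L[ℂ] K) :
    IsClosed (intertwined T : Set ((E →L[ℂ] E) × (K →L[ℂ] K))) := by
  change IsClosed {x : (E →L[ℂ] E) × (K →L[ℂ] K) |
    x.2 ∘L T = T ∘L x.1 ∧ star x.2 ∘L T = T ∘L star x.1}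
  refine (isClosed_eq ?_ ?_).inter (isClosed_eq ?_ ?_)
  · exact continuous_snd.clm_comp continuous_const
  · exact continuous_const.clm_comp continuous_fst
  · exact continuous_snd.star.clm_comp continuous_const
  · exact continuous_const.clm_comp continuous_fst.star

/-- A map on generators which is implemented by sufficiently many intertwiners extends to a
*-homomorphism with the same intertwiners. -/
theorem exists_starAlgHom_of_intertwine [IsClosed (A : Set (E →L[ℂ] E))]
    [IsClosed (B : Set (K →L[ℂ] K))] {ι κ : Type*} (g : ι → A) (hg : Generates g) (h : ι → B)
    (T : κ → E →L[ℂ] K)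
    (hT : ∀ i k, Intertwines (T k) (g i : E →L[ℂ] E) (h i : K →L[ℂ] K))
    (hd : Dense (Submodule.span ℂ (⋃ k, Set.range (T k)) : Set K)) :
    ∃ φ : A →⋆ₐ[ℂ] B, (∀ i, φ (g i) = h i) ∧
      ∀ (a : A) k, Intertwines (T k) (a : E →L[ℂ] E) (φ a : K →L[ℂ] K) := by
  let j : A × B →⋆ₐ[ℂ] (E →L[ℂ] E) × (K →L[ℂ] K) :=
    (A.subtype.comp (StarAlgHom.fst ℂ A B)).prod (B.subtype.comp (StarAlgHom.snd ℂ A B))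
  obtain ⟨φ, hφ⟩ := exists_starAlgHom_of_norm_le g hg h (by
    refine norm_snd_le_of_intertwine A B _ T (fun x hx k => ?_) hd
    have h1 : StarAlgebra.adjoin ℂ (Set.range fun i => (g i, h i)) ≤
        (intertwined (T k)).comap j := by
      refine StarAlgebra.adjoin_le ?_
      rintro _ ⟨i, rfl⟩
      exact hT i k
    exact (h1 hx).1)
  refine ⟨φ, hφ, fun a k => ?_⟩
  let p : A →⋆ₐ[ℂ] (E →L[ℂ] E) × (K →L[ℂ] K) := A.subtype.prod (B.subtype.comp φ)
  refine hg.mem_of_isClosed ((intertwined (T k)).comap p) ?_ (fun i => ?_) a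
  · have hp : Continuous p :=
      continuous_subtype_val.prodMk
        (continuous_subtype_val.comp (StarAlgHom.continuous_of_cstar φ))
    exact (isClosed_intertwined (T k)).preimage hp
  · change Intertwines (T k) (g i : E →L[ℂ] E) (φ (g i) : K →L[ℂ] K)
    rw [hφ]
    exact hT i k

end Extension

/-! ### Operators on Hilbert space tensor products -/

section HilbertTensor

variable {E F E' F' E'' F'' G : Type*}
  [NormedAddCommGroup E] [InnerProductSpace ℂ E]
  [NormedAddCommGroup F] [InnerProductSpace ℂ F]
  [NormedAddCommGroup E'] [InnerProductSpace ℂ E']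
  [NormedAddCommGroup F'] [InnerProductSpace ℂ F']
  [NormedAddCommGroup E''] [InnerProductSpace ℂ E'']
  [NormedAddCommGroup F''] [InnerProductSpace ℂ F'']
  [NormedAddCommGroup G] [InnerProductSpace ℂ G]

/-- The elementary tensor `x ⊗ y` in the Hilbert space tensor product, as a bilinear map. -/
def HilbertTensor.tmul : E →L[ℂ] F →L[ℂ] HilbertTensor E F :=
  (ContinuousLinearMap.compL ℂ F (E ⊗[ℂ] F) (HilbertTensor E F)
    (HilbertTensor.of E F).toContinuousLinearMap) ∘L TensorProduct.mkL ℂ E F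

theorem HilbertTensor.tmul_apply (x : E) (y : F) :
    HilbertTensor.tmul x y = HilbertTensor.of E F (x ⊗ₜ y) := rfl

theorem HilbertTensor.inner_tmul (x x' : E) (y y' : F) :
    inner ℂ (HilbertTensor.tmul x y) (HilbertTensor.tmul x' y') = inner ℂ x x' * inner ℂ y y' := by
  rw [tmul_apply, tmul_apply, LinearIsometry.inner_map_map, TensorProduct.inner_tmul]

theorem HilbertTensor.norm_tmul (x : E) (y : F) : ‖HilbertTensor.tmul x y‖ = ‖x‖ * ‖y‖ := by
  rw [tmul_apply, LinearIsometry.norm_map, TensorProduct.norm_tmul]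

/-- Closure arguments in one variable at a time, with the other held fixed. This is how density of
ranges passes to tensor products of intertwiners. -/
theorem HilbertTensor.dense_span_tmul {s : Set E} {t : Set F}
    (hs : Dense (Submodule.span ℂ s : Set E)) (ht : Dense (Submodule.span ℂ t : Set F)) :
    Dense (Submodule.span ℂ (Set.image2 (fun x y => HilbertTensor.tmul x y) s t) :
      Set (HilbertTensor E F)) := by
  set W := (Submodule.span ℂ (Set.image2 (fun x y => HilbertTensor.tmul (E := E) (F := F) x y) s t))
    with hW
  have h1 : ∀ x ∈ s, ∀ y : F, HilbertTensor.tmul x y ∈ W.topologicalClosure := by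
    intro x hx y
    have hsub : Submodule.span ℂ t ≤
        W.topologicalClosure.comap (HilbertTensor.tmul (E := E) (F := F) x).toLinearMap := by
      rw [Submodule.span_le]
      intro y hy
      exact W.le_topologicalClosure (Submodule.subset_span ⟨x, hx, y, hy, rfl⟩)
    exact closure_minimal hsub
      (W.isClosed_topologicalClosure.preimage (HilbertTensor.tmul x).continuous) (ht y)
  have h2 : ∀ (x : E) (y : F), HilbertTensor.tmul x y ∈ W.topologicalClosure := by
    intro x y
    have hsub : Submodule.span ℂ s ≤
        W.topologicalClosure.comap
          ((HilbertTensor.tmul (E := E) (F := F)).flip y).toLinearMap := by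
      rw [Submodule.span_le]
      intro x hx
      exact h1 x hx y
    exact closure_minimal hsub
      (W.isClosed_topologicalClosure.preimage
        ((HilbertTensor.tmul (E := E) (F := F)).flip y).continuous) (hs x)
  have h3 : Set.range (HilbertTensor.of E F) ⊆ W.topologicalClosure := by
    rintro _ ⟨v, rfl⟩
    induction v using TensorProduct.induction_on with
    | zero => rw [map_zero]; exact zero_mem _
    | tmul x y => exact h2 x y
    | add v w hv hw => rw [map_add]; exact add_mem hv hw
  intro v
  exact closure_minimal h3 W.isClosed_topologicalClosure (HilbertTensor.denseRange_of E F v)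

theorem HilbertTensor.clm_ext {S T : HilbertTensor E F →L[ℂ] G}
    (h : ∀ x y, S (HilbertTensor.tmul x y) = T (HilbertTensor.tmul x y)) : S = T := by
  refine ContinuousLinearMap.ext_on (HilbertTensor.dense_span_tmul (s := Set.univ) (t := Set.univ)
    ?_ ?_) ?_
  · simp
  · simp
  · rintro _ ⟨x, -, y, -, rfl⟩
    exact h x y

/-- The tensor product of two bounded operators. -/
def mapTensor (S : E →L[ℂ] E') (T : F →L[ℂ] F') : HilbertTensor E F →L[ℂ] HilbertTensor E' F' :=
  ((HilbertTensor.of E' F').toContinuousLinearMap ∘L TensorProduct.mapL S T).extend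
    (HilbertTensor.of E F).toContinuousLinearMap

theorem mapTensor_tmul (S : E →L[ℂ] E') (T : F →L[ℂ] F') (x : E) (y : F) :
    mapTensor S T (HilbertTensor.tmul x y) = HilbertTensor.tmul (S x) (T y) :=
  ContinuousLinearMap.extend_eq _ (HilbertTensor.denseRange_of E F)
    (HilbertTensor.of E F).isometry.isUniformInducing _

theorem opTensor_eq_mapTensor (S : E →L[ℂ] E) (T : F →L[ℂ] F) : opTensor S T = mapTensor S T := rfl

theorem opTensor_tmul (S : E →L[ℂ] E) (T : F →L[ℂ] F) (x : E) (y : F) :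
    opTensor S T (HilbertTensor.tmul x y) = HilbertTensor.tmul (S x) (T y) :=
  mapTensor_tmul S T x y

theorem mapTensor_comp (S' : E' →L[ℂ] E'') (T' : F' →L[ℂ] F'') (S : E →L[ℂ] E') (T : F →L[ℂ] F') :
    mapTensor S' T' ∘L mapTensor S T = mapTensor (S' ∘L S) (T' ∘L T) :=
  HilbertTensor.clm_ext fun x y => by simp [mapTensor_tmul]

theorem opTensor_mul (S S' : E →L[ℂ] E) (T T' : F →L[ℂ] F) :
    opTensor S T * opTensor S' T' = opTensor (S * S') (T * T') :=
  mapTensor_comp S T S' T'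

theorem opTensor_one : opTensor (1 : E →L[ℂ] E) (1 : F →L[ℂ] F) = 1 :=
  HilbertTensor.clm_ext fun x y => by simp [opTensor_tmul]

theorem star_opTensor [CompleteSpace E] [CompleteSpace F] (S : E →L[ℂ] E) (T : F →L[ℂ] F) :
    star (opTensor S T) = opTensor (star S) (star T) := by
  symm
  rw [ContinuousLinearMap.star_eq_adjoint (opTensor S T)]
  refine (ContinuousLinearMap.eq_adjoint_iff _ _).2 fun v w => ?_
  -- The inner product is only conjugate linear in its first argument. So the adjoint relation is
  -- extended from elementary tensors in the second argument, and then, after conjugating, in the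
  -- other one.
  have h : ∀ (x : E) (y : F),
      innerSL ℂ (opTensor (star S) (star T) (HilbertTensor.tmul x y)) =
        innerSL ℂ (HilbertTensor.tmul x y) ∘L opTensor S T := by
    intro x y
    refine HilbertTensor.clm_ext fun x' y' => ?_
    simp only [innerSL_apply_apply, ContinuousLinearMap.comp_apply, opTensor_tmul,
      HilbertTensor.inner_tmul, ContinuousLinearMap.star_eq_adjoint,
      ContinuousLinearMap.adjoint_inner_left]
  have h2 : innerSL ℂ w ∘L opTensor (star S) (star T) = innerSL ℂ (opTensor S T w) := by
    refine HilbertTensor.clm_ext fun x y => ?_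
    have := DFunLike.congr_fun (h x y) w
    simp only [innerSL_apply_apply, ContinuousLinearMap.comp_apply] at this ⊢
    rw [← inner_conj_symm, this, inner_conj_symm]
  have := DFunLike.congr_fun h2 v
  simp only [innerSL_apply_apply, ContinuousLinearMap.comp_apply] at this
  rw [← inner_conj_symm, this, inner_conj_symm]

theorem opTensor_add_left (S S' : E →L[ℂ] E) (T : F →L[ℂ] F) :
    opTensor (S + S') T = opTensor S T + opTensor S' T :=
  HilbertTensor.clm_ext fun x y => by simp [opTensor_tmul]

theorem opTensor_add_right (S : E →L[ℂ] E) (T T' : F →L[ℂ] F) :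
    opTensor S (T + T') = opTensor S T + opTensor S T' :=
  HilbertTensor.clm_ext fun x y => by simp [opTensor_tmul]

/-- A map between families of vectors which preserves inner products extends to a linear isometry
on the closed span. -/
theorem exists_clm_of_inner_eq {ι : Type*} [CompleteSpace F] (v : ι → E) (w : ι → F)
    (h : ∀ i j, inner ℂ (v i) (v j) = inner ℂ (w i) (w j))
    (hv : Dense (Submodule.span ℂ (Set.range v) : Set E)) :
    ∃ U : E →L[ℂ] F, ∀ i, U (v i) = w i := by
  have hnorm : ∀ c : ι →₀ ℂ,
      ‖Finsupp.linearCombination ℂ w c‖ = ‖Finsupp.linearCombination ℂ v c‖ := by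
    intro c
    have : inner ℂ (Finsupp.linearCombination ℂ w c) (Finsupp.linearCombination ℂ w c) =
        inner ℂ (Finsupp.linearCombination ℂ v c) (Finsupp.linearCombination ℂ v c) := by
      simp only [Finsupp.linearCombination_apply, Finsupp.sum, sum_inner, inner_sum,
        inner_smul_left, inner_smul_right, h]
    rw [inner_self_eq_norm_sq_to_K, inner_self_eq_norm_sq_to_K] at this
    exact (sq_eq_sq₀ (norm_nonneg _) (norm_nonneg _)).1 (by exact_mod_cast this)
  have hd : DenseRange (Finsupp.linearCombination ℂ v) := by
    have h2 := Finsupp.range_linearCombination ℂ (v := v)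
    rw [DenseRange, ← LinearMap.coe_range, h2]
    exact hv
  refine ⟨(Finsupp.linearCombination ℂ w).extendOfNorm (Finsupp.linearCombination ℂ v),
    fun i => ?_⟩
  have := LinearMap.extendOfNorm_eq (f := Finsupp.linearCombination ℂ w) hd
    ⟨1, fun c => by rw [hnorm, one_mul]⟩ (Finsupp.single i 1)
  simpa using this

end HilbertTensor

section SpatialTensor

variable {E F E' F' : Type*}
  [NormedAddCommGroup E] [InnerProductSpace ℂ E] [CompleteSpace E]
  [NormedAddCommGroup F] [InnerProductSpace ℂ F] [CompleteSpace F]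
  [NormedAddCommGroup E'] [InnerProductSpace ℂ E'] [CompleteSpace E']
  [NormedAddCommGroup F'] [InnerProductSpace ℂ F'] [CompleteSpace F']

theorem Intertwines.mapTensor {S : E →L[ℂ] E'} {T : F →L[ℂ] F'} {a : E →L[ℂ] E} {a' : E' →L[ℂ] E'}
    {b : F →L[ℂ] F} {b' : F' →L[ℂ] F'} (hS : Intertwines S a a') (hT : Intertwines T b b') :
    Intertwines (mapTensor S T) (opTensor a b) (opTensor a' b') := by
  constructor
  · rw [opTensor_eq_mapTensor, opTensor_eq_mapTensor, mapTensor_comp, mapTensor_comp, hS.1, hT.1]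
  · rw [star_opTensor, star_opTensor, opTensor_eq_mapTensor, opTensor_eq_mapTensor, mapTensor_comp,
      mapTensor_comp, hS.2, hT.2]

theorem intertwines_id (a : E →L[ℂ] E) : Intertwines (ContinuousLinearMap.id ℂ E) a a :=
  ⟨rfl, rfl⟩

instance isClosed_spatialTensor (A : StarSubalgebra ℂ (E →L[ℂ] E))
    (B : StarSubalgebra ℂ (F →L[ℂ] F)) :
    IsClosed (spatialTensor A B : Set (HilbertTensor E F →L[ℂ] HilbertTensor E F)) :=
  StarSubalgebra.isClosed_topologicalClosure _

variable {A : StarSubalgebra ℂ (E →L[ℂ] E)} {B : StarSubalgebra ℂ (F →L[ℂ] F)}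
  {A' : StarSubalgebra ℂ (E' →L[ℂ] E')} {B' : StarSubalgebra ℂ (F' →L[ℂ] F')}

theorem generates_elemTensor :
    Generates (fun p : A × B => (elemTensor p.1 p.2 : spatialTensor A B)) := by
  refine generates_of_le _ _ (le_of_eq ?_)
  change (StarAlgebra.adjoin ℂ _).topologicalClosure = _
  congr 2
  ext T
  constructor
  · rintro ⟨a, ha, b, hb, rfl⟩
    exact ⟨(⟨a, ha⟩, ⟨b, hb⟩), rfl⟩
  · rintro ⟨p, rfl⟩
    exact ⟨_, p.1.2, _, p.2.2, rfl⟩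

theorem elemTensor_mul (a a' : A) (b b' : B) :
    (elemTensor a b * elemTensor a' b' : spatialTensor A B) = elemTensor (a * a') (b * b') :=
  Subtype.ext (opTensor_mul _ _ _ _)

theorem star_elemTensor (a : A) (b : B) :
    star (elemTensor a b : spatialTensor A B) = elemTensor (star a) (star b) :=
  Subtype.ext (star_opTensor _ _)

variable (A B) in
/-- The embedding `a ↦ a ⊗ 1`. -/
def tensorInl : A →⋆ₐ[ℂ] spatialTensor A B where
  toFun a := elemTensor a 1
  map_one' := Subtype.ext opTensor_one
  map_mul' a b := by rw [elemTensor_mul, mul_one]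
  map_zero' := Subtype.ext (HilbertTensor.clm_ext fun x y => by simp [elemTensor, opTensor_tmul])
  map_add' a b := Subtype.ext (opTensor_add_left _ _ _)
  commutes' r := Subtype.ext (HilbertTensor.clm_ext fun x y => by
    simp [elemTensor, opTensor_tmul, Algebra.algebraMap_eq_smul_one])
  map_star' a := by rw [star_elemTensor, star_one]

variable (A B) in
/-- The embedding `b ↦ 1 ⊗ b`. -/
def tensorInr : B →⋆ₐ[ℂ] spatialTensor A B where
  toFun b := elemTensor 1 b
  map_one' := Subtype.ext opTensor_one
  map_mul' a b := by rw [elemTensor_mul, mul_one]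
  map_zero' := Subtype.ext (HilbertTensor.clm_ext fun x y => by simp [elemTensor, opTensor_tmul])
  map_add' a b := Subtype.ext (opTensor_add_right _ _ _)
  commutes' r := Subtype.ext (HilbertTensor.clm_ext fun x y => by
    simp [elemTensor, opTensor_tmul, Algebra.algebraMap_eq_smul_one])
  map_star' a := by rw [star_elemTensor, star_one]

theorem elemTensor_eq_inl_mul_inr (a : A) (b : B) :
    elemTensor a b = tensorInl A B a * tensorInr A B b := by
  change _ = elemTensor a 1 * elemTensor 1 b
  rw [elemTensor_mul, mul_one, one_mul]

/-- A family generates the spatial tensor product if its closed *-algebra contains the elementary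
tensors `g i ⊗ 1` and `1 ⊗ h j` for generators `g i` and `h j`. -/
theorem generates_spatialTensor [IsClosed (A : Set (E →L[ℂ] E))] [IsClosed (B : Set (F →L[ℂ] F))]
    {ι ι' κ : Type*} {g : ι → A} (hg : Generates g) {h : ι' → B} (hh : Generates h)
    (k : κ → spatialTensor A B) (h1 : ∀ i, elemTensor (g i) 1 ∈ Set.range k)
    (h2 : ∀ j, elemTensor 1 (h j) ∈ Set.range k) : Generates k := by
  set S := (StarAlgebra.adjoin ℂ (Set.range k)).topologicalClosure with hS
  have hcl : IsClosed (S : Set (spatialTensor A B)) := StarSubalgebra.isClosed_topologicalClosure _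
  have hmem : ∀ x ∈ Set.range k, x ∈ S := fun x hx =>
    StarSubalgebra.le_topologicalClosure _ (StarAlgebra.subset_adjoin ℂ _ hx)
  have hl : ∀ a, tensorInl A B a ∈ S := hg.mem_of_isClosed (S.comap (tensorInl A B))
    (hcl.preimage (StarAlgHom.continuous_of_cstar (tensorInl A B))) (fun i => hmem _ (h1 i))
  have hr : ∀ b, tensorInr A B b ∈ S := hh.mem_of_isClosed (S.comap (tensorInr A B))
    (hcl.preimage (StarAlgHom.continuous_of_cstar (tensorInr A B))) (fun i => hmem _ (h2 i))
  rw [Generates, StarSubalgebra.eq_top_iff]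
  refine generates_elemTensor.mem_of_isClosed S hcl fun p => ?_
  change elemTensor p.1 p.2 ∈ S
  rw [elemTensor_eq_inl_mul_inr]
  exact mul_mem (hl _) (hr _)

theorem generates_id [IsClosed (A : Set (E →L[ℂ] E))] : Generates (id : A → A) := by
  rw [Generates, StarSubalgebra.eq_top_iff]
  exact fun a => StarSubalgebra.le_topologicalClosure _ (StarAlgebra.subset_adjoin ℂ _ ⟨a, rfl⟩)

/-- The tensor product of two *-homomorphisms which are implemented by intertwiners. -/
theorem exists_tensor_hom {κ κ' : Type*} (φ : A →⋆ₐ[ℂ] A') (S : κ → E →L[ℂ] E')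
    (hS : ∀ (a : A) k, Intertwines (S k) (a : E →L[ℂ] E) (φ a : E' →L[ℂ] E'))
    (hSd : Dense (Submodule.span ℂ (⋃ k, Set.range (S k)) : Set E'))
    (ψ : B →⋆ₐ[ℂ] B') (T : κ' → F →L[ℂ] F')
    (hT : ∀ (b : B) k, Intertwines (T k) (b : F →L[ℂ] F) (ψ b : F' →L[ℂ] F'))
    (hTd : Dense (Submodule.span ℂ (⋃ k, Set.range (T k)) : Set F')) :
    ∃ χ : spatialTensor A B →⋆ₐ[ℂ] spatialTensor A' B',
      ∀ a b, χ (elemTensor a b) = elemTensor (φ a) (ψ b) := by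
  -- The operators `S k ⊗ T k'` intertwine `a ⊗ b` with `φ a ⊗ ψ b`, and their ranges again span a
  -- dense subspace.
  obtain ⟨χ, hχ, -⟩ := exists_starAlgHom_of_intertwine
    (fun p : A × B => (elemTensor p.1 p.2 : spatialTensor A B)) generates_elemTensor
    (fun p : A × B => (elemTensor (φ p.1) (ψ p.2) : spatialTensor A' B'))
    (fun k : κ × κ' => mapTensor (S k.1) (T k.2))
    (fun p k => (hS p.1 k.1).mapTensor (hT p.2 k.2)) (by
      refine (HilbertTensor.dense_span_tmul hSd hTd).mono ?_
      refine Submodule.span_mono ?_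
      rintro _ ⟨x, hx, y, hy, rfl⟩
      obtain ⟨k, x, rfl⟩ := Set.mem_iUnion.1 hx
      obtain ⟨k', y, rfl⟩ := Set.mem_iUnion.1 hy
      exact Set.mem_iUnion.2 ⟨(k, k'), HilbertTensor.tmul x y, mapTensor_tmul _ _ _ _⟩)
  exact ⟨χ, fun a b => hχ (a, b)⟩

/-- Regrouping triple tensors preserves inner products. It therefore gives operators `U` and `V` in
the two directions with dense range, and these implement *-homomorphisms that are inverse to each
other on generators. -/
theorem exists_spatialTensor_assoc {G : Type*} [NormedAddCommGroup G] [InnerProductSpace ℂ G]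
    [CompleteSpace G] {C : StarSubalgebra ℂ (G →L[ℂ] G)} [IsClosed (A : Set (E →L[ℂ] E))]
    [IsClosed (C : Set (G →L[ℂ] G))] :
    ∃ assoc : spatialTensor (spatialTensor A B) C ≃⋆ₐ[ℂ] spatialTensor A (spatialTensor B C),
      ∀ a b c, assoc (elemTensor (elemTensor a b) c) = elemTensor a (elemTensor b c) := by
  have hdL : Dense (Submodule.span ℂ (Set.range fun p : E × F × G =>
      HilbertTensor.tmul (HilbertTensor.tmul p.1 p.2.1) p.2.2) :
      Set (HilbertTensor (HilbertTensor E F) G)) := by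
    refine (HilbertTensor.dense_span_tmul (HilbertTensor.dense_span_tmul (s := Set.univ)
      (t := Set.univ) (by simp) (by simp)) (t := Set.univ) (by simp)).mono
      (Submodule.span_mono ?_)
    rintro _ ⟨_, ⟨x, -, y, -, rfl⟩, z, -, rfl⟩
    exact ⟨(x, y, z), rfl⟩
  have hdR : Dense (Submodule.span ℂ (Set.range fun p : E × F × G =>
      HilbertTensor.tmul p.1 (HilbertTensor.tmul p.2.1 p.2.2)) :
      Set (HilbertTensor E (HilbertTensor F G))) := by
    refine (HilbertTensor.dense_span_tmul (s := Set.univ) (by simp)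
      (HilbertTensor.dense_span_tmul (s := Set.univ)
      (t := Set.univ) (by simp) (by simp))).mono (Submodule.span_mono ?_)
    rintro _ ⟨x, -, _, ⟨y, -, z, -, rfl⟩, rfl⟩
    exact ⟨(x, y, z), rfl⟩
  obtain ⟨U, hU⟩ := exists_clm_of_inner_eq _ (fun p : E × F × G =>
      HilbertTensor.tmul p.1 (HilbertTensor.tmul p.2.1 p.2.2))
      (fun i j => by simp only [HilbertTensor.inner_tmul, mul_assoc]) hdL
  obtain ⟨V, hV⟩ := exists_clm_of_inner_eq _ (fun p : E × F × G =>
      HilbertTensor.tmul (HilbertTensor.tmul p.1 p.2.1) p.2.2)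
      (fun i j => by simp only [HilbertTensor.inner_tmul, mul_assoc]) hdR
  have hgL : Generates (fun p : A × B × C =>
      (elemTensor (elemTensor p.1 p.2.1) p.2.2 : spatialTensor (spatialTensor A B) C)) :=
    generates_spatialTensor generates_elemTensor generates_id _
      (fun p => ⟨(p.1, p.2, 1), rfl⟩)
      (fun c => ⟨(1, 1, c), congrArg (fun x => elemTensor x c) (map_one (tensorInl A B))⟩)
  have hgR : Generates (fun p : A × B × C =>
      (elemTensor p.1 (elemTensor p.2.1 p.2.2) : spatialTensor A (spatialTensor B C))) :=
    generates_spatialTensor generates_id generates_elemTensor _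
      (fun a => ⟨(a, 1, 1), congrArg (fun x => elemTensor a x) (map_one (tensorInl B C))⟩)
      (fun p => ⟨(1, p.1, p.2), rfl⟩)
  have hUe : ∀ (a : E →L[ℂ] E) (b : F →L[ℂ] F) (c : G →L[ℂ] G),
      opTensor a (opTensor b c) ∘L U = U ∘L opTensor (opTensor a b) c := by
    intro a b c
    refine ContinuousLinearMap.ext_on hdL ?_
    rintro _ ⟨p, rfl⟩
    have h1 := hU p
    have h2 := hU (a p.1, b p.2.1, c p.2.2)
    simp only [ContinuousLinearMap.comp_apply, opTensor_tmul] at h1 h2 ⊢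
    rw [h1, h2, opTensor_tmul, opTensor_tmul]
  have hVe : ∀ (a : E →L[ℂ] E) (b : F →L[ℂ] F) (c : G →L[ℂ] G),
      opTensor (opTensor a b) c ∘L V = V ∘L opTensor a (opTensor b c) := by
    intro a b c
    refine ContinuousLinearMap.ext_on hdR ?_
    rintro _ ⟨p, rfl⟩
    have h1 := hV p
    have h2 := hV (a p.1, b p.2.1, c p.2.2)
    simp only [ContinuousLinearMap.comp_apply, opTensor_tmul] at h1 h2 ⊢
    rw [h1, h2, opTensor_tmul, opTensor_tmul]
  obtain ⟨φ, hφ, -⟩ := exists_starAlgHom_of_intertwine _ hgL (fun p : A × B × C =>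
      (elemTensor p.1 (elemTensor p.2.1 p.2.2) : spatialTensor A (spatialTensor B C)))
    (fun _ : Unit => U)
    (fun p _ => ⟨hUe _ _ _, by
      simp only [elemTensor, star_opTensor]
      exact hUe _ _ _⟩)
    (hdR.mono (Submodule.span_mono (by
      rintro _ ⟨p, rfl⟩
      exact Set.mem_iUnion.2 ⟨(), _, hU p⟩)))
  obtain ⟨ψ, hψ, -⟩ := exists_starAlgHom_of_intertwine _ hgR (fun p : A × B × C =>
      (elemTensor (elemTensor p.1 p.2.1) p.2.2 : spatialTensor (spatialTensor A B) C))
    (fun _ : Unit => V)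
    (fun p _ => ⟨hVe _ _ _, by
      simp only [elemTensor, star_opTensor]
      exact hVe _ _ _⟩)
    (hdL.mono (Submodule.span_mono (by
      rintro _ ⟨p, rfl⟩
      exact Set.mem_iUnion.2 ⟨(), _, hV p⟩)))
  have h1 : ∀ a b c, φ (elemTensor (elemTensor a b) c) = elemTensor a (elemTensor b c) :=
    fun a b c => hφ (a, b, c)
  have h2 : ∀ a b c, ψ (elemTensor a (elemTensor b c)) = elemTensor (elemTensor a b) c :=
    fun a b c => hψ (a, b, c)
  have h3 : ψ.comp φ = StarAlgHom.id ℂ _ := hgL.ext fun p => by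
    change ψ (φ (elemTensor (elemTensor p.1 p.2.1) p.2.2)) = elemTensor (elemTensor p.1 p.2.1) p.2.2
    rw [h1, h2]
  have h4 : φ.comp ψ = StarAlgHom.id ℂ _ := hgR.ext fun p => by
    change φ (ψ (elemTensor p.1 (elemTensor p.2.1 p.2.2))) = elemTensor p.1 (elemTensor p.2.1 p.2.2)
    rw [h2, h1]
  exact ⟨StarAlgEquiv.ofStarAlgHom φ ψ h3 h4, h1⟩

end SpatialTensor

/-! ### Characters from approximate eigenvectors -/

section ApproximateEigenvectors

open Filter Topology

variable {E F K : Type*}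
  [NormedAddCommGroup E] [InnerProductSpace ℂ E] [CompleteSpace E]
  [NormedAddCommGroup F] [InnerProductSpace ℂ F] [CompleteSpace F]
  [NormedAddCommGroup K] [InnerProductSpace ℂ K] [CompleteSpace K]

/-- The *-algebra of the pairs which are asymptotically intertwined by a sequence of operators. -/
def asympIntertwined (S : ℕ → F →L[ℂ] K) : StarSubalgebra ℂ ((K →L[ℂ] K) × (F →L[ℂ] F)) where
  carrier := {x | Tendsto (fun n => x.1 ∘L S n - S n ∘L x.2) atTop (𝓝 0) ∧
    Tendsto (fun n => star x.1 ∘L S n - S n ∘L star x.2) atTop (𝓝 0)}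
  mul_mem' := by
    have key : ∀ (a a' : K →L[ℂ] K) (b b' : F →L[ℂ] F),
        Tendsto (fun n => a ∘L S n - S n ∘L b) atTop (𝓝 0) →
        Tendsto (fun n => a' ∘L S n - S n ∘L b') atTop (𝓝 0) →
        Tendsto (fun n => (a * a') ∘L S n - S n ∘L (b * b')) atTop (𝓝 0) := by
      intro a a' b b' h h'
      -- Telescoping: `a a' S - S b b' = a (a' S - S b') + (a S - S b) b'`.
      have h1 := (((ContinuousLinearMap.compL ℂ F K K) a).continuous.tendsto 0).comp h'
      have h2 := ((((ContinuousLinearMap.compL ℂ F F K).flip) b').continuous.tendsto 0).comp h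
      have h3 := h1.add h2
      simp only [map_zero, add_zero] at h3
      refine h3.congr fun n => ?_
      ext y
      simp
    rintro ⟨a, b⟩ ⟨a', b'⟩ ⟨h1, h2⟩ ⟨h3, h4⟩
    refine ⟨key _ _ _ _ h1 h3, ?_⟩
    have := key _ _ _ _ h4 h2
    rwa [← star_mul, ← star_mul] at this
  add_mem' := by
    rintro ⟨a, b⟩ ⟨a', b'⟩ ⟨h1, h2⟩ ⟨h3, h4⟩
    constructor
    · have := h1.add h3
      rw [add_zero] at this
      refine this.congr fun n => ?_
      ext y
      simp
      abel
    · have := h2.add h4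
      rw [add_zero] at this
      refine this.congr fun n => ?_
      ext y
      simp
      abel
  algebraMap_mem' r := by
    constructor
    · refine tendsto_const_nhds.congr fun n => ?_
      ext y
      simp [Algebra.algebraMap_eq_smul_one]
    · refine tendsto_const_nhds.congr fun n => ?_
      ext y
      simp [Algebra.algebraMap_eq_smul_one]
  star_mem' := by
    rintro ⟨a, b⟩ ⟨h1, h2⟩
    exact ⟨h2, by simpa using h1⟩

/-- As the `S n` are isometries, `‖b y‖ = ‖S n (b y)‖` differs from `‖a (S n y)‖` by at most a null
sequence. -/
theorem norm_snd_le_of_mem_asympIntertwined {S : ℕ → F →L[ℂ] K} (hS : ∀ n y, ‖S n y‖ = ‖y‖)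
    {x : (K →L[ℂ] K) × (F →L[ℂ] F)} (hx : x ∈ asympIntertwined S) : ‖x.2‖ ≤ ‖x.1‖ := by
  refine x.2.opNorm_le_bound (norm_nonneg _) fun y => ?_
  have h1 : Tendsto (fun n => ‖(x.1 ∘L S n - S n ∘L x.2) y‖) atTop (𝓝 0) := by
    have := ((ContinuousLinearMap.apply ℂ K y).continuous.tendsto 0).comp hx.1
    simpa using this.norm
  have h2 : Tendsto (fun n => ‖(x.1 ∘L S n - S n ∘L x.2) y‖ + ‖x.1‖ * ‖y‖) atTop
      (𝓝 (0 + ‖x.1‖ * ‖y‖)) := h1.add tendsto_const_nhds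
  rw [zero_add] at h2
  refine ge_of_tendsto' h2 fun n => ?_
  have h3 : S n (x.2 y) = x.1 (S n y) - (x.1 ∘L S n - S n ∘L x.2) y := by simp
  rw [← hS n (x.2 y), h3]
  refine (norm_sub_le _ _).trans ?_
  rw [add_comm]
  gcongr
  rw [← hS n y]
  exact x.1.le_opNorm _

theorem exists_hom_of_asympIntertwined {A : StarSubalgebra ℂ (K →L[ℂ] K)}
    [IsClosed (A : Set (K →L[ℂ] K))] {B : Type*} [CStarAlgebra B] (π : B →⋆ₐ[ℂ] F →L[ℂ] F)
    (hπ : ∀ b, ‖π b‖ = ‖b‖) {ι : Type*} {g : ι → A} (hg : Generates g) (h : ι → B)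
    (S : ℕ → F →L[ℂ] K) (hS : ∀ n y, ‖S n y‖ = ‖y‖)
    (H : ∀ i, ((g i : K →L[ℂ] K), π (h i)) ∈ asympIntertwined S) :
    ∃ φ : A →⋆ₐ[ℂ] B, ∀ i, φ (g i) = h i := by
  let j : A × B →⋆ₐ[ℂ] (K →L[ℂ] K) × (F →L[ℂ] F) :=
    (A.subtype.comp (StarAlgHom.fst ℂ A B)).prod (π.comp (StarAlgHom.snd ℂ A B))
  refine exists_starAlgHom_of_norm_le g hg h fun x hx => ?_
  have h1 : StarAlgebra.adjoin ℂ (Set.range fun i => (g i, h i)) ≤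
      (asympIntertwined S).comap j := by
    refine StarAlgebra.adjoin_le ?_
    rintro _ ⟨i, rfl⟩
    exact H i
  have h2 := norm_snd_le_of_mem_asympIntertwined hS (h1 hx)
  change ‖π x.2‖ ≤ _ at h2
  rwa [hπ] at h2

variable {A : StarSubalgebra ℂ (E →L[ℂ] E)} [IsClosed (A : Set (E →L[ℂ] E))] {ι : Type*}
  {g : ι → A} {c : ι → ℂ} {ξ : ℕ → E}

/-- The isometries are the embeddings `ℂ → E` with image spanned by `ξ n`. The condition on adjoints
is needed because `ξ n` has to be an approximate eigenvector for the whole *-algebra. -/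
theorem exists_character (hg : Generates g) (hξ : ∀ n, ‖ξ n‖ = 1)
    (h1 : ∀ i, Tendsto (fun n => (g i : E →L[ℂ] E) (ξ n) - c i • ξ n) atTop (𝓝 0))
    (h2 : ∀ i, Tendsto (fun n => star (g i : E →L[ℂ] E) (ξ n) - star (c i) • ξ n) atTop (𝓝 0)) :
    ∃ ε : A →⋆ₐ[ℂ] ℂ, ∀ i, ε (g i) = c i := by
  refine exists_hom_of_asympIntertwined (StarAlgHom.ofId ℂ (ℂ →L[ℂ] ℂ)) (fun b => ?_) hg c
    (fun n => ContinuousLinearMap.toSpanSingleton ℂ (ξ n)) (fun n y => ?_) fun i => ⟨?_, ?_⟩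
  · change ‖algebraMap ℂ (ℂ →L[ℂ] ℂ) b‖ = _
    rw [norm_algebraMap']
  · simp [norm_smul, hξ]
  · have := ((ContinuousLinearMap.toSpanSingletonCLE (𝕜 := ℂ) (E := E)).continuous.tendsto 0).comp
      (h1 i)
    rw [map_zero] at this
    refine this.congr fun n => ?_
    ext
    simp [Algebra.algebraMap_eq_smul_one, StarAlgHom.ofId_apply]
  · have := ((ContinuousLinearMap.toSpanSingletonCLE (𝕜 := ℂ) (E := E)).continuous.tendsto 0).comp
      (h2 i)
    rw [map_zero] at this
    refine this.congr fun n => ?_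
    ext
    simp [Algebra.algebraMap_eq_smul_one, StarAlgHom.ofId_apply]

/-- The isometries `y ↦ ξ n ⊗ y` asymptotically intertwine `g i ⊗ 1` with the scalar `c i`, and `1 ⊗
b` exactly with `b`. This gives `ε ⊗ id` on the completed tensor product. -/
theorem exists_slice {B : StarSubalgebra ℂ (F →L[ℂ] F)} [IsClosed (B : Set (F →L[ℂ] F))]
    (hg : Generates g) (hξ : ∀ n, ‖ξ n‖ = 1)
    (h1 : ∀ i, Tendsto (fun n => (g i : E →L[ℂ] E) (ξ n) - c i • ξ n) atTop (𝓝 0))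
    (h2 : ∀ i, Tendsto (fun n => star (g i : E →L[ℂ] E) (ξ n) - star (c i) • ξ n) atTop (𝓝 0))
    (ε : A →⋆ₐ[ℂ] ℂ) (hε : ∀ i, ε (g i) = c i) :
    ∃ ε₁ : spatialTensor A B →⋆ₐ[ℂ] B, ∀ a b, ε₁ (elemTensor a b) = ε a • b := by
  have hk : Generates (Sum.elim (fun i => elemTensor (g i) 1) (fun b => elemTensor 1 b) :
      ι ⊕ B → spatialTensor A B) :=
    generates_spatialTensor hg generates_id _ (fun i => ⟨Sum.inl i, rfl⟩)
      (fun b => ⟨Sum.inr b, rfl⟩)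
  obtain ⟨φ, hφ⟩ := exists_hom_of_asympIntertwined B.subtype (fun b => rfl) hk
    (Sum.elim (fun i => algebraMap ℂ B (c i)) id)
    (fun n => HilbertTensor.tmul (ξ n)) (fun n y => by
      rw [HilbertTensor.norm_tmul, hξ, one_mul]) (by
      rintro (i | b)
      · constructor
        · have := ((HilbertTensor.tmul (E := E) (F := F)).continuous.tendsto 0).comp (h1 i)
          rw [map_zero] at this
          refine this.congr fun n => ?_
          ext y
          simp [elemTensor, opTensor_tmul, Algebra.algebraMap_eq_smul_one]
        · have := ((HilbertTensor.tmul (E := E) (F := F)).continuous.tendsto 0).comp (h2 i)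
          rw [map_zero] at this
          refine this.congr fun n => ?_
          ext y
          simp [elemTensor, opTensor_tmul, star_opTensor, Algebra.algebraMap_eq_smul_one]
      · constructor
        · refine tendsto_const_nhds.congr fun n => ?_
          ext y
          simp [elemTensor, opTensor_tmul]
        · refine tendsto_const_nhds.congr fun n => ?_
          ext y
          simp [elemTensor, opTensor_tmul, star_opTensor])
  have hl : ∀ a, φ (tensorInl A B a) = algebraMap ℂ B (ε a) := by
    have : φ.comp (tensorInl A B) = (StarAlgHom.ofId ℂ B).comp ε := hg.ext fun i => by
      change φ (elemTensor (g i) 1) = algebraMap ℂ B (ε (g i))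
      rw [hε]
      exact hφ (Sum.inl i)
    exact fun a => DFunLike.congr_fun this a
  refine ⟨φ, fun a b => ?_⟩
  rw [elemTensor_eq_inl_mul_inr, map_mul, hl, Algebra.smul_def]
  congr 1
  exact hφ (Sum.inr b)

end ApproximateEigenvectors

/-! ### Multiplications and translations on `L²` -/

section Operators

variable {n : ℕ} {X : Type*} [TopologicalSpace X] [CompactSpace X] [MeasurableSpace X]
  [BorelSpace X] {μ : Measure X} [IsFiniteMeasure μ]

/-- The homeomorphism `x ↦ t · x` as a continuous map. -/
def TorusAction.actMap (T : TorusAction n X μ) (t : Fin n → ℝ) : C(X, X) :=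
  ⟨T.act t, T.continuous_act.comp (continuous_const.prodMk continuous_id)⟩

@[simp]
theorem TorusAction.actMap_apply (T : TorusAction n X μ) (t : Fin n → ℝ) (x : X) :
    T.actMap t x = T.act t x := rfl

theorem TorusAction.act_neg_act (T : TorusAction n X μ) (t : Fin n → ℝ) (x : X) :
    T.act (-t) (T.act t x) = x := by
  rw [← T.act_add, neg_add_cancel, T.act_zero]

theorem TorusAction.act_act_neg (T : TorusAction n X μ) (t : Fin n → ℝ) (x : X) :
    T.act t (T.act (-t) x) = x := by
  rw [← T.act_add, add_neg_cancel, T.act_zero]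

theorem TorusAction.integral_act (T : TorusAction n X μ) (t : Fin n → ℝ) (f : X → ℂ) :
    ∫ x, f (T.act t x) ∂μ = ∫ x, f x ∂μ := by
  let e : X ≃ₜ X :=
    { toFun := T.act t
      invFun := T.act (-t)
      left_inv := T.act_neg_act t
      right_inv := T.act_act_neg t
      continuous_toFun := (T.actMap t).continuous
      continuous_invFun := (T.actMap (-t)).continuous }
  exact (T.measurePreserving t).integral_comp e.measurableEmbedding f

theorem mulOp_toLp (f g : C(X, ℂ)) :
    mulOp μ f (ContinuousMap.toLp 2 μ ℂ g) = ContinuousMap.toLp 2 μ ℂ (f * g) := by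
  have h1 := ContinuousMap.coeFn_toLp (p := ∞) (𝕜 := ℂ) μ f
  have h2 := ContinuousMap.coeFn_toLp (p := 2) (𝕜 := ℂ) μ g
  have h3 := ContinuousMap.coeFn_toLp (p := 2) (𝕜 := ℂ) μ (f * g)
  have h6 := (ContinuousLinearMap.mul ℂ ℂ).coeFn_holder (r := 2) (ContinuousMap.toLp ∞ μ ℂ f)
    (ContinuousMap.toLp 2 μ ℂ g)
  apply Lp.ext
  filter_upwards [h1, h2, h3, h6] with x h1 h2 h3 h6
  refine h6.trans ?_
  rw [h1, h2, h3]
  rfl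

theorem translateOp_toLp (T : TorusAction n X μ) (t : Fin n → ℝ) (g : C(X, ℂ)) :
    translateOp T t (ContinuousMap.toLp 2 μ ℂ g) =
      ContinuousMap.toLp 2 μ ℂ (g.comp (T.actMap t)) := by
  have h2 := ContinuousMap.coeFn_toLp (p := 2) (𝕜 := ℂ) μ g
  have h3 := ContinuousMap.coeFn_toLp (p := 2) (𝕜 := ℂ) μ (g.comp (T.actMap t))
  have h4 := (T.measurePreserving t).quasiMeasurePreserving.ae_eq_comp h2
  have h5 := Lp.coeFn_compMeasurePreserving (ContinuousMap.toLp 2 μ ℂ g) (T.measurePreserving t)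
  apply Lp.ext
  filter_upwards [h3, h4, h5] with x h3 h4 h5
  rw [h3]
  exact h5.trans h4

/-- The operator `ξ ↦ f · ξ(t · -)` on `L²`. -/
def mulTranslate (T : TorusAction n X μ) (f : C(X, ℂ)) (t : Fin n → ℝ) :
    Lp ℂ 2 μ →L[ℂ] Lp ℂ 2 μ :=
  mulOp μ f ∘L translateOp T t

theorem mulTranslate_toLp (T : TorusAction n X μ) (f : C(X, ℂ)) (t : Fin n → ℝ) (g : C(X, ℂ)) :
    mulTranslate T f t (ContinuousMap.toLp 2 μ ℂ g) =
      ContinuousMap.toLp 2 μ ℂ (f * g.comp (T.actMap t)) := by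
  rw [mulTranslate, ContinuousLinearMap.comp_apply, translateOp_toLp, mulOp_toLp]

theorem inner_toLp_eq (f g : C(X, ℂ)) :
    inner ℂ (ContinuousMap.toLp 2 μ ℂ f) (ContinuousMap.toLp 2 μ ℂ g) =
      ∫ x, star (f x) * g x ∂μ := by
  rw [ContinuousMap.inner_toLp]
  simp [mul_comm]

variable [NormalSpace X] [μ.WeaklyRegular]

theorem denseRange_toLp : DenseRange (ContinuousMap.toLp 2 μ ℂ : C(X, ℂ) →L[ℂ] Lp ℂ 2 μ) :=
  ContinuousMap.toLp_denseRange ℂ μ ℂ (by simp)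

theorem clm_ext_toLp {G : Type*} [NormedAddCommGroup G] [NormedSpace ℂ G]
    {S S' : Lp ℂ 2 μ →L[ℂ] G}
    (h : ∀ g : C(X, ℂ), S (ContinuousMap.toLp 2 μ ℂ g) = S' (ContinuousMap.toLp 2 μ ℂ g)) :
    S = S' :=
  ContinuousLinearMap.coeFn_injective (denseRange_toLp.equalizer S.continuous S'.continuous
    (funext h))

theorem mulTranslate_mul (T : TorusAction n X μ) (f g : C(X, ℂ)) (s t : Fin n → ℝ) :
    mulTranslate T f s * mulTranslate T g t =
      mulTranslate T (f * g.comp (T.actMap s)) (s + t) := by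
  refine clm_ext_toLp fun k => ?_
  change mulTranslate T f s (mulTranslate T g t _) = _
  rw [mulTranslate_toLp, mulTranslate_toLp, mulTranslate_toLp]
  congr 1
  ext x
  simp [mul_assoc, add_comm s t, T.act_add]

/-- Substitution of `(-t) · x` for `x` in the inner product, by invariance of the measure. -/
theorem star_mulTranslate (T : TorusAction n X μ) (f : C(X, ℂ)) (t : Fin n → ℝ) :
    star (mulTranslate T f t) = mulTranslate T (star (f.comp (T.actMap (-t)))) (-t) := by
  have h : ∀ g k : C(X, ℂ),
      inner ℂ (mulTranslate T (star (f.comp (T.actMap (-t)))) (-t) (ContinuousMap.toLp 2 μ ℂ g))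
        (ContinuousMap.toLp 2 μ ℂ k) =
      inner ℂ (ContinuousMap.toLp 2 μ ℂ g) (mulTranslate T f t (ContinuousMap.toLp 2 μ ℂ k)) := by
    intro g k
    rw [mulTranslate_toLp, mulTranslate_toLp, inner_toLp_eq, inner_toLp_eq,
      ← T.integral_act (-t) (fun x => star (g x) * _)]
    refine integral_congr_ae (Filter.Eventually.of_forall fun x => ?_)
    simp only [ContinuousMap.mul_apply, ContinuousMap.comp_apply, ContinuousMap.star_apply,
      TorusAction.actMap_apply, star_mul', star_star, T.act_act_neg]
    ring
  symm
  rw [ContinuousLinearMap.star_eq_adjoint (mulTranslate T f t)]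
  refine (ContinuousLinearMap.eq_adjoint_iff _ _).2 fun v w => ?_
  refine denseRange_toLp.induction_on₂ (p := fun v w => inner ℂ
    (mulTranslate T (star (f.comp (T.actMap (-t)))) (-t) v) w = inner ℂ v (mulTranslate T f t w))
    ?_ h v w
  exact isClosed_eq (by fun_prop) (by fun_prop)

theorem continuous_mulTranslate (T : TorusAction n X μ) (t : Fin n → ℝ) :
    Continuous fun f : C(X, ℂ) => mulTranslate T f t :=
  (((ContinuousLinearMap.mul ℂ ℂ).holderL μ ∞ 2 2).continuous.comp
    (ContinuousMap.toLp ∞ μ ℂ).continuous).clm_comp continuous_const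

theorem mulTranslate_add (T : TorusAction n X μ) (f g : C(X, ℂ)) (t : Fin n → ℝ) :
    mulTranslate T (f + g) t = mulTranslate T f t + mulTranslate T g t :=
  clm_ext_toLp fun k => by
    simp only [mulTranslate_toLp, add_apply, add_mul, map_add]

theorem mulTranslate_smul (T : TorusAction n X μ) (c : ℂ) (f : C(X, ℂ)) (t : Fin n → ℝ) :
    mulTranslate T (c • f) t = c • mulTranslate T f t :=
  clm_ext_toLp fun k => by
    simp only [mulTranslate_toLp, smul_apply, smul_mul_assoc, map_smul]

/-- The translation by which the left multiplication by a function of weight `r` is twisted. -/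
def halfShift (θ : Matrix (Fin n) (Fin n) ℝ) (r : Fin n → ℤ) : Fin n → ℝ :=
  (1 / 2 : ℝ) • Matrix.vecMul (fun i => (r i : ℝ)) θ

theorem leftMul_eq (T : TorusAction n X μ) (θ : Matrix (Fin n) (Fin n) ℝ) (r : Fin n → ℤ)
    (f : C(X, ℂ)) : leftMul T θ r f = mulTranslate T f (halfShift θ r) := rfl

/-- The operator of right multiplication `g ↦ g ×_θ f` by a function of weight `r`. -/
def rightMul (T : TorusAction n X μ) (θ : Matrix (Fin n) (Fin n) ℝ) (r : Fin n → ℤ)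
    (f : C(X, ℂ)) : Lp ℂ 2 μ →L[ℂ] Lp ℂ 2 μ := mulTranslate T f (-halfShift θ r)

theorem halfShift_add (θ : Matrix (Fin n) (Fin n) ℝ) (r s : Fin n → ℤ) :
    halfShift θ (r + s) = halfShift θ r + halfShift θ s := by
  rw [halfShift, halfShift, halfShift, ← smul_add, ← Matrix.add_vecMul]
  congr 2
  ext i
  simp

theorem halfShift_neg (θ : Matrix (Fin n) (Fin n) ℝ) (r : Fin n → ℤ) :
    halfShift θ (-r) = -halfShift θ r := by
  rw [halfShift, halfShift, ← smul_neg, ← Matrix.neg_vecMul]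
  congr 2
  ext i
  simp

theorem sum_halfShift_mul (θ : Matrix (Fin n) (Fin n) ℝ) (r s : Fin n → ℤ) :
    ∑ j, halfShift θ r j * s j
      = 1 / 2 * ((fun i => (r i : ℝ)) ⬝ᵥ θ.mulVec fun i => (s i : ℝ)) := by
  rw [Matrix.dotProduct_mulVec, dotProduct, Finset.mul_sum]
  simp [halfShift, mul_assoc]

theorem sum_halfShift_swap {θ : Matrix (Fin n) (Fin n) ℝ} (hθ : θ.transpose = -θ)
    (r s : Fin n → ℤ) :
    ∑ j, halfShift θ r j * s j = -∑ j, halfShift θ s j * r j := by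
  rw [sum_halfShift_mul, sum_halfShift_mul, Matrix.dotProduct_mulVec, ← Matrix.mulVec_transpose, hθ,
    Matrix.neg_mulVec, neg_dotProduct, dotProduct_comm, mul_neg]

/-- A function of weight `r` is thus invariant under its own twisting translation. Hence taking the
adjoint of a left multiplication produces no phase. -/
theorem sum_halfShift_self {θ : Matrix (Fin n) (Fin n) ℝ} (hθ : θ.transpose = -θ)
    (r : Fin n → ℤ) : ∑ j, halfShift θ r j * r j = 0 := by
  have := sum_halfShift_swap hθ r r
  linarith

theorem IsIsotypic.comp_actMap {T : TorusAction n X μ} {r : Fin n → ℤ} {f : C(X, ℂ)}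
    (hf : IsIsotypic T r f) (t : Fin n → ℝ) :
    f.comp (T.actMap t) = e2pi (∑ j, t j * r j) • f := by
  ext x
  exact hf t x

theorem IsIsotypic.mul {T : TorusAction n X μ} {r s : Fin n → ℤ} {f g : C(X, ℂ)}
    (hf : IsIsotypic T r f) (hg : IsIsotypic T s g) : IsIsotypic T (r + s) (f * g) := by
  intro t x
  have : ∑ j, t j * ((r + s) j : ℤ) = ∑ j, t j * r j + ∑ j, t j * s j := by
    simp [mul_add, Finset.sum_add_distrib]
  rw [this, e2pi_add, ContinuousMap.mul_apply, hf, hg, ContinuousMap.mul_apply]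
  ring

theorem IsIsotypic.star {T : TorusAction n X μ} {r : Fin n → ℤ} {f : C(X, ℂ)}
    (hf : IsIsotypic T r f) : IsIsotypic T (-r) (star f) := by
  intro t x
  have : ∑ j, t j * ((-r) j : ℤ) = -∑ j, t j * r j := by simp
  rw [this, ← star_e2pi, ContinuousMap.star_apply, hf, star_mul', ContinuousMap.star_apply]

theorem isIsotypic_one (T : TorusAction n X μ) : IsIsotypic T 0 (1 : C(X, ℂ)) := by
  intro t x
  simp [e2pi_zero]

theorem leftMul_mul {T : TorusAction n X μ} (θ : Matrix (Fin n) (Fin n) ℝ) {r s : Fin n → ℤ}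
    (f : C(X, ℂ)) {g : C(X, ℂ)} (hg : IsIsotypic T s g) :
    leftMul T θ r f * leftMul T θ s g =
      e2pi (∑ j, halfShift θ r j * s j) • leftMul T θ (r + s) (f * g) := by
  rw [leftMul_eq, leftMul_eq, leftMul_eq, mulTranslate_mul, hg.comp_actMap, mul_smul_comm,
    mulTranslate_smul, halfShift_add]

theorem star_leftMul {T : TorusAction n X μ} {θ : Matrix (Fin n) (Fin n) ℝ}
    (hθ : θ.transpose = -θ) {r : Fin n → ℤ} {f : C(X, ℂ)} (hf : IsIsotypic T r f) :
    star (leftMul T θ r f) = leftMul T θ (-r) (star f) := by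
  have h : ∑ j, (-halfShift θ r) j * r j = 0 := by
    simpa using sum_halfShift_self hθ r
  rw [leftMul_eq, leftMul_eq, star_mulTranslate, hf.comp_actMap, h, e2pi_zero, one_smul,
    halfShift_neg]

/-- Moving the left translation past `g` and the opposite right translation past `f` produces phases
that agree because `θ` is skew. -/
theorem leftMul_commute_rightMul {T : TorusAction n X μ} {θ : Matrix (Fin n) (Fin n) ℝ}
    (hθ : θ.transpose = -θ) {r s : Fin n → ℤ} {f g : C(X, ℂ)} (hf : IsIsotypic T r f)
    (hg : IsIsotypic T s g) :
    leftMul T θ r f * rightMul T θ s g = rightMul T θ s g * leftMul T θ r f := by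
  have h : ∑ j, (-halfShift θ s) j * r j = ∑ j, halfShift θ r j * s j := by
    rw [sum_halfShift_swap hθ r s]
    simp
  rw [leftMul_eq, rightMul, mulTranslate_mul, mulTranslate_mul, hf.comp_actMap, hg.comp_actMap, h,
    mul_smul_comm, mul_smul_comm, mul_comm f g, add_comm]

/-- The commutant supplies self-intertwiners of the deformed algebra. They enlarge the range of a
given intertwiner, and they make `1` a separating vector. -/
theorem intertwines_rightMul {T : TorusAction n X μ} {θ : Matrix (Fin n) (Fin n) ℝ}
    (hθ : θ.transpose = -θ) {s : Fin n → ℤ} {g : C(X, ℂ)} (hg : IsIsotypic T s g)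
    (a : deformedAlgebra T θ) :
    Intertwines (rightMul T θ s g) (a : Lp ℂ 2 μ →L[ℂ] Lp ℂ 2 μ) a := by
  let d : (Lp ℂ 2 μ →L[ℂ] Lp ℂ 2 μ) →⋆ₐ[ℂ]
      (Lp ℂ 2 μ →L[ℂ] Lp ℂ 2 μ) × (Lp ℂ 2 μ →L[ℂ] Lp ℂ 2 μ) :=
    (StarAlgHom.id ℂ _).prod (StarAlgHom.id ℂ _)
  have hd : Continuous d := continuous_id.prodMk continuous_id
  have h : deformedAlgebra T θ ≤ (intertwined (rightMul T θ s g)).comap d := by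
    refine StarSubalgebra.topologicalClosure_minimal (StarAlgebra.adjoin_le ?_)
      ((isClosed_intertwined _).preimage hd)
    rintro _ ⟨r, f, hf, rfl⟩
    refine ⟨leftMul_commute_rightMul hθ hf hg, ?_⟩
    change star (leftMul T θ r f) * rightMul T θ s g = rightMul T θ s g * star (leftMul T θ r f)
    rw [star_leftMul hθ hf]
    exact leftMul_commute_rightMul hθ hf.star hg
  exact h a.2

theorem rightMul_one (T : TorusAction n X μ) (θ : Matrix (Fin n) (Fin n) ℝ) (s : Fin n → ℤ)
    (g : C(X, ℂ)) : rightMul T θ s g (ContinuousMap.toLp 2 μ ℂ 1) = ContinuousMap.toLp 2 μ ℂ g := by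
  rw [rightMul, mulTranslate_toLp]
  congr 1
  ext x
  simp

theorem leftMul_one (T : TorusAction n X μ) (θ : Matrix (Fin n) (Fin n) ℝ) (s : Fin n → ℤ)
    (g : C(X, ℂ)) : leftMul T θ s g (ContinuousMap.toLp 2 μ ℂ 1) = ContinuousMap.toLp 2 μ ℂ g := by
  rw [leftMul_eq, mulTranslate_toLp]
  congr 1
  ext x
  simp

instance isClosed_deformedAlgebra (T : TorusAction n X μ) (θ : Matrix (Fin n) (Fin n) ℝ) :
    IsClosed (deformedAlgebra T θ : Set (Lp ℂ 2 μ →L[ℂ] Lp ℂ 2 μ)) :=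
  StarSubalgebra.isClosed_topologicalClosure _

end Operators

/-! ### Generators of deformed algebras -/

section Averaging

variable {n : ℕ} {X : Type*} [TopologicalSpace X] [CompactSpace X] [MeasurableSpace X]
  [BorelSpace X] {μ : Measure X} [IsFiniteMeasure μ]

/-- The Lebesgue measure on the unit cube. -/
def cubeMeasure (n : ℕ) : Measure (Fin n → ℝ) :=
  Measure.pi fun _ => volume.restrict (Set.Ioc 0 1)

instance : IsProbabilityMeasure ((volume : Measure ℝ).restrict (Set.Ioc 0 1)) :=
  ⟨by simp⟩

instance : IsProbabilityMeasure (cubeMeasure n) := by unfold cubeMeasure; infer_instance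

theorem e2pi_sum {ι : Type*} (s : Finset ι) (f : ι → ℝ) :
    e2pi (∑ j ∈ s, f j) = ∏ j ∈ s, e2pi (f j) := by
  classical
  induction s using Finset.induction_on with
  | empty => simp [e2pi_zero]
  | insert a s ha ih => rw [Finset.sum_insert ha, Finset.prod_insert ha, e2pi_add, ih]

theorem integral_e2pi_int_mul {m : ℤ} (hm : m ≠ 0) :
    ∫ t in Set.Ioc (0 : ℝ) 1, e2pi (t * m) = 0 := by
  rw [← intervalIntegral.integral_of_le zero_le_one]
  have hc : (2 * Real.pi * Complex.I * m : ℂ) ≠ 0 := by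
    simp [hm, Real.pi_ne_zero]
  have h : ∀ t : ℝ, e2pi (t * m) = Complex.exp (2 * Real.pi * Complex.I * m * t) := by
    intro t
    rw [e2pi]
    congr 1
    push_cast
    ring
  simp only [h]
  rw [integral_exp_mul_complex hc]
  have h1 : Complex.exp (2 * Real.pi * Complex.I * m * (1 : ℝ)) = 1 := by
    have := h 1
    rw [one_mul, e2pi_int] at this
    exact this.symm
  rw [h1]
  simp

theorem integral_e2pi_cube (m : Fin n → ℤ) (hm : m ≠ 0) :
    ∫ t, e2pi (∑ j, t j * m j) ∂cubeMeasure n = 0 := by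
  simp only [e2pi_sum, cubeMeasure]
  rw [integral_fintype_prod_eq_prod (fun j (t : ℝ) => e2pi (t * m j))]
  obtain ⟨j, hj⟩ := Function.ne_iff.1 hm
  exact Finset.prod_eq_zero (Finset.mem_univ j) (integral_e2pi_int_mul hj)

theorem TorusAction.continuous_comp_actMap (T : TorusAction n X μ) (f : C(X, ℂ)) :
    Continuous fun t => f.comp (T.actMap t) :=
  ContinuousMap.continuous_of_continuous_uncurry _ (f.continuous.comp T.continuous_act)

theorem TorusAction.continuous_averageIntegrand (T : TorusAction n X μ) (r : Fin n → ℤ)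
    (f : C(X, ℂ)) : Continuous fun t : Fin n → ℝ => e2pi (-∑ j, t j * r j) • f.comp (T.actMap t) := by
  refine (continuous_e2pi.comp ?_).smul (T.continuous_comp_actMap f)
  fun_prop

theorem TorusAction.norm_averageIntegrand_le (T : TorusAction n X μ) (r : Fin n → ℤ)
    (f : C(X, ℂ)) (t : Fin n → ℝ) : ‖e2pi (-∑ j, t j * r j) • f.comp (T.actMap t)‖ ≤ ‖f‖ := by
  rw [norm_smul, norm_e2pi, one_mul]
  exact (ContinuousMap.norm_le _ (norm_nonneg _)).2 fun x => f.norm_coe_le_norm _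

theorem TorusAction.integrable_averageIntegrand (T : TorusAction n X μ) (r : Fin n → ℤ)
    (f : C(X, ℂ)) :
    Integrable (fun t : Fin n → ℝ => e2pi (-∑ j, t j * r j) • f.comp (T.actMap t)) (cubeMeasure n) :=
  Integrable.of_bound (T.continuous_averageIntegrand r f).aestronglyMeasurable ‖f‖
    (Filter.Eventually.of_forall (T.norm_averageIntegrand_le r f))

/-- The projection onto the isotypic component of weight `r`. -/
def TorusAction.average (T : TorusAction n X μ) (r : Fin n → ℤ) : C(X, ℂ) →L[ℂ] C(X, ℂ) :=
  LinearMap.mkContinuous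
    { toFun := fun f => ∫ t, e2pi (-∑ j, t j * r j) • f.comp (T.actMap t) ∂cubeMeasure n
      map_add' := fun f g => by
        rw [← integral_add (T.integrable_averageIntegrand r f) (T.integrable_averageIntegrand r g)]
        congr 1
        ext t x
        simp
      map_smul' := fun c f => by
        rw [RingHom.id_apply, ← integral_smul]
        congr 1
        ext t x
        simp
        ring } 1 (fun f => by
      rw [one_mul]
      refine (norm_integral_le_of_norm_le_const (C := ‖f‖)
        (Filter.Eventually.of_forall (T.norm_averageIntegrand_le r f))).trans ?_
      simp)

variable [NormalSpace X] [μ.WeaklyRegular]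

theorem IsIsotypic.average {T : TorusAction n X μ} {s : Fin n → ℤ} {f : C(X, ℂ)}
    (hf : IsIsotypic T s f) (r : Fin n → ℤ) : T.average r f = if s = r then f else 0 := by
  have h : T.average r f = (∫ t, e2pi (∑ j, t j * (s - r) j) ∂cubeMeasure n) • f := by
    rw [← integral_smul_const]
    change ∫ t, _ ∂_ = _
    congr 1
    ext1 t
    rw [hf.comp_actMap, smul_smul, ← e2pi_add]
    congr 2
    simp [mul_sub]
    ring
  rw [h]
  split_ifs with hsr
  · simp [hsr, e2pi_zero]
  · rw [integral_e2pi_cube _ (sub_ne_zero.2 hsr), zero_smul]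

variable {T : TorusAction n X μ} {ι : Type*} {s : ι → Fin n → ℤ} {w : ι → C(X, ℂ)}

/-- By Stone–Weierstrass the *-algebra generated by the `w i` is dense. It is spanned by the
monomials in `w i` and `star (w i)`, and all of these lie in the monoid `N`. -/
theorem dense_span_of_separatesPoints (hsep : ∀ x y, x ≠ y → ∃ i, w i x ≠ w i y)
    {N : Submonoid C(X, ℂ)} (hw : ∀ i, w i ∈ N) (hw' : ∀ i, star (w i) ∈ N) :
    Dense (Submodule.span ℂ (N : Set C(X, ℂ)) : Set C(X, ℂ)) := by
  have h1 : (StarAlgebra.adjoin ℂ (Set.range w)).topologicalClosure = ⊤ := by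
    refine ContinuousMap.starSubalgebra_topologicalClosure_eq_top_of_separatesPoints _ ?_
    intro x y hxy
    obtain ⟨i, hi⟩ := hsep x y hxy
    exact ⟨w i, ⟨w i, StarAlgebra.subset_adjoin ℂ _ ⟨i, rfl⟩, rfl⟩, hi⟩
  have h2 : (StarAlgebra.adjoin ℂ (Set.range w) : Set C(X, ℂ)) ⊆
      Submodule.span ℂ (N : Set C(X, ℂ)) := by
    have h3 : Submonoid.closure (Set.range w ∪ star (Set.range w)) ≤ N := by
      rw [Submonoid.closure_le]
      rintro f (⟨i, rfl⟩ | ⟨i, hi⟩)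
      · exact hw i
      · have := hw' i
        rwa [hi, star_star] at this
    intro f hf
    have h4 : f ∈ Subalgebra.toSubmodule (StarAlgebra.adjoin ℂ (Set.range w)).toSubalgebra := hf
    rw [StarAlgebra.adjoin_eq_span] at h4
    exact Submodule.span_mono h3 h4
  intro f
  refine closure_mono h2 ?_
  rw [← StarSubalgebra.topologicalClosure_coe, h1]
  trivial

/-- The deformed algebra is generated by isotypic functions which separate the points. -/
theorem deformedAlgebra_le {θ : Matrix (Fin n) (Fin n) ℝ} (hθ : θ.transpose = -θ)
    (hw : ∀ i, IsIsotypic T (s i) (w i)) (hsep : ∀ x y, x ≠ y → ∃ i, w i x ≠ w i y) :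
    deformedAlgebra T θ ≤ (StarAlgebra.adjoin ℂ
      (Set.range fun i => leftMul T θ (s i) (w i))).topologicalClosure := by
  set B := (StarAlgebra.adjoin ℂ
      (Set.range fun i => leftMul T θ (s i) (w i))).topologicalClosure with hB
  have hcl : IsClosed (B : Set (Lp ℂ 2 μ →L[ℂ] Lp ℂ 2 μ)) :=
    StarSubalgebra.isClosed_topologicalClosure _
  have hmem : ∀ i, leftMul T θ (s i) (w i) ∈ B := fun i =>
    StarSubalgebra.le_topologicalClosure _ (StarAlgebra.subset_adjoin ℂ _ ⟨i, rfl⟩)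
  -- Undeformed and deformed products of isotypic functions differ by a phase, so this set is closed
  -- under the pointwise product and Stone–Weierstrass applies to it.
  let N : Submonoid C(X, ℂ) :=
    { carrier := {f | ∃ r, IsIsotypic T r f ∧ leftMul T θ r f ∈ B}
      one_mem' := by
        refine ⟨0, isIsotypic_one T, ?_⟩
        have : leftMul T θ 0 1 = 1 := clm_ext_toLp fun g => by
          rw [leftMul_eq, mulTranslate_toLp]
          have h0 : halfShift θ 0 = 0 := by
            have := halfShift_add θ 0 0
            simpa using this
          rw [h0, one_mul]
          refine congrArg _ (ContinuousMap.ext fun x => ?_)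
          simp [T.act_zero]
        rw [this]
        exact one_mem B
      mul_mem' := by
        rintro f g ⟨r, hf, hfB⟩ ⟨r', hg, hgB⟩
        refine ⟨r + r', hf.mul hg, ?_⟩
        have h1 := leftMul_mul θ (r := r) f hg
        have h2 : leftMul T θ (r + r') (f * g) = e2pi (-∑ j, halfShift θ r j * r' j) •
            (leftMul T θ r f * leftMul T θ r' g) := by
          rw [h1, smul_smul, ← e2pi_add, neg_add_cancel, e2pi_zero, one_smul]
        rw [h2]
        exact B.smul_mem (mul_mem hfB hgB) _ }
  have hd : Dense (Submodule.span ℂ (N : Set C(X, ℂ)) : Set C(X, ℂ)) :=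
    dense_span_of_separatesPoints hsep (fun i => ⟨s i, hw i, hmem i⟩)
      (fun i => ⟨-s i, (hw i).star, by
        rw [← star_leftMul hθ (hw i)]
        exact star_mem (hmem i)⟩)
  refine StarSubalgebra.topologicalClosure_minimal (StarAlgebra.adjoin_le ?_) hcl
  rintro _ ⟨r, f, hf, rfl⟩
  -- Sums of elements of `N` mix weights, while `leftMul` with fixed `r` is meaningful only for
  -- weight `r`. Averaging projects the approximants to weight `r` and leaves `f` unchanged.
  have hcont : Continuous fun g => leftMul T θ r (T.average r g) :=
    (continuous_mulTranslate T _).comp (T.average r).continuous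
  have hspan : (Submodule.span ℂ (N : Set C(X, ℂ)) : Set C(X, ℂ)) ⊆
      (fun g => leftMul T θ r (T.average r g)) ⁻¹' B := by
    intro g hg
    change leftMul T θ r (T.average r g) ∈ B
    induction hg using Submodule.span_induction with
    | mem g hg =>
      obtain ⟨r', hg, hgB⟩ := hg
      rw [hg.average]
      split_ifs with h
      · rwa [← h]
      · have : leftMul T θ r 0 = 0 := by
          have := mulTranslate_smul T 0 0 (halfShift θ r)
          rwa [zero_smul, zero_smul] at this
        rw [this]
        exact zero_mem B
    | zero =>
      have : leftMul T θ r 0 = 0 := by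
        have := mulTranslate_smul T 0 0 (halfShift θ r)
        rwa [zero_smul, zero_smul] at this
      rw [map_zero, this]
      exact zero_mem B
    | add g g' _ _ h h' =>
      rw [map_add, leftMul_eq, mulTranslate_add]
      exact add_mem h h'
    | smul c g _ h =>
      rw [map_smul, leftMul_eq, mulTranslate_smul]
      exact B.smul_mem h c
  have := closure_minimal hspan (hcl.preimage hcont) (hd f)
  change leftMul T θ r (T.average r f) ∈ B at this
  rwa [hf.average, if_pos rfl] at this

theorem generates_toDeformed {θ : Matrix (Fin n) (Fin n) ℝ} (hθ : θ.transpose = -θ)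
    (hw : ∀ i, IsIsotypic T (s i) (w i)) (hsep : ∀ x y, x ≠ y → ∃ i, w i x ≠ w i y) :
    Generates fun i => toDeformed T θ (s i) (w i) (hw i) :=
  generates_of_le _ _ (deformedAlgebra_le hθ hw hsep)

theorem dense_span_isotypic (hw : ∀ i, IsIsotypic T (s i) (w i))
    (hsep : ∀ x y, x ≠ y → ∃ i, w i x ≠ w i y) :
    Dense (Submodule.span ℂ (ContinuousMap.toLp 2 μ ℂ '' {f | ∃ r, IsIsotypic T r f}) :
      Set (Lp ℂ 2 μ)) := by
  let N : Submonoid C(X, ℂ) :=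
    { carrier := {f | ∃ r, IsIsotypic T r f}
      one_mem' := ⟨0, isIsotypic_one T⟩
      mul_mem' := by
        rintro f g ⟨r, hf⟩ ⟨r', hg⟩
        exact ⟨r + r', hf.mul hg⟩ }
  have hd : Dense (Submodule.span ℂ (N : Set C(X, ℂ)) : Set C(X, ℂ)) :=
    dense_span_of_separatesPoints hsep (fun i => ⟨s i, hw i⟩) (fun i => ⟨-s i, (hw i).star⟩)
  have h1 := (denseRange_toLp (μ := μ)).dense_image (ContinuousMap.toLp 2 μ ℂ).continuous hd
  refine h1.mono ?_
  have h2 := Submodule.map_span (ContinuousMap.toLp 2 μ ℂ : C(X, ℂ) →L[ℂ] Lp ℂ 2 μ).toLinearMap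
    (N : Set C(X, ℂ))
  exact (congrArg (fun W : Submodule ℂ (Lp ℂ 2 μ) => (W : Set (Lp ℂ 2 μ))) h2).subset

end Averaging

/-! ### Coactions on deformed algebras -/

section Coaction

variable {n n' : ℕ} {X Y : Type*}
  [TopologicalSpace X] [CompactSpace X] [MeasurableSpace X] [BorelSpace X] {μ : Measure X}
  [IsProbabilityMeasure μ] [NormalSpace X] [μ.WeaklyRegular]
  [TopologicalSpace Y] [CompactSpace Y] [MeasurableSpace Y] [BorelSpace Y] {ν : Measure Y}
  [IsFiniteMeasure ν] [NormalSpace Y] [ν.WeaklyRegular]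

/-- The evaluation of `∑ f ⊗ g` at `(x, y)`. -/
def evalTensor (x : X) (y : Y) : C(X, ℂ) ⊗[ℂ] C(Y, ℂ) →ₐ[ℂ] ℂ :=
  Algebra.TensorProduct.productMap (ContinuousMap.evalAlgHom ℂ ℂ x)
    (ContinuousMap.evalAlgHom ℂ ℂ y)

@[simp]
theorem evalTensor_tmul (x : X) (y : Y) (f : C(X, ℂ)) (g : C(Y, ℂ)) :
    evalTensor x y (f ⊗ₜ g) = f x * g y := rfl

variable (μ ν) in
/-- The vector of `L²(μ) ⊗ L²(ν)` which is given by a tensor of continuous functions. -/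
def tensorToLp : C(X, ℂ) ⊗[ℂ] C(Y, ℂ) →ₗ[ℂ] HilbertTensor (Lp ℂ 2 μ) (Lp ℂ 2 ν) :=
  (HilbertTensor.of (Lp ℂ 2 μ) (Lp ℂ 2 ν)).toLinearMap ∘ₗ
    TensorProduct.map (ContinuousMap.toLp 2 μ ℂ).toLinearMap (ContinuousMap.toLp 2 ν ℂ).toLinearMap

@[simp]
theorem tensorToLp_tmul (f : C(X, ℂ)) (g : C(Y, ℂ)) :
    tensorToLp μ ν (f ⊗ₜ g) =
      HilbertTensor.tmul (ContinuousMap.toLp 2 μ ℂ f) (ContinuousMap.toLp 2 ν ℂ g) := rfl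

theorem integrable_continuousMap (f : C(Y, ℂ)) : Integrable f ν :=
  Integrable.of_bound f.continuous.aestronglyMeasurable ‖f‖
    (Filter.Eventually.of_forall fun x => f.norm_coe_le_norm x)

theorem inner_tensorToLp_eq_sum (S S' : Finset (C(X, ℂ) × C(Y, ℂ))) :
    inner ℂ (tensorToLp μ ν (∑ p ∈ S, p.1 ⊗ₜ p.2)) (tensorToLp μ ν (∑ q ∈ S', q.1 ⊗ₜ q.2)) =
      ∑ p ∈ S, ∑ q ∈ S', (∫ x, (star p.1 * q.1) x ∂μ) * ∫ y, (star p.2 * q.2) y ∂ν := by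
  simp only [map_sum, sum_inner, inner_sum, tensorToLp_tmul, HilbertTensor.inner_tmul,
    inner_toLp_eq]
  rw [Finset.sum_comm]
  rfl

theorem star_evalTensor_mul_evalTensor (S S' : Finset (C(X, ℂ) × C(Y, ℂ))) (x : X) (y : Y) :
    star (evalTensor x y (∑ p ∈ S, p.1 ⊗ₜ p.2)) * evalTensor x y (∑ q ∈ S', q.1 ⊗ₜ q.2) =
      ∑ p ∈ S, ∑ q ∈ S', (star p.1 * q.1) x * (star p.2 * q.2) y := by
  simp only [map_sum, evalTensor_tmul, star_sum, Finset.sum_mul_sum, star_mul',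
    ContinuousMap.mul_apply, ContinuousMap.star_apply]
  refine Finset.sum_congr rfl fun p _ => Finset.sum_congr rfl fun q _ => ?_
  ring

/-- For finite sums of products the double integral splits termwise. So the Hilbert tensor product
need not be identified with `L²` of the product space. -/
theorem inner_tensorToLp (Q Q' : C(X, ℂ) ⊗[ℂ] C(Y, ℂ)) :
    inner ℂ (tensorToLp μ ν Q) (tensorToLp μ ν Q') =
      ∫ x, ∫ y, star (evalTensor x y Q) * evalTensor x y Q' ∂ν ∂μ := by
  obtain ⟨S, rfl⟩ := TensorProduct.exists_finset Q
  obtain ⟨S', rfl⟩ := TensorProduct.exists_finset Q'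
  have h : ∀ x, ∫ y, ∑ p ∈ S, ∑ q ∈ S', (star p.1 * q.1) x * (star p.2 * q.2) y ∂ν =
      ∑ p ∈ S, ∑ q ∈ S', (star p.1 * q.1) x * ∫ y, (star p.2 * q.2) y ∂ν := by
    intro x
    rw [integral_finsetSum _ fun p _ => integrable_finsetSum _ fun q _ =>
      (integrable_continuousMap _).const_mul _]
    refine Finset.sum_congr rfl fun p _ => ?_
    rw [integral_finsetSum _ fun q _ => (integrable_continuousMap _).const_mul _]
    exact Finset.sum_congr rfl fun q _ => integral_const_mul _ _
  simp only [star_evalTensor_mul_evalTensor, h]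
  rw [inner_tensorToLp_eq_sum, integral_finsetSum _ fun p _ => integrable_finsetSum _ fun q _ =>
      (integrable_continuousMap _).mul_const _]
  refine Finset.sum_congr rfl fun p _ => ?_
  rw [integral_finsetSum _ fun q _ => (integrable_continuousMap _).mul_const _]
  exact Finset.sum_congr rfl fun q _ => (integral_mul_const _ _).symm

theorem inner_tensorToLp' (Q Q' : C(X, ℂ) ⊗[ℂ] C(Y, ℂ)) :
    inner ℂ (tensorToLp μ ν Q) (tensorToLp μ ν Q') =
      ∫ y, ∫ x, star (evalTensor x y Q) * evalTensor x y Q' ∂μ ∂ν := by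
  obtain ⟨S, rfl⟩ := TensorProduct.exists_finset Q
  obtain ⟨S', rfl⟩ := TensorProduct.exists_finset Q'
  have h : ∀ y, ∫ x, ∑ p ∈ S, ∑ q ∈ S', (star p.1 * q.1) x * (star p.2 * q.2) y ∂μ =
      ∑ p ∈ S, ∑ q ∈ S', (∫ x, (star p.1 * q.1) x ∂μ) * (star p.2 * q.2) y := by
    intro y
    rw [integral_finsetSum _ fun p _ => integrable_finsetSum _ fun q _ =>
      (integrable_continuousMap _).mul_const _]
    refine Finset.sum_congr rfl fun p _ => ?_
    rw [integral_finsetSum _ fun q _ => (integrable_continuousMap _).mul_const _]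
    exact Finset.sum_congr rfl fun q _ => integral_mul_const _ _
  simp only [star_evalTensor_mul_evalTensor, h]
  rw [inner_tensorToLp_eq_sum, integral_finsetSum _ fun p _ => integrable_finsetSum _ fun q _ =>
      (integrable_continuousMap _).const_mul _]
  refine Finset.sum_congr rfl fun p _ => ?_
  rw [integral_finsetSum _ fun q _ => (integrable_continuousMap _).const_mul _]
  exact Finset.sum_congr rfl fun q _ => (integral_const_mul _ _).symm

/-- The map `h ↦ f · h(t · -)` on continuous functions. -/
def mulTranslateC (T : TorusAction n X μ) (f : C(X, ℂ)) (t : Fin n → ℝ) : C(X, ℂ) →ₗ[ℂ] C(X, ℂ) where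
  toFun h := f * h.comp (T.actMap t)
  map_add' h k := by
    ext x
    simp [mul_add]
  map_smul' c h := by
    ext x
    simp

theorem evalTensor_map_mulTranslateC (T : TorusAction n X μ) (T' : TorusAction n' Y ν)
    (f : C(X, ℂ)) (s : Fin n → ℝ) (g : C(Y, ℂ)) (t : Fin n' → ℝ) (x : X) (y : Y)
    (Q : C(X, ℂ) ⊗[ℂ] C(Y, ℂ)) :
    evalTensor x y (TensorProduct.map (mulTranslateC T f s) (mulTranslateC T' g t) Q) =
      f x * g y * evalTensor (T.act s x) (T'.act t y) Q := by
  induction Q using TensorProduct.induction_on with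
  | zero => simp
  | tmul h k =>
    rw [TensorProduct.map_tmul, evalTensor_tmul, evalTensor_tmul]
    simp only [mulTranslateC, LinearMap.coe_mk, AddHom.coe_mk, ContinuousMap.mul_apply,
      ContinuousMap.comp_apply, TorusAction.actMap_apply]
    ring
  | add Q Q' h h' => rw [map_add, map_add, h, h', map_add, mul_add]

theorem tensorToLp_map_mulTranslateC (T : TorusAction n X μ) (T' : TorusAction n' Y ν)
    (f : C(X, ℂ)) (s : Fin n → ℝ) (g : C(Y, ℂ)) (t : Fin n' → ℝ) (Q : C(X, ℂ) ⊗[ℂ] C(Y, ℂ)) :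
    tensorToLp μ ν (TensorProduct.map (mulTranslateC T f s) (mulTranslateC T' g t) Q) =
      opTensor (mulTranslate T f s) (mulTranslate T' g t) (tensorToLp μ ν Q) := by
  induction Q using TensorProduct.induction_on with
  | zero => simp
  | tmul h k =>
    rw [TensorProduct.map_tmul, tensorToLp_tmul, tensorToLp_tmul, opTensor_tmul, mulTranslate_toLp,
      mulTranslate_toLp]
    rfl
  | add Q Q' h h' => rw [map_add, map_add, h, h', map_add, map_add]

/-- `Q ∈ C(X) ⊗ C(Y)` is the function `(x, y) ↦ P (m x y)`. -/
def IsPullback (m : X → Y → Y) (P : C(Y, ℂ)) (Q : C(X, ℂ) ⊗[ℂ] C(Y, ℂ)) : Prop :=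
  ∀ x y, evalTensor x y Q = P (m x y)

theorem IsPullback.mulTranslate {m : X → Y → Y} {P : C(Y, ℂ)} {Q : C(X, ℂ) ⊗[ℂ] C(Y, ℂ)}
    (h : IsPullback m P Q) (T : TorusAction n X μ) (T' : TorusAction n' Y ν)
    {I : Type*} [Fintype I] {f : I → C(X, ℂ)} {s : I → Fin n → ℝ} {g : I → C(Y, ℂ)}
    {t : I → Fin n' → ℝ} {p : C(Y, ℂ)} {t' : Fin n' → ℝ}
    (hp : ∀ x y, p (m x y) = ∑ k, f k x * g k y)
    (ht : ∀ k x y, m (T.act (s k) x) (T'.act (t k) y) = T'.act t' (m x y)) :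
    IsPullback m (mulTranslateC T' p t' P)
      (∑ k, TensorProduct.map (mulTranslateC T (f k) (s k)) (mulTranslateC T' (g k) (t k)) Q) := by
  intro x y
  simp only [map_sum, evalTensor_map_mulTranslateC, h _ _, ht]
  rw [← Finset.sum_mul, ← hp]
  rfl

/-- For fixed `x` the inner integral over `y` does not depend on `x`, since `m x` preserves `ν`. The
outer integral then disappears because `μ` is a probability measure. -/
theorem inner_eq_of_isPullback {m : X → Y → Y} (hm : ∀ x, MeasurePreserving (m x) ν ν)
    {P P' : C(Y, ℂ)} {Q Q' : C(X, ℂ) ⊗[ℂ] C(Y, ℂ)} (h : IsPullback m P Q)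
    (h' : IsPullback m P' Q') :
    inner ℂ (ContinuousMap.toLp 2 ν ℂ P) (ContinuousMap.toLp 2 ν ℂ P') =
      inner ℂ (tensorToLp μ ν Q) (tensorToLp μ ν Q') := by
  rw [inner_tensorToLp, inner_toLp_eq]
  have h1 : ∀ x, ∫ y, star (evalTensor x y Q) * evalTensor x y Q' ∂ν =
      ∫ y, star (P y) * P' y ∂ν := by
    intro x
    simp only [h _ _, h' _ _]
    have h2 : AEStronglyMeasurable (fun y => star (P y) * P' y) (ν.map (m x)) := by
      have : Continuous fun y => star (P y) * P' y := by fun_prop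
      exact this.aestronglyMeasurable
    have h3 := integral_map (hm x).measurable.aemeasurable h2
    rw [(hm x).map_eq] at h3
    exact h3.symm
  simp only [h1, integral_const, probReal_univ, one_smul]

/-- The pullback along a continuous family of measure preserving maps, as an operator on `L²`. -/
theorem exists_pullback_operator {m : X → Y → Y} (hm : ∀ x, MeasurePreserving (m x) ν ν)
    {ι : Type*} {w : ι → C(Y, ℂ)} (hsep : ∀ x y, x ≠ y → ∃ i, w i x ≠ w i y)
    (hw : ∀ i, ∃ Q, IsPullback (X := X) m (w i) Q)
    (hw' : ∀ i, ∃ Q, IsPullback (X := X) m (star (w i)) Q) :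
    ∃ U : Lp ℂ 2 ν →L[ℂ] HilbertTensor (Lp ℂ 2 μ) (Lp ℂ 2 ν),
      (∀ P Q, IsPullback m P Q → U (ContinuousMap.toLp 2 ν ℂ P) = tensorToLp μ ν Q) ∧
      Dense (Submodule.span ℂ
        (ContinuousMap.toLp 2 ν ℂ '' {P | ∃ Q, IsPullback (X := X) m P Q}) : Set (Lp ℂ 2 ν)) := by
  let N : Submonoid C(Y, ℂ) :=
    { carrier := {P | ∃ Q, IsPullback (X := X) m P Q}
      one_mem' := ⟨1 ⊗ₜ 1, fun x y => by simp⟩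
      mul_mem' := by
        rintro P P' ⟨Q, h⟩ ⟨Q', h'⟩
        exact ⟨Q * Q', fun x y => by rw [map_mul, h, h', ContinuousMap.mul_apply]⟩ }
  have hd0 : Dense (Submodule.span ℂ (N : Set C(Y, ℂ)) : Set C(Y, ℂ)) :=
    dense_span_of_separatesPoints hsep hw hw'
  have hd : Dense (Submodule.span ℂ
        (ContinuousMap.toLp 2 ν ℂ '' {P | ∃ Q, IsPullback (X := X) m P Q}) : Set (Lp ℂ 2 ν)) := by
    have h1 := (denseRange_toLp (μ := ν)).dense_image (ContinuousMap.toLp 2 ν ℂ).continuous hd0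
    refine h1.mono ?_
    have h2 := Submodule.map_span (ContinuousMap.toLp 2 ν ℂ : C(Y, ℂ) →L[ℂ] Lp ℂ 2 ν).toLinearMap
      (N : Set C(Y, ℂ))
    exact (congrArg (fun W : Submodule ℂ (Lp ℂ 2 ν) => (W : Set (Lp ℂ 2 ν))) h2).subset
  -- The family is indexed by pairs `(P, Q)`. Equality of inner products already makes the
  -- assignment well defined, so uniqueness of `Q` is not needed.
  obtain ⟨U, hU⟩ := exists_clm_of_inner_eq
    (fun p : {p : C(Y, ℂ) × (C(X, ℂ) ⊗[ℂ] C(Y, ℂ)) // IsPullback m p.1 p.2} =>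
      ContinuousMap.toLp 2 ν ℂ p.1.1)
    (fun p => tensorToLp μ ν p.1.2) (fun p q => inner_eq_of_isPullback hm p.2 q.2)
    (hd.mono (Submodule.span_mono (by
      rintro _ ⟨P, ⟨Q, h⟩, rfl⟩
      exact ⟨⟨(P, Q), h⟩, rfl⟩)))
  exact ⟨U, fun P Q h => hU ⟨(P, Q), h⟩, hd⟩

theorem Intertwines.sum {E K I : Type*} [NormedAddCommGroup E] [InnerProductSpace ℂ E]
    [CompleteSpace E] [NormedAddCommGroup K] [InnerProductSpace ℂ K] [CompleteSpace K] [Fintype I]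
    {T : E →L[ℂ] K} {a : I → E →L[ℂ] E} {b : I → K →L[ℂ] K} (h : ∀ i, Intertwines T (a i) (b i)) :
    Intertwines T (∑ i, a i) (∑ i, b i) := by
  have := sum_mem (S := intertwined T) (t := Finset.univ) (f := fun i => (a i, b i)) fun i _ => h i
  rwa [mem_intertwined, Prod.fst_sum, Prod.snd_sum] at this

theorem star_leftMul' {T : TorusAction n Y ν} {θ : Matrix (Fin n) (Fin n) ℝ}
    (hθ : θ.transpose = -θ) {r : Fin n → ℤ} {f : C(Y, ℂ)} (hf : IsIsotypic T r f) :
    star (leftMul T θ r f) = mulTranslate T (star f) (-halfShift θ r) := by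
  rw [star_leftMul hθ hf, leftMul_eq, halfShift_neg]

/-- The *-homomorphism `φ` is implemented by intertwining operators. -/
def Implemented {E K : Type*} [NormedAddCommGroup E] [InnerProductSpace ℂ E] [CompleteSpace E]
    [NormedAddCommGroup K] [InnerProductSpace ℂ K] [CompleteSpace K]
    {A : StarSubalgebra ℂ (E →L[ℂ] E)} {B : StarSubalgebra ℂ (K →L[ℂ] K)} (φ : A →⋆ₐ[ℂ] B) : Prop :=
  Dense (Submodule.span ℂ (⋃ T : {T : E →L[ℂ] K // ∀ a : A,
    Intertwines T (a : E →L[ℂ] E) (φ a : K →L[ℂ] K)}, Set.range T.1) : Set K)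

/-- The slice map `x ⊗ y ↦ ⟪1, x⟫ y`. -/
def sliceOne : HilbertTensor (Lp ℂ 2 μ) (Lp ℂ 2 ν) →L[ℂ] Lp ℂ 2 ν :=
  ContinuousLinearMap.adjoint (HilbertTensor.tmul (ContinuousMap.toLp 2 μ ℂ 1))

theorem sliceOne_tmul_one (F : Lp ℂ 2 ν) :
    sliceOne (HilbertTensor.tmul (ContinuousMap.toLp 2 μ ℂ 1) F) = F := by
  refine ext_inner_left ℂ fun F' => ?_
  rw [sliceOne, ContinuousLinearMap.adjoint_inner_right, HilbertTensor.inner_tmul, inner_toLp_eq]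
  simp

/-- The slice of a pullback is the function `y ↦ ∫ P (m x y) dμ(x)`. The order of integration in
`inner_tensorToLp'` is the one that exhibits this integral. -/
theorem sliceOne_tensorToLp {m : X → Y → Y} {P : C(Y, ℂ)} {Q : C(X, ℂ) ⊗[ℂ] C(Y, ℂ)}
    (h : IsPullback m P Q) {c : ℂ} (hc : ∀ y, ∫ x, P (m x y) ∂μ = c) :
    sliceOne (tensorToLp μ ν Q) = c • ContinuousMap.toLp 2 ν ℂ 1 := by
  refine ext_inner_left ℂ fun F => ?_
  refine (denseRange_toLp (μ := ν)).induction_on (p := fun F => inner ℂ F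
    (sliceOne (tensorToLp μ ν Q)) = inner ℂ F (c • ContinuousMap.toLp 2 ν ℂ 1)) F ?_ fun g => ?_
  · exact isClosed_eq (by fun_prop) (by fun_prop)
  · rw [sliceOne, ContinuousLinearMap.adjoint_inner_right, ← tensorToLp_tmul, inner_tensorToLp',
      inner_smul_right, inner_toLp_eq, mul_comm, ← integral_mul_const]
    refine integral_congr_ae (Filter.Eventually.of_forall fun y => ?_)
    simp only [h _ _, evalTensor_tmul, ContinuousMap.one_apply, one_mul, mul_one]
    rw [integral_const_mul, hc]

/-- An element of the deformed algebra which acts on `1` as a scalar is a scalar. -/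
theorem eq_algebraMap_of_apply_one {T : TorusAction n Y ν} {θ : Matrix (Fin n) (Fin n) ℝ}
    (hθ : θ.transpose = -θ)
    (hd : Dense (Submodule.span ℂ (ContinuousMap.toLp 2 ν ℂ '' {f | ∃ r, IsIsotypic T r f}) :
      Set (Lp ℂ 2 ν))) (a : deformedAlgebra T θ) {c : ℂ}
    (h : (a : Lp ℂ 2 ν →L[ℂ] Lp ℂ 2 ν) (ContinuousMap.toLp 2 ν ℂ 1) =
      c • ContinuousMap.toLp 2 ν ℂ 1) : a = algebraMap ℂ (deformedAlgebra T θ) c := by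
  apply Subtype.ext
  refine ContinuousLinearMap.ext_on hd ?_
  rintro _ ⟨g, ⟨s, hg⟩, rfl⟩
  -- With `R` the right multiplication by `g`: `a g = a (R 1) = R (a 1) = c • g`.
  have h1 := DFunLike.congr_fun (intertwines_rightMul hθ hg a).1 (ContinuousMap.toLp 2 ν ℂ 1)
  rw [ContinuousLinearMap.comp_apply, ContinuousLinearMap.comp_apply, rightMul_one, h, map_smul,
    rightMul_one] at h1
  rw [h1]
  change _ = (algebraMap ℂ (Lp ℂ 2 ν →L[ℂ] Lp ℂ 2 ν) c) _
  simp [Algebra.algebraMap_eq_smul_one]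

theorem sliceOne_apply_mem_span {m : X → Y → Y}
    {U : Lp ℂ 2 ν →L[ℂ] HilbertTensor (Lp ℂ 2 μ) (Lp ℂ 2 ν)}
    (hU : ∀ P Q, IsPullback m P Q → U (ContinuousMap.toLp 2 ν ℂ P) = tensorToLp μ ν Q)
    (hd : Dense (Submodule.span ℂ
      (ContinuousMap.toLp 2 ν ℂ '' {P | ∃ Q, IsPullback (X := X) m P Q}) : Set (Lp ℂ 2 ν)))
    (hconst : ∀ P : C(Y, ℂ), ∃ c, ∀ y, ∫ x, P (m x y) ∂μ = c) (F : Lp ℂ 2 ν) :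
    sliceOne (U F) ∈ Submodule.span ℂ {ContinuousMap.toLp 2 ν ℂ (1 : C(Y, ℂ))} := by
  set W := Submodule.span ℂ {ContinuousMap.toLp 2 ν ℂ (1 : C(Y, ℂ))} with hW
  have hcl : IsClosed (W : Set (Lp ℂ 2 ν)) := Submodule.closed_of_finiteDimensional _
  have hsub : Submodule.span ℂ
      (ContinuousMap.toLp 2 ν ℂ '' {P | ∃ Q, IsPullback (X := X) m P Q}) ≤
      W.comap (sliceOne ∘L U).toLinearMap := by
    rw [Submodule.span_le]
    rintro _ ⟨P, ⟨Q, h⟩, rfl⟩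
    obtain ⟨c, hc⟩ := hconst P
    rw [SetLike.mem_coe, Submodule.mem_comap]
    have : (sliceOne ∘L U) (ContinuousMap.toLp 2 ν ℂ P) = c • ContinuousMap.toLp 2 ν ℂ 1 := by
      rw [ContinuousLinearMap.comp_apply, hU P Q h, sliceOne_tensorToLp h hc]
    exact this ▸ Submodule.smul_mem _ _ (Submodule.mem_span_singleton_self _)
  exact closure_minimal hsub (hcl.preimage (sliceOne ∘L U).continuous) (hd F)

/-- For coinvariant `a` the intertwining relation at `1` reads `1 ⊗ a 1 = U (a 1)`. Slicing recovers
`a 1` on the left and a multiple of `1` on the right. -/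
theorem coinvariants_eq {T : TorusAction n X μ} {θ : Matrix (Fin n) (Fin n) ℝ}
    {T' : TorusAction n' Y ν} {θ' : Matrix (Fin n') (Fin n') ℝ} (hθ' : θ'.transpose = -θ')
    (hY : Dense (Submodule.span ℂ (ContinuousMap.toLp 2 ν ℂ '' {f | ∃ r, IsIsotypic T' r f}) :
      Set (Lp ℂ 2 ν)))
    {U : Lp ℂ 2 ν →L[ℂ] HilbertTensor (Lp ℂ 2 μ) (Lp ℂ 2 ν)}
    (hU1 : U (ContinuousMap.toLp 2 ν ℂ 1) =
      HilbertTensor.tmul (ContinuousMap.toLp 2 μ ℂ 1) (ContinuousMap.toLp 2 ν ℂ 1))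
    (hslice : ∀ F, sliceOne (U F) ∈ Submodule.span ℂ {ContinuousMap.toLp 2 ν ℂ (1 : C(Y, ℂ))})
    (δ : deformedAlgebra T' θ' →⋆ₐ[ℂ] spatialTensor (deformedAlgebra T θ) (deformedAlgebra T' θ'))
    (hδU : ∀ a : deformedAlgebra T' θ', Intertwines U (a : Lp ℂ 2 ν →L[ℂ] Lp ℂ 2 ν)
      (δ a : HilbertTensor (Lp ℂ 2 μ) (Lp ℂ 2 ν) →L[ℂ] HilbertTensor (Lp ℂ 2 μ) (Lp ℂ 2 ν))) :
    coinvariants δ = Set.range (algebraMap ℂ (deformedAlgebra T' θ')) := by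
  refine Set.Subset.antisymm (fun a ha => ?_) ?_
  · have h1 := DFunLike.congr_fun (hδU a).1 (ContinuousMap.toLp 2 ν ℂ 1)
    have h2 : δ a = elemTensor 1 a := ha
    have h3 : ((elemTensor 1 a : spatialTensor (deformedAlgebra T θ) (deformedAlgebra T' θ')) :
        HilbertTensor (Lp ℂ 2 μ) (Lp ℂ 2 ν) →L[ℂ] HilbertTensor (Lp ℂ 2 μ) (Lp ℂ 2 ν)) =
        opTensor 1 (a : Lp ℂ 2 ν →L[ℂ] Lp ℂ 2 ν) := rfl
    rw [h2, h3, ContinuousLinearMap.comp_apply, ContinuousLinearMap.comp_apply, hU1, opTensor_tmul,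
      one_apply_eq_self] at h1
    have h4 := hslice ((a : Lp ℂ 2 ν →L[ℂ] Lp ℂ 2 ν) (ContinuousMap.toLp 2 ν ℂ 1))
    rw [← h1, sliceOne_tmul_one] at h4
    obtain ⟨c, hc⟩ := Submodule.mem_span_singleton.1 h4
    exact ⟨c, (eq_algebraMap_of_apply_one hθ' hY a hc.symm).symm⟩
  · rintro _ ⟨c, rfl⟩
    have h1 : δ (algebraMap ℂ _ c) = tensorInr (deformedAlgebra T θ) (deformedAlgebra T' θ')
        (algebraMap ℂ _ c) := by
      rw [AlgHomClass.commutes, AlgHomClass.commutes]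
    exact h1

/-- An action of `X` on `Y`, described by matrix coordinates, which is compatible with the
deformations. -/
structure DeformedAction (T : TorusAction n X μ) (θ : Matrix (Fin n) (Fin n) ℝ)
    (T' : TorusAction n' Y ν) (θ' : Matrix (Fin n') (Fin n') ℝ) {I L : Type*} [Fintype I]
    (r : I → I → Fin n → ℤ) (u : I → I → C(X, ℂ)) (s : I → L → Fin n' → ℤ) (w : I → L → C(Y, ℂ))
    (m : X → Y → Y) : Prop where
  skew : θ.transpose = -θ
  skew' : θ'.transpose = -θ'
  measurePreserving : ∀ x, MeasurePreserving (m x) ν ν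
  isotypic_u : ∀ i j, IsIsotypic T (r i j) (u i j)
  isotypic_w : ∀ i j, IsIsotypic T' (s i j) (w i j)
  separates_u : ∀ x x', x ≠ x' → ∃ p : I × I, u p.1 p.2 x ≠ u p.1 p.2 x'
  separates_w : ∀ y y', y ≠ y' → ∃ p : I × L, w p.1 p.2 y ≠ w p.1 p.2 y'
  coordinates : ∀ j l x y, w j l (m x y) = ∑ k, u j k x * w k l y
  shift : ∀ j k l x y, m (T.act (halfShift θ (r j k)) x) (T'.act (halfShift θ' (s k l)) y) =
    T'.act (halfShift θ' (s j l)) (m x y)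

namespace DeformedAction

variable {T : TorusAction n X μ} {θ : Matrix (Fin n) (Fin n) ℝ}
    {T' : TorusAction n' Y ν} {θ' : Matrix (Fin n') (Fin n') ℝ} {I L : Type*} [Fintype I]
    {r : I → I → Fin n → ℤ} {u : I → I → C(X, ℂ)} {s : I → L → Fin n' → ℤ} {w : I → L → C(Y, ℂ)}
    {m : X → Y → Y}

theorem shift_neg (D : DeformedAction T θ T' θ' r u s w m) (j k l x y) :
    m (T.act (-halfShift θ (r j k)) x) (T'.act (-halfShift θ' (s k l)) y) =
      T'.act (-halfShift θ' (s j l)) (m x y) := by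
  have h := D.shift j k l (T.act (-halfShift θ (r j k)) x) (T'.act (-halfShift θ' (s k l)) y)
  rw [T.act_act_neg, T'.act_act_neg] at h
  rw [h, T'.act_neg_act]

theorem star_coordinates (D : DeformedAction T θ T' θ' r u s w m) (j l x y) :
    star (w j l) (m x y) = ∑ k, star (u j k) x * star (w k l) y := by
  simp only [ContinuousMap.star_apply, D.coordinates, star_sum, star_mul']

theorem generates_w (D : DeformedAction T θ T' θ' r u s w m) :
    Generates fun p : I × L => toDeformed T' θ' (s p.1 p.2) (w p.1 p.2) (D.isotypic_w _ _) :=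
  generates_toDeformed D.skew' (fun p : I × L => D.isotypic_w p.1 p.2) D.separates_w

/-- Each summand sends `P (m x y)` to `u_jk(x) w_kl(y) P (m (σ x) (τ y))`, with `σ`, `τ` the
twisting translations. By `shift` the last factor is the same for all `k`, so the sum over `k`
collapses to `w_jl (m x y)` times that factor. Adjoints behave alike, with conjugated functions and
opposite translations. -/
theorem intertwines (D : DeformedAction T θ T' θ' r u s w m)
    {U : Lp ℂ 2 ν →L[ℂ] HilbertTensor (Lp ℂ 2 μ) (Lp ℂ 2 ν)}
    (hU : ∀ P Q, IsPullback m P Q → U (ContinuousMap.toLp 2 ν ℂ P) = tensorToLp μ ν Q)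
    (hd : Dense (Submodule.span ℂ
      (ContinuousMap.toLp 2 ν ℂ '' {P | ∃ Q, IsPullback (X := X) m P Q}) : Set (Lp ℂ 2 ν)))
    (j : I) (l : L) :
    Intertwines U (leftMul T' θ' (s j l) (w j l))
      (∑ k, opTensor (leftMul T θ (r j k) (u j k)) (leftMul T' θ' (s k l) (w k l))) := by
  have key : ∀ (f : I → C(X, ℂ)) (a : I → Fin n → ℝ) (g : I → C(Y, ℂ)) (b : I → Fin n' → ℝ)
      (p : C(Y, ℂ)) (t : Fin n' → ℝ), (∀ x y, p (m x y) = ∑ k, f k x * g k y) →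
      (∀ k x y, m (T.act (a k) x) (T'.act (b k) y) = T'.act t (m x y)) →
      (∑ k, opTensor (mulTranslate T (f k) (a k)) (mulTranslate T' (g k) (b k))) ∘L U =
        U ∘L mulTranslate T' p t := by
    intro f a g b p t hp ht
    refine ContinuousLinearMap.ext_on hd ?_
    rintro _ ⟨P, ⟨Q, h⟩, rfl⟩
    rw [ContinuousLinearMap.comp_apply, ContinuousLinearMap.comp_apply, hU P Q h,
      mulTranslate_toLp]
    refine Eq.trans ?_ (hU _ _ (h.mulTranslate T T' hp ht)).symm
    rw [map_sum, sum_apply]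
    exact Finset.sum_congr rfl fun k _ => (tensorToLp_map_mulTranslateC T T' _ _ _ _ Q).symm
  refine ⟨key _ _ _ _ _ _ (D.coordinates j l) fun k => D.shift j k l, ?_⟩
  have h2 : star (∑ k, opTensor (leftMul T θ (r j k) (u j k)) (leftMul T' θ' (s k l) (w k l))) =
      ∑ k, opTensor (mulTranslate T (star (u j k)) (-halfShift θ (r j k)))
        (mulTranslate T' (star (w k l)) (-halfShift θ' (s k l))) := by
    rw [star_sum]
    refine Finset.sum_congr rfl fun k _ => ?_
    rw [star_opTensor, star_leftMul' D.skew' (D.isotypic_w k l),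
      star_leftMul' D.skew (D.isotypic_u j k)]
  rw [star_leftMul' D.skew' (D.isotypic_w j l), h2]
  exact key _ _ _ _ _ _ (D.star_coordinates j l) fun k => D.shift_neg j k l

/-- The deformed coaction. -/
theorem exists_coaction (D : DeformedAction T θ T' θ' r u s w m) :
    ∃ δ : deformedAlgebra T' θ' →⋆ₐ[ℂ] spatialTensor (deformedAlgebra T θ) (deformedAlgebra T' θ'),
      (∀ j l, δ (toDeformed T' θ' (s j l) (w j l) (D.isotypic_w j l)) =
        ∑ k, elemTensor (toDeformed T θ (r j k) (u j k) (D.isotypic_u j k))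
          (toDeformed T' θ' (s k l) (w k l) (D.isotypic_w k l))) ∧
      Implemented δ ∧
      ((∀ P : C(Y, ℂ), ∃ c, ∀ y, ∫ x, P (m x y) ∂μ = c) →
        coinvariants δ = Set.range (algebraMap ℂ (deformedAlgebra T' θ'))) := by
  obtain ⟨U, hU, hd⟩ := exists_pullback_operator (μ := μ) D.measurePreserving D.separates_w
    (fun p => ⟨∑ k, u p.1 k ⊗ₜ w k p.2, fun x y => by
      rw [D.coordinates, map_sum]
      rfl⟩)
    (fun p => ⟨∑ k, star (u p.1 k) ⊗ₜ star (w k p.2), fun x y => by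
      rw [D.star_coordinates, map_sum]
      rfl⟩)
  have hU1 : U (ContinuousMap.toLp 2 ν ℂ 1) =
      HilbertTensor.tmul (ContinuousMap.toLp 2 μ ℂ 1) (ContinuousMap.toLp 2 ν ℂ 1) :=
    hU 1 (1 ⊗ₜ 1) fun x y => by simp
  have hX : Dense (Submodule.span ℂ (ContinuousMap.toLp 2 μ ℂ '' {f | ∃ r, IsIsotypic T r f}) :
      Set (Lp ℂ 2 μ)) :=
    dense_span_isotypic (fun p : I × I => D.isotypic_u p.1 p.2) D.separates_u
  have hY : Dense (Submodule.span ℂ (ContinuousMap.toLp 2 ν ℂ '' {f | ∃ r, IsIsotypic T' r f}) :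
      Set (Lp ℂ 2 ν)) :=
    dense_span_isotypic (fun p : I × L => D.isotypic_w p.1 p.2) D.separates_w
  let κ := {p : ((Fin n → ℤ) × C(X, ℂ)) × ((Fin n' → ℤ) × C(Y, ℂ)) //
    IsIsotypic T p.1.1 p.1.2 ∧ IsIsotypic T' p.2.1 p.2.2}
  -- The range of `U` contains only functions of `m x y` and need not be dense. Right
  -- multiplications commute with the target algebra, so each `V p` is again an intertwiner, and `V
  -- p 1 = f ⊗ g` gives density.
  let V : κ → Lp ℂ 2 ν →L[ℂ] HilbertTensor (Lp ℂ 2 μ) (Lp ℂ 2 ν) := fun p =>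
    mapTensor (rightMul T θ p.1.1.1 p.1.1.2) (rightMul T' θ' p.1.2.1 p.1.2.2) ∘L U
  have hVd : Dense (Submodule.span ℂ (⋃ p, Set.range (V p)) :
      Set (HilbertTensor (Lp ℂ 2 μ) (Lp ℂ 2 ν))) := by
    refine (HilbertTensor.dense_span_tmul hX hY).mono (Submodule.span_mono ?_)
    rintro _ ⟨_, ⟨f, ⟨a, hf⟩, rfl⟩, _, ⟨g, ⟨b, hg⟩, rfl⟩, rfl⟩
    refine Set.mem_iUnion.2 ⟨⟨((a, f), (b, g)), hf, hg⟩, ContinuousMap.toLp 2 ν ℂ 1, ?_⟩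
    change mapTensor (rightMul T θ a f) (rightMul T' θ' b g) (U _) = _
    rw [hU1, mapTensor_tmul, rightMul_one, rightMul_one]
  -- `U` itself is kept in the family, because the coinvariants are computed from the relation
  -- between `U` and `δ`.
  let V' : Option κ → Lp ℂ 2 ν →L[ℂ] HilbertTensor (Lp ℂ 2 μ) (Lp ℂ 2 ν) := fun o => o.elim U V
  have hint := D.intertwines hU hd
  have hsum : ∀ j l, ((∑ k, elemTensor (toDeformed T θ (r j k) (u j k) (D.isotypic_u j k))
        (toDeformed T' θ' (s k l) (w k l) (D.isotypic_w k l)) :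
        spatialTensor (deformedAlgebra T θ) (deformedAlgebra T' θ')) :
        HilbertTensor (Lp ℂ 2 μ) (Lp ℂ 2 ν) →L[ℂ] HilbertTensor (Lp ℂ 2 μ) (Lp ℂ 2 ν)) =
      ∑ k, opTensor (leftMul T θ (r j k) (u j k)) (leftMul T' θ' (s k l) (w k l)) := by
    intro j l
    rw [AddSubmonoidClass.coe_finsetSum]
    rfl
  obtain ⟨δ, hδ, hδV⟩ := exists_starAlgHom_of_intertwine _ D.generates_w
    (fun p : I × L => ∑ k, elemTensor (toDeformed T θ (r p.1 k) (u p.1 k) (D.isotypic_u p.1 k))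
          (toDeformed T' θ' (s k p.2) (w k p.2) (D.isotypic_w k p.2)))
    V'
    (fun p q => by
      rw [hsum]
      rcases q with - | q
      · exact hint p.1 p.2
      refine Intertwines.comp ?_ (hint p.1 p.2)
      refine Intertwines.sum fun k => ?_
      exact (intertwines_rightMul D.skew q.2.1 (toDeformed T θ _ _ (D.isotypic_u p.1 k))).mapTensor
        (intertwines_rightMul D.skew' q.2.2 (toDeformed T' θ' _ _ (D.isotypic_w k p.2)))) (by
      exact hVd.mono (Submodule.span_mono (Set.iUnion_subset fun q =>
        Set.subset_iUnion (fun o : Option κ => Set.range (V' o)) (some q))))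
  refine ⟨δ, fun j l => hδ (j, l), ?_, fun hconst => ?_⟩
  · refine hVd.mono (Submodule.span_mono (Set.iUnion_subset fun p => ?_))
    refine fun v hv => Set.mem_iUnion.2 ⟨⟨V p, fun a => hδV a (some p)⟩, hv⟩
  · exact coinvariants_eq D.skew' hY hU1 (sliceOne_apply_mem_span hU hd hconst) δ
      fun a => hδV a none

end DeformedAction

end Coaction

/-! ### The action of `SU(3)` on the 5-sphere -/

section SphereAction

/-- The action of `SU(3)` on `ℂ³`. -/
def smulVec (g : SU3) (v : EuclideanSpace ℂ (Fin 3)) : EuclideanSpace ℂ (Fin 3) :=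
  WithLp.toLp 2 ((g : Matrix (Fin 3) (Fin 3) ℂ).mulVec v.ofLp)

theorem smulVec_apply (g : SU3) (v : EuclideanSpace ℂ (Fin 3)) (i : Fin 3) :
    smulVec g v i = ∑ k, (g : Matrix (Fin 3) (Fin 3) ℂ) i k * v k := rfl

theorem smulVec_mul (g h : SU3) (v : EuclideanSpace ℂ (Fin 3)) :
    smulVec (g * h) v = smulVec g (smulVec h v) := by
  simp [smulVec, Matrix.mulVec_mulVec]

theorem smulVec_one (v : EuclideanSpace ℂ (Fin 3)) : smulVec 1 v = v := by
  simp [smulVec]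

theorem norm_smulVec (g : SU3) (v : EuclideanSpace ℂ (Fin 3)) : ‖smulVec g v‖ = ‖v‖ := by
  have hg : star (g : Matrix (Fin 3) (Fin 3) ℂ) * g = 1 :=
    Matrix.mem_unitaryGroup_iff'.1 (Matrix.mem_specialUnitaryGroup_iff.1 g.2).1
  have h : inner ℂ (smulVec g v) (smulVec g v) = inner ℂ v v := by
    rw [EuclideanSpace.inner_eq_star_dotProduct, EuclideanSpace.inner_eq_star_dotProduct]
    simp only [smulVec]
    rw [Matrix.star_mulVec, dotProduct_comm, ← Matrix.dotProduct_mulVec, Matrix.mulVec_mulVec,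
      ← Matrix.star_eq_conjTranspose, hg, Matrix.one_mulVec, dotProduct_comm]
  rw [inner_self_eq_norm_sq_to_K, inner_self_eq_norm_sq_to_K] at h
  exact (sq_eq_sq₀ (norm_nonneg _) (norm_nonneg _)).1 (by exact_mod_cast h)

/-- The action of an element of `SU(3)` as a linear isometry. -/
def smulIsometry (g : SU3) : EuclideanSpace ℂ (Fin 3) ≃ₗᵢ[ℝ] EuclideanSpace ℂ (Fin 3) where
  toFun := smulVec g
  invFun := smulVec g⁻¹
  map_add' v w := by simp [smulVec, Matrix.mulVec_add]
  map_smul' c v := by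
    simp [smulVec, Matrix.mulVec_smul]
  left_inv v := by rw [← smulVec_mul, inv_mul_cancel, smulVec_one]
  right_inv v := by rw [← smulVec_mul, mul_inv_cancel, smulVec_one]
  norm_map' v := norm_smulVec g v

/-- The action of `SU(3)` on the 5-sphere. -/
def smulS5 (g : SU3) (y : S5) : S5 :=
  ⟨smulVec g y, by
    rw [mem_sphere_zero_iff_norm, norm_smulVec]
    exact mem_sphere_zero_iff_norm.1 y.2⟩

theorem smulS5_mul (g h : SU3) (y : S5) : smulS5 (g * h) y = smulS5 g (smulS5 h y) :=
  Subtype.ext (smulVec_mul g h y)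

theorem measurePreserving_smulS5 (g : SU3) : MeasurePreserving (smulS5 g) surfS5 surfS5 :=
  measurePreserving_surfS5 (smulIsometry g) _
    (((smulIsometry g).continuous.comp continuous_subtype_val).subtype_mk _) fun _ => rfl

theorem coordZ_smulS5 (g : SU3) (y : S5) (j : Fin 3) :
    coordZ j (smulS5 g y) = ∑ k, coordU j k g * coordZ k y := rfl

/-- The first basis vector as a point of the sphere. -/
def baseS5 : S5 := ⟨EuclideanSpace.single 0 1, by simp⟩

theorem exists_smulS5_baseS5 (y : S5) : ∃ g, smulS5 g baseS5 = y := by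
  have hy : ‖(y : EuclideanSpace ℂ (Fin 3))‖ = 1 := mem_sphere_zero_iff_norm.1 y.2
  have ho : Orthonormal ℂ (({0} : Set (Fin 3)).domRestrict
      fun _ : Fin 3 => (y : EuclideanSpace ℂ (Fin 3))) := by
    constructor
    · intro i
      exact hy
    · intro i j hij
      exact absurd (Subsingleton.elim i j) hij
  obtain ⟨b, hb⟩ := ho.exists_orthonormalBasis_extension_of_card_eq (by simp)
  have hb0 : b 0 = y := hb 0 rfl
  set U : Matrix (Fin 3) (Fin 3) ℂ :=
    (EuclideanSpace.basisFun (Fin 3) ℂ).toBasis.toMatrix b with hU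
  have hUmem : U ∈ Matrix.unitaryGroup (Fin 3) ℂ :=
    OrthonormalBasis.toMatrix_orthonormalBasis_mem_unitary _ _
  have hUapp : ∀ i j, U i j = b j i := by
    intro i j
    simp [hU, Module.Basis.toMatrix_apply]
  have hdet : U.det ∈ unitary ℂ := Matrix.det_of_mem_unitary hUmem
  -- The unitary matrix `U` has first column `y`. Rescaling its last column by the conjugate of the
  -- determinant puts it into SU(3) and leaves that column alone.
  set D : Matrix (Fin 3) (Fin 3) ℂ := Matrix.diagonal ![1, 1, star U.det] with hD
  have hDmem : D ∈ Matrix.unitaryGroup (Fin 3) ℂ := by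
    rw [Matrix.mem_unitaryGroup_iff, Matrix.star_eq_conjTranspose, hD,
      Matrix.diagonal_conjTranspose, Matrix.diagonal_mul_diagonal, ← Matrix.diagonal_one]
    congr 1
    ext i
    fin_cases i
    · simp
    · simp
    · have := (Unitary.mem_iff.1 hdet).1
      simpa using this
  refine ⟨⟨U * D, ?_⟩, ?_⟩
  · rw [Matrix.mem_specialUnitaryGroup_iff]
    refine ⟨mul_mem hUmem hDmem, ?_⟩
    rw [Matrix.det_mul, hD, Matrix.det_diagonal, Fin.prod_univ_three]
    have := (Unitary.mem_iff.1 hdet).2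
    simpa using this
  · apply Subtype.ext
    ext i
    change smulVec _ (EuclideanSpace.single 0 1) i = _
    rw [smulVec_apply]
    simp only [hD, Matrix.mul_diagonal, Fin.sum_univ_three, hUapp]
    simp [hb0]

/-- Transitivity writes `y` as `k · baseS5`, and right invariance of Haar measure absorbs `k`. -/
theorem integral_smulS5_eq (P : C(S5, ℂ)) (y : S5) :
    ∫ g, P (smulS5 g y) ∂haarSU3 = ∫ g, P (smulS5 g baseS5) ∂haarSU3 := by
  obtain ⟨k, rfl⟩ := exists_smulS5_baseS5 y
  simp only [← smulS5_mul]
  exact integral_mul_right_eq_self (fun g => P (smulS5 g baseS5)) k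

end SphereAction

/-! ### The twisting elements of the maximal torus -/

section Twist

theorem transpose_matJ (θ : ℝ) : (matJ θ).transpose = -matJ θ := by
  ext i j
  fin_cases i <;> fin_cases j <;> simp [matJ]

/-- The element of the maximal torus by which the weight `wt j` is twisted. -/
def twist (θ : ℝ) (j : Fin 3) : SU3 :=
  maxTorus ![1 / 2 * (θ * wt j 1), -(1 / 2 * (θ * wt j 0))]

/-- The two blocks of `matJ` have opposite signs, so both sides are twisted by the same elements
`twist θ j`, one of them inverted. This makes the inner twists of `u_jk ⊗ u_kl` cancel. -/
theorem act_halfShift_weightU (θ : ℝ) (j k : Fin 3) (g : SU3) :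
    actSU3.act (halfShift (matJ θ) (weightU j k)) g = twist θ j * g * (twist θ k)⁻¹ := by
  have h1 : ∀ i, halfShift (matJ θ) (weightU j k) i =
      ![-(1 / 2 * (θ * wt j 1)), 1 / 2 * (θ * wt j 0), -(1 / 2 * (θ * wt k 1)),
        1 / 2 * (θ * wt k 0)] i := by
    intro i
    fin_cases i <;>
      simp [halfShift, matJ, weightU, Matrix.vecHead, Matrix.vecTail] <;> ring
  have h2 : (twist θ k)⁻¹ = maxTorus ![-(1 / 2 * (θ * wt k 1)), 1 / 2 * (θ * wt k 0)] := by
    rw [inv_eq_iff_mul_eq_one, twist, ← maxTorus_add]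
    convert maxTorus_zero using 2
    ext i
    fin_cases i <;> simp
  change maxTorus _ * g * maxTorus _ = _
  rw [h2, h1, h1, h1, h1, twist]
  simp

/-- The translation belonging to `z_k` multiplies the coordinate `l` by `e^{πi θ'_kl}`. The
parameter conditions say that these three phases are the diagonal entries of `twist θ k`; this is
where they enter. -/
theorem act_halfShift_single {θ : ℝ} {θ' : Matrix (Fin 3) (Fin 3) ℝ} (hθ' : θ'.transpose = -θ')
    (h1 : -θ' 0 1 = θ) (h2 : θ' 0 2 = θ) (h3 : -θ' 1 2 = θ) (k : Fin 3) (y : S5) :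
    actS5.act (halfShift θ' (Pi.single k 1)) y = smulS5 (twist θ k) y := by
  have hs : ∀ i j, θ' j i = -θ' i j := fun i j => congrFun (congrFun hθ' i) j
  have h0 : ∀ i, θ' i i = 0 := fun i => by linarith [hs i i]
  have h4 : ∀ l, halfShift θ' (Pi.single k 1) l = 1 / 2 * θ' k l := by
    intro l
    simp [halfShift, Matrix.vecMul, dotProduct, Pi.single_apply]
  apply Subtype.ext
  ext l
  change e2pi _ * (y : EuclideanSpace ℂ (Fin 3)) l = ((Matrix.diagonal _).mulVec _) l
  rw [Matrix.mulVec_diagonal, h4]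
  congr 1
  have h01 : θ' 0 1 = -θ := by linarith
  have h12 : θ' 1 2 = -θ := by linarith
  fin_cases k <;> fin_cases l <;>
    simp [wt, h0, h01, h2, h12, hs 0 1, hs 0 2, hs 1 2, e2pi_zero]

end Twist

/-! ### The coproduct and the coaction on the sphere -/

section Instances

theorem coordU_separates (x y : SU3) (h : x ≠ y) :
    ∃ p : Fin 3 × Fin 3, coordU p.1 p.2 x ≠ coordU p.1 p.2 y := by
  by_contra! hc
  exact h (Subtype.ext (Matrix.ext fun i j => hc (i, j)))

theorem coordZ_separates (x y : S5) (h : x ≠ y) :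
    ∃ p : Fin 3 × Unit, coordZ p.1 x ≠ coordZ p.1 y := by
  by_contra! hc
  exact h (Subtype.ext (PiLp.ext fun i => hc (i, ())))

theorem deformedAction_SU3 (θ : ℝ) :
    DeformedAction actSU3 (matJ θ) actSU3 (matJ θ) weightU coordU weightU coordU
      (fun x y => x * y) where
  skew := transpose_matJ θ
  skew' := transpose_matJ θ
  measurePreserving x := measurePreserving_mul_left haarSU3 x
  isotypic_u := isIsotypic_coordU
  isotypic_w := isIsotypic_coordU
  separates_u := coordU_separates
  separates_w := coordU_separates
  coordinates j l x y := by
    change ((x : Matrix (Fin 3) (Fin 3) ℂ) * (y : Matrix (Fin 3) (Fin 3) ℂ)) j l = _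
    rw [Matrix.mul_apply]
    rfl
  shift j k l x y := by
    simp only [act_halfShift_weightU]
    group

theorem deformedAction_S5 {θ : ℝ} {θ' : Matrix (Fin 3) (Fin 3) ℝ} (hθ' : θ'.transpose = -θ')
    (h1 : -θ' 0 1 = θ) (h2 : θ' 0 2 = θ) (h3 : -θ' 1 2 = θ) :
    DeformedAction actSU3 (matJ θ) actS5 θ' weightU coordU
      (fun j (_ : Unit) => Pi.single j 1) (fun j _ => coordZ j) smulS5 where
  skew := transpose_matJ θ
  skew' := hθ'
  measurePreserving := measurePreserving_smulS5
  isotypic_u := isIsotypic_coordU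
  isotypic_w j _ := isIsotypic_coordZ j
  separates_u := coordU_separates
  separates_w := coordZ_separates
  coordinates j _ x y := coordZ_smulS5 x y j
  shift j k _ x y := by
    -- With `t = twist θ`, the identity is `(t j * x * (t k)⁻¹) * t k = t j * x` in the group,
    -- applied to `y`.
    simp only [act_halfShift_weightU, act_halfShift_single hθ' h1 h2 h3, ← smulS5_mul]
    congr 1
    group

instance isClosed_CSU3 (θ : ℝ) : IsClosed (CSU3 θ : Set (Lp ℂ 2 haarSU3 →L[ℂ] Lp ℂ 2 haarSU3)) :=
  isClosed_deformedAlgebra _ _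

instance isClosed_CS5 (θ : Matrix (Fin 3) (Fin 3) ℝ) :
    IsClosed (CS5 θ : Set (Lp ℂ 2 surfS5 →L[ℂ] Lp ℂ 2 surfS5)) :=
  isClosed_deformedAlgebra _ _

theorem generates_u (θ : ℝ) : Generates fun p : Fin 3 × Fin 3 => u θ p.1 p.2 :=
  generates_toDeformed (transpose_matJ θ) (fun p : Fin 3 × Fin 3 => isIsotypic_coordU p.1 p.2)
    coordU_separates

theorem generates_z {θ : Matrix (Fin 3) (Fin 3) ℝ} (hθ : θ.transpose = -θ) :
    Generates fun j : Fin 3 => z θ j :=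
  generates_toDeformed hθ (fun j : Fin 3 => isIsotypic_coordZ j) fun x y h => by
    obtain ⟨p, hp⟩ := coordZ_separates x y h
    exact ⟨p.1, hp⟩

theorem exists_coproduct (θ : ℝ) :
    ∃ Δ : CSU3 θ →⋆ₐ[ℂ] spatialTensor (CSU3 θ) (CSU3 θ), IsCoproduct θ Δ ∧ Implemented Δ := by
  obtain ⟨Δ, h1, h2, -⟩ := (deformedAction_SU3 θ).exists_coaction
  exact ⟨Δ, h1, h2⟩

set_option maxHeartbeats 1000000 in
theorem exists_coaction_S5 {θ : ℝ} {θ' : Matrix (Fin 3) (Fin 3) ℝ} (hθ' : θ'.transpose = -θ')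
    (h1 : -θ' 0 1 = θ) (h2 : θ' 0 2 = θ) (h3 : -θ' 1 2 = θ) :
    ∃ δ : CS5 θ' →⋆ₐ[ℂ] spatialTensor (CSU3 θ) (CS5 θ'),
      (∀ j, δ (z θ' j) = ∑ k, elemTensor (u θ j k) (z θ' k)) ∧ Implemented δ ∧
      coinvariants δ = Set.range (algebraMap ℂ (CS5 θ')) := by
  obtain ⟨δ, h4, h5, h6⟩ := (deformedAction_S5 hθ' h1 h2 h3).exists_coaction
  refine Exists.intro (α := CS5 θ' →⋆ₐ[ℂ] spatialTensor (CSU3 θ) (CS5 θ')) δ ?_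
  refine ⟨?_, ?_, ?_⟩
  · intro j
    exact h4 j ()
  · exact h5
  · apply h6
    intro P
    exact ⟨∫ g, P (smulS5 g baseS5) ∂haarSU3, integral_smulS5_eq P⟩

end Instances

/-! ### The counit -/

section Counit

open Filter Topology

/-- A pointwise bound by a translate of `f` suffices, since translation is isometric on `L²`. -/
theorem norm_toLp_le_of_le {n : ℕ} {X : Type*} [TopologicalSpace X] [CompactSpace X]
    [MeasurableSpace X] [BorelSpace X] {μ : Measure X} [IsFiniteMeasure μ] (T : TorusAction n X μ)
    (t : Fin n → ℝ) {f k : C(X, ℂ)} {c : ℝ} (h : ∀ x, ‖k x‖ ≤ c * ‖f (T.act t x)‖) :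
    ‖ContinuousMap.toLp 2 μ ℂ k‖ ≤ c * ‖ContinuousMap.toLp 2 μ ℂ f‖ := by
  have h1 : ‖translateOp T t (ContinuousMap.toLp 2 μ ℂ f)‖ = ‖ContinuousMap.toLp 2 μ ℂ f‖ :=
    (Lp.compMeasurePreservingₗᵢ ℂ (T.act t) (T.measurePreserving t)).norm_map _
  rw [← h1, translateOp_toLp]
  refine Lp.norm_le_mul_norm_of_ae_le_mul ?_
  filter_upwards [ContinuousMap.coeFn_toLp (p := 2) (𝕜 := ℂ) μ k,
    ContinuousMap.coeFn_toLp (p := 2) (𝕜 := ℂ) μ (f.comp (T.actMap t))] with x h2 h3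
  rw [h2, h3]
  exact h x

/-- A distance of an element of `SU(3)` to the unit element. -/
def distOne (g : SU3) : ℝ := ∑ p : Fin 3 × Fin 3, ‖coordU p.1 p.2 g - if p.1 = p.2 then 1 else 0‖

theorem continuous_distOne : Continuous distOne :=
  continuous_finsetSum _ fun p _ => ((coordU p.1 p.2).continuous.sub continuous_const).norm

theorem distOne_one : distOne 1 = 0 := by
  refine Finset.sum_eq_zero fun p _ => ?_
  change ‖(1 : Matrix (Fin 3) (Fin 3) ℂ) p.1 p.2 - _‖ = 0
  rw [Matrix.one_apply, sub_self, norm_zero]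

theorem norm_coordU_sub_le_distOne (i j : Fin 3) (g : SU3) :
    ‖coordU i j g - if i = j then 1 else 0‖ ≤ distOne g :=
  Finset.single_le_sum (f := fun p : Fin 3 × Fin 3 =>
    ‖coordU p.1 p.2 g - if p.1 = p.2 then 1 else 0‖) (fun _ _ => norm_nonneg _)
    (Finset.mem_univ (i, j))

theorem sum_halfShift_weightU (θ : ℝ) (i j k l : Fin 3) :
    ∑ m, halfShift (matJ θ) (weightU i j) m * weightU k l m =
      1 / 2 * θ * ((wt i 1 * wt k 0 - wt i 0 * wt k 1) - (wt j 1 * wt l 0 - wt j 0 * wt l 1)) := by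
  simp [halfShift, matJ, weightU, Matrix.vecHead, Matrix.vecTail, Fin.sum_univ_four]
  ring

/-- The translation belonging to `u_kk` is conjugation by a torus element: it fixes the diagonal
entries and changes the others by phases. -/
theorem distOne_act (θ : ℝ) (k : Fin 3) (g : SU3) :
    distOne (actSU3.act (halfShift (matJ θ) (weightU k k)) g) = distOne g := by
  refine Finset.sum_congr rfl fun p _ => ?_
  rw [isIsotypic_coordU, sum_halfShift_weightU]
  split_ifs with h
  · rw [h, sub_self, mul_zero, e2pi_zero, one_mul]
  · rw [sub_zero, sub_zero, norm_mul, norm_e2pi, one_mul]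

/-- A bump function around the unit element of `SU(3)`. -/
def bump (n : ℕ) : C(SU3, ℂ) where
  toFun g := ((max 0 (1 / (n + 1) - distOne g) : ℝ) : ℂ)
  continuous_toFun := Complex.continuous_ofReal.comp
    (continuous_const.max (continuous_const.sub continuous_distOne))

theorem bump_eq (n : ℕ) {g h : SU3} (hgh : distOne g = distOne h) : bump n g = bump n h := by
  change ((max 0 (1 / (n + 1) - distOne g) : ℝ) : ℂ) = ((max 0 (1 / (n + 1) - distOne h) : ℝ) : ℂ)
  rw [hgh]

theorem distOne_le_of_bump_ne_zero {n : ℕ} {g : SU3} (h : bump n g ≠ 0) :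
    distOne g ≤ 1 / (n + 1) := by
  by_contra! hc
  refine h ?_
  change ((max 0 (1 / (n + 1) - distOne g) : ℝ) : ℂ) = 0
  rw [max_eq_left (by linarith), Complex.ofReal_zero]

theorem toLp_bump_ne_zero (n : ℕ) : ContinuousMap.toLp 2 haarSU3 ℂ (bump n) ≠ 0 := by
  intro h
  have h1 : bump n = 0 := ContinuousMap.toLp_injective (p := 2) (𝕜 := ℂ) haarSU3 (by rw [h, map_zero])
  have h2 : ((max 0 (1 / (n + 1) - distOne 1) : ℝ) : ℂ) = 0 := DFunLike.congr_fun h1 1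
  rw [distOne_one, sub_zero, max_eq_right (by positivity)] at h2
  exact absurd (Complex.ofReal_eq_zero.1 h2) (by positivity)

theorem coordU_act_of_self {θ : ℝ} {i j : Fin 3} {t : Fin 4 → ℝ}
    (ht : t = halfShift (matJ θ) (weightU i j) ∨ t = -halfShift (matJ θ) (weightU i j)) (x : SU3) :
    coordU i j (actSU3.act t x) = coordU i j x := by
  have h := sum_halfShift_self (transpose_matJ θ) (weightU i j)
  rw [isIsotypic_coordU]
  rcases ht with rfl | rfl
  · rw [h, e2pi_zero, one_mul]
  · simp only [Pi.neg_apply, neg_mul, Finset.sum_neg_distrib, h, neg_zero, e2pi_zero, one_mul]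

/-- On the diagonal the translation preserves the bump, so the two terms combine to `(u_ii - 1)`
times the bump. Off the diagonal the support moves away from `1`, but `u_ij` is invariant under its
own translation, and so it is small on the moved support. -/
theorem norm_coordU_mul_bump_sub_le {θ : ℝ} {i j : Fin 3} {t : Fin 4 → ℝ}
    (ht : t = halfShift (matJ θ) (weightU i j) ∨ t = -halfShift (matJ θ) (weightU i j))
    (n : ℕ) (x : SU3) :
    ‖coordU i j x * bump n (actSU3.act t x) - (if i = j then 1 else 0) * bump n x‖ ≤
      1 / (n + 1) * ‖bump n (actSU3.act t x)‖ := by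
  have h1 : (if i = j then 1 else 0) * bump n x =
      (if i = j then 1 else 0) * bump n (actSU3.act t x) := by
    split_ifs with h
    · subst h
      congr 1
      rcases ht with rfl | rfl
      · exact (bump_eq n (distOne_act θ i x)).symm
      · have := distOne_act θ i (actSU3.act (-halfShift (matJ θ) (weightU i i)) x)
        rw [actSU3.act_act_neg] at this
        exact bump_eq n this
    · rw [zero_mul, zero_mul]
  rw [h1, ← sub_mul, norm_mul, ← coordU_act_of_self ht]
  by_cases h : bump n (actSU3.act t x) = 0
  · rw [h, norm_zero, mul_zero, mul_zero]
  · gcongr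
    exact (norm_coordU_sub_le_distOne i j _).trans (distOne_le_of_bump_ne_zero h)

theorem norm_mulTranslate_bump_sub_le {t : Fin 4 → ℝ} {f : C(SU3, ℂ)} {c : ℂ} (n : ℕ)
    (h : ∀ x, ‖f x * bump n (actSU3.act t x) - c * bump n x‖ ≤
      1 / (n + 1) * ‖bump n (actSU3.act t x)‖) :
    ‖mulTranslate actSU3 f t (ContinuousMap.toLp 2 haarSU3 ℂ (bump n)) -
        c • ContinuousMap.toLp 2 haarSU3 ℂ (bump n)‖ ≤
      1 / (n + 1) * ‖ContinuousMap.toLp 2 haarSU3 ℂ (bump n)‖ := by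
  rw [mulTranslate_toLp, ← map_smul, ← map_sub]
  exact norm_toLp_le_of_le actSU3 t h

/-- The vectors are bump functions around the unit element, normalised in `L²`. The error `1 / (n +
1)` is the radius of their support. -/
theorem exists_approximate_eigenvectors (θ : ℝ) :
    ∃ ξ : ℕ → Lp ℂ 2 haarSU3, (∀ n, ‖ξ n‖ = 1) ∧
      (∀ p : Fin 3 × Fin 3, Tendsto (fun n => (u θ p.1 p.2 : Lp ℂ 2 haarSU3 →L[ℂ] Lp ℂ 2 haarSU3)
        (ξ n) - (if p.1 = p.2 then (1 : ℂ) else 0) • ξ n) atTop (𝓝 0)) ∧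
      (∀ p : Fin 3 × Fin 3, Tendsto (fun n =>
        star (u θ p.1 p.2 : Lp ℂ 2 haarSU3 →L[ℂ] Lp ℂ 2 haarSU3) (ξ n) -
          star (if p.1 = p.2 then (1 : ℂ) else 0) • ξ n) atTop (𝓝 0)) := by
  set v : ℕ → Lp ℂ 2 haarSU3 := fun n => ContinuousMap.toLp 2 haarSU3 ℂ (bump n) with hv
  have hv0 : ∀ n, ‖v n‖ ≠ 0 := fun n => norm_ne_zero_iff.2 (toLp_bump_ne_zero n)
  have key : ∀ (a : Lp ℂ 2 haarSU3 →L[ℂ] Lp ℂ 2 haarSU3) (c : ℂ),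
      (∀ n, ‖a (v n) - c • v n‖ ≤ 1 / (n + 1) * ‖v n‖) →
      Tendsto (fun n => a (((‖v n‖⁻¹ : ℝ) : ℂ) • v n) - c • (((‖v n‖⁻¹ : ℝ) : ℂ) • v n))
        atTop (𝓝 0) := by
    intro a c h
    refine squeeze_zero_norm (fun n => ?_) tendsto_one_div_add_atTop_nhds_zero_nat
    rw [map_smul, smul_comm c, ← smul_sub, norm_smul, Complex.norm_real, norm_inv, norm_norm,
      inv_mul_le_iff₀ ((norm_nonneg _).lt_of_ne (hv0 n).symm), mul_comm]
    exact h n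
  refine ⟨fun n => ((‖v n‖⁻¹ : ℝ) : ℂ) • v n, fun n => ?_, fun p => key _ _ fun n => ?_,
    fun p => key _ _ fun n => ?_⟩
  · rw [norm_smul, Complex.norm_real, norm_inv, norm_norm, inv_mul_cancel₀ (hv0 n)]
  · exact norm_mulTranslate_bump_sub_le n
      (norm_coordU_mul_bump_sub_le (Or.inl rfl) n)
  · change ‖star (leftMul actSU3 (matJ θ) _ _) _ - _‖ ≤ _
    rw [star_leftMul' (transpose_matJ θ) (isIsotypic_coordU p.1 p.2)]
    refine norm_mulTranslate_bump_sub_le n fun x => ?_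
    have h := norm_coordU_mul_bump_sub_le (θ := θ) (i := p.1) (j := p.2) (Or.inr rfl) n x
    rw [← norm_star] at h
    have hb : ∀ y, star (bump n y) = bump n y := fun y => Complex.conj_ofReal _
    rw [star_sub, star_mul', star_mul', hb, hb] at h
    exact h

theorem exists_counit (θ : ℝ) : ∃ ε : CSU3 θ →⋆ₐ[ℂ] ℂ, IsCounit θ ε := by
  obtain ⟨ξ, h1, h2, h3⟩ := exists_approximate_eigenvectors θ
  obtain ⟨ε, hε⟩ := exists_character (generates_u θ) h1 h2 h3
  exact ⟨ε, fun i j => hε (i, j)⟩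

theorem exists_counit_slice {F : Type*} [NormedAddCommGroup F] [InnerProductSpace ℂ F]
    [CompleteSpace F] (B : StarSubalgebra ℂ (F →L[ℂ] F)) [IsClosed (B : Set (F →L[ℂ] F))] {θ : ℝ}
    {ε : CSU3 θ →⋆ₐ[ℂ] ℂ} (hε : IsCounit θ ε) :
    ∃ ε₁ : spatialTensor (CSU3 θ) B →⋆ₐ[ℂ] B, ∀ a b, ε₁ (elemTensor a b) = ε a • b := by
  obtain ⟨ξ, h1, h2, h3⟩ := exists_approximate_eigenvectors θ
  exact exists_slice (generates_u θ) h1 h2 h3 ε fun p => hε p.1 p.2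

end Counit

/-! ### The left coaction -/

section LeftCoaction

theorem dense_range_intertwines_id (E : Type*) [NormedAddCommGroup E] [InnerProductSpace ℂ E] :
    Dense (Submodule.span ℂ (⋃ _ : Unit, Set.range (ContinuousLinearMap.id ℂ E)) : Set E) := by
  have : (Set.range (ContinuousLinearMap.id ℂ E)) = Set.univ := Set.range_id
  rw [Set.iUnion_const, this, Submodule.span_univ]
  exact dense_univ

theorem sum_elemTensor_left {E F I : Type*} [NormedAddCommGroup E] [InnerProductSpace ℂ E]
    [CompleteSpace E] [NormedAddCommGroup F] [InnerProductSpace ℂ F] [CompleteSpace F]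
    {A : StarSubalgebra ℂ (E →L[ℂ] E)} {B : StarSubalgebra ℂ (F →L[ℂ] F)} (s : Finset I)
    (a : I → A) (b : B) : elemTensor (∑ i ∈ s, a i) b = ∑ i ∈ s, elemTensor (a i) b := by
  simp only [elemTensor_eq_inl_mul_inr, map_sum, Finset.sum_mul]

theorem sum_elemTensor_right {E F I : Type*} [NormedAddCommGroup E] [InnerProductSpace ℂ E]
    [CompleteSpace E] [NormedAddCommGroup F] [InnerProductSpace ℂ F] [CompleteSpace F]
    {A : StarSubalgebra ℂ (E →L[ℂ] E)} {B : StarSubalgebra ℂ (F →L[ℂ] F)} (s : Finset I)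
    (a : A) (b : I → B) : elemTensor a (∑ i ∈ s, b i) = ∑ i ∈ s, elemTensor a (b i) := by
  simp only [elemTensor_eq_inl_mul_inr, map_sum, Finset.mul_sum]

section Implemented

variable {E F K : Type*} [NormedAddCommGroup E] [InnerProductSpace ℂ E] [CompleteSpace E]
  [NormedAddCommGroup F] [InnerProductSpace ℂ F] [CompleteSpace F]
  [NormedAddCommGroup K] [InnerProductSpace ℂ K] [CompleteSpace K]
  {A : StarSubalgebra ℂ (E →L[ℂ] E)}
  {C : StarSubalgebra ℂ (K →L[ℂ] K)}
  {φ : A →⋆ₐ[ℂ] C}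

/-- Tensoring the intertwiners of `φ` with the identity implements `φ ⊗ id`. The maps `Δ ⊗ id` and
`id ⊗ δ` on completed tensor products arise in this way. -/
theorem Implemented.exists_tensor_id (hφ : Implemented φ) (B : StarSubalgebra ℂ (F →L[ℂ] F)) :
    ∃ χ : spatialTensor A B →⋆ₐ[ℂ] spatialTensor C B,
      ∀ a b, χ (elemTensor a b) = elemTensor (φ a) b :=
  exists_tensor_hom φ
    (fun T : {T : E →L[ℂ] K // ∀ a : A, Intertwines T (a : E →L[ℂ] E) (φ a : K →L[ℂ] K)} => T.1)
    (fun a T => T.2 a) hφ (StarAlgHom.id ℂ B) (fun _ : Unit => ContinuousLinearMap.id ℂ F)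
    (fun _ _ => intertwines_id _) (dense_range_intertwines_id F)

theorem Implemented.exists_id_tensor (hφ : Implemented φ) (B : StarSubalgebra ℂ (F →L[ℂ] F)) :
    ∃ χ : spatialTensor B A →⋆ₐ[ℂ] spatialTensor B C,
      ∀ b a, χ (elemTensor b a) = elemTensor b (φ a) :=
  exists_tensor_hom (StarAlgHom.id ℂ B) (fun _ : Unit => ContinuousLinearMap.id ℂ F)
    (fun _ _ => intertwines_id _) (dense_range_intertwines_id F) φ
    (fun T : {T : E →L[ℂ] K // ∀ a : A, Intertwines T (a : E →L[ℂ] E) (φ a : K →L[ℂ] K)} => T.1)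
    (fun a T => T.2 a) hφ

end Implemented

/-- Both axioms are equalities of *-homomorphisms, so they need checking only on the `z j`. There
coassociativity is an exchange of two finite sums. -/
theorem isLeftCoaction {F I : Type*} [Fintype I] [DecidableEq I]
    {E : Type*} [NormedAddCommGroup E] [InnerProductSpace ℂ E] [CompleteSpace E]
    [NormedAddCommGroup F] [InnerProductSpace ℂ F] [CompleteSpace F]
    {H : StarSubalgebra ℂ (E →L[ℂ] E)} {A : StarSubalgebra ℂ (F →L[ℂ] F)}
    [IsClosed (H : Set (E →L[ℂ] E))] [IsClosed (A : Set (F →L[ℂ] F))]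
    {u : I → I → H} {z : I → A} (hz : Generates z)
    {Δ : H →⋆ₐ[ℂ] spatialTensor H H} (hΔ : ∀ i j, Δ (u i j) = ∑ k, elemTensor (u i k) (u k j))
    (hΔi : Implemented Δ)
    {ε : H →⋆ₐ[ℂ] ℂ} (hε : ∀ i j, ε (u i j) = if i = j then 1 else 0)
    (hε₁ : ∃ ε₁ : spatialTensor H A →⋆ₐ[ℂ] A, ∀ h a, ε₁ (elemTensor h a) = ε h • a)
    {δ : A →⋆ₐ[ℂ] spatialTensor H A} (hδ : ∀ j, δ (z j) = ∑ k, elemTensor (u j k) (z k))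
    (hδi : Implemented δ) : IsLeftCoaction H A Δ ε δ := by
  constructor
  · obtain ⟨assoc, h1⟩ := exists_spatialTensor_assoc (A := H) (B := H) (C := A)
    obtain ⟨Δ₁, h2⟩ := hΔi.exists_tensor_id A
    obtain ⟨δ₁, h3⟩ := hδi.exists_id_tensor H
    refine ⟨assoc, Δ₁, δ₁, h1, h2, h3, fun a => ?_⟩
    have h4 : ((assoc : _ →⋆ₐ[ℂ] _).comp Δ₁).comp δ = δ₁.comp δ := hz.ext fun j => by
      change assoc (Δ₁ (δ (z j))) = δ₁ (δ (z j))
      simp only [hδ, map_sum, h2, h3, hΔ, sum_elemTensor_left, h1,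
        sum_elemTensor_right]
      exact Finset.sum_comm
    exact DFunLike.congr_fun h4 a
  · obtain ⟨ε₁, h1⟩ := hε₁
    refine ⟨ε₁, h1, fun a => ?_⟩
    have h2 : ε₁.comp δ = StarAlgHom.id ℂ A := hz.ext fun j => by
      change ε₁ (δ (z j)) = z j
      simp [hδ, h1, hε]
    exact DFunLike.congr_fun h2 a

end LeftCoaction

/-! ### Necessity of the relations between the parameters -/

section Converse

theorem e2pi_half : e2pi (1 / 2) = -1 := by
  rw [e2pi, ← Complex.exp_pi_mul_I]
  congr 1
  push_cast
  ring

theorem exists_int_of_e2pi_eq {s t : ℝ} (h : e2pi s = e2pi t) : ∃ n : ℤ, s = t + n := by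
  obtain ⟨n, hn⟩ := Complex.exp_eq_exp_iff_exists_int.1 h
  refine ⟨n, ?_⟩
  have h1 : (2 * Real.pi * Complex.I : ℂ) * ((s : ℂ) - (t + n)) = 0 := by
    linear_combination hn
  have h2 := (mul_eq_zero.1 h1).resolve_left Complex.two_pi_I_ne_zero
  have h3 : (s : ℂ) = ((t + n : ℝ) : ℂ) := by
    push_cast
    linear_combination h2
  exact_mod_cast h3

theorem inner_eq_zero_of_weight_ne {n : ℕ} {X : Type*} [TopologicalSpace X] [CompactSpace X]
    [MeasurableSpace X] [BorelSpace X] {μ : Measure X} [IsFiniteMeasure μ] [NormalSpace X]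
    [μ.WeaklyRegular] {T : TorusAction n X μ} {r s : Fin n → ℤ} {f g : C(X, ℂ)} (hf : IsIsotypic T r f) (hg : IsIsotypic T s g)
    (hrs : r ≠ s) :
    inner ℂ (ContinuousMap.toLp 2 μ ℂ f) (ContinuousMap.toLp 2 μ ℂ g) = 0 := by
  obtain ⟨j, hj⟩ := Function.ne_iff.1 hrs
  have hfg := hf.star.mul hg
  have hd : ((s j - r j : ℤ) : ℝ) ≠ 0 := Int.cast_ne_zero.2 (sub_ne_zero.2 (Ne.symm hj))
  -- This translation multiplies `star f * g` by `e^{πi} = -1`, so invariance of the measure makes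
  -- the integral its own negative.
  have ht : ∑ i, (Pi.single j (1 / (2 * ((s j - r j : ℤ) : ℝ))) : Fin n → ℝ) i * ((-r + s) i : ℤ) =
      1 / 2 := by
    rw [Finset.sum_eq_single j (fun i _ hi => by rw [Pi.single_eq_of_ne hi, zero_mul])
      (fun h => absurd (Finset.mem_univ j) h), Pi.single_eq_same, Pi.add_apply, Pi.neg_apply,
      neg_add_eq_sub]
    field_simp
  rw [inner_toLp_eq]
  have h := T.integral_act (Pi.single j (1 / (2 * ((s j - r j : ℤ) : ℝ)))) (star f * g : C(X, ℂ))
  simp only [hfg _ _, ht, e2pi_half, neg_one_mul, integral_neg] at h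
  exact self_eq_neg.1 h.symm

instance : surfS5.IsOpenPosMeasure := by unfold surfS5; infer_instance

theorem toLp_coordU_mul_ne_zero (i j : Fin 3) :
    ContinuousMap.toLp 2 haarSU3 ℂ (coordU i 0 * coordU j 0) ≠ 0 := by
  intro h
  have h1 : coordU i 0 * coordU j 0 = 0 :=
    ContinuousMap.toLp_injective (p := 2) (𝕜 := ℂ) haarSU3 (by rw [h, map_zero])
  have h3 : (Real.sqrt 3 : ℂ) ≠ 0 := by simp
  -- A group element whose first column has all entries `1/√3`, so that no `u_k0` vanishes at it.
  obtain ⟨g, hg⟩ := exists_smulS5_baseS5 ⟨WithLp.toLp 2 fun _ => (1 / Real.sqrt 3 : ℂ), by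
    rw [mem_sphere_zero_iff_norm, EuclideanSpace.norm_eq]
    simp⟩
  have h2 : ∀ k, coordU k 0 g = (1 / Real.sqrt 3 : ℂ) := by
    intro k
    have := congrArg (coordZ k) hg
    rw [coordZ_smulS5] at this
    simpa [baseS5, coordZ] using this
  have h4 : coordU i 0 g * coordU j 0 g = 0 := DFunLike.congr_fun h1 g
  rw [h2, h2] at h4
  simp at h4

theorem toLp_coordZ_mul_ne_zero :
    ContinuousMap.toLp 2 surfS5 ℂ (coordZ 0 * coordZ 0) ≠ 0 := by
  intro h
  have h1 : coordZ 0 * coordZ 0 = 0 :=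
    ContinuousMap.toLp_injective (p := 2) (𝕜 := ℂ) surfS5 (by rw [h, map_zero])
  have h4 : coordZ 0 baseS5 * coordZ 0 baseS5 = 0 := DFunLike.congr_fun h1 baseS5
  simp [baseS5, coordZ] at h4

theorem single_add_single_ne {k l : Fin 3} (h : (k, l) ≠ (0, 0)) :
    (Pi.single 0 1 + Pi.single 0 1 : Fin 3 → ℤ) ≠ Pi.single k 1 + Pi.single l 1 := by
  intro h1
  have := congrFun h1 0
  fin_cases k <;> fin_cases l <;> simp at this h

theorem mul_apply_one {n : ℕ} {X : Type*} [TopologicalSpace X] [CompactSpace X]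
    [MeasurableSpace X] [BorelSpace X] {μ : Measure X} [IsFiniteMeasure μ] [NormalSpace X]
    [μ.WeaklyRegular] {T : TorusAction n X μ} (θ : Matrix (Fin n) (Fin n) ℝ)
    {r s : Fin n → ℤ} (f : C(X, ℂ)) {g : C(X, ℂ)} (hg : IsIsotypic T s g) :
    (leftMul T θ r f * leftMul T θ s g) (ContinuousMap.toLp 2 μ ℂ 1) =
      e2pi (∑ j, halfShift θ r j * s j) • ContinuousMap.toLp 2 μ ℂ (f * g) := by
  rw [leftMul_mul θ f hg, smul_apply, leftMul_one]

theorem sum_halfShift_single (θ' : Matrix (Fin 3) (Fin 3) ℝ) (i j : Fin 3) :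
    ∑ m, halfShift θ' (Pi.single i 1) m * (Pi.single j 1 : Fin 3 → ℤ) m = 1 / 2 * θ' i j := by
  simp [halfShift, Matrix.vecMul, dotProduct, Pi.single_apply]

/-- Each side is `e^{πi θ'_ij} e^{πi θ'_ji}` times the left multiplication by the pointwise product.
-/
theorem z_mul_z {θ' : Matrix (Fin 3) (Fin 3) ℝ} (i j : Fin 3) :
    e2pi (1 / 2 * θ' i j) • (z θ' j * z θ' i) = e2pi (1 / 2 * θ' j i) • (z θ' i * z θ' j) := by
  apply Subtype.ext
  change e2pi (1 / 2 * θ' i j) • (leftMul actS5 θ' _ _ * leftMul actS5 θ' _ _) =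
    e2pi (1 / 2 * θ' j i) • (leftMul actS5 θ' _ _ * leftMul actS5 θ' _ _)
  rw [leftMul_mul _ _ (isIsotypic_coordZ i), leftMul_mul _ _ (isIsotypic_coordZ j),
    sum_halfShift_single, sum_halfShift_single, smul_smul, smul_smul, mul_comm (coordZ j),
    add_comm (Pi.single j 1), mul_comm (e2pi _)]

/-- The matrix coefficient `a ↦ ⟪v, a w⟫`. -/
def matrixCoefficient {K : Type*} [NormedAddCommGroup K] [InnerProductSpace ℂ K] [CompleteSpace K]
    (B : StarSubalgebra ℂ (K →L[ℂ] K)) (v w : K) : B →ₗ[ℂ] ℂ where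
  toFun a := inner ℂ v ((a : K →L[ℂ] K) w)
  map_add' a b := by
    rw [← inner_add_right]
    rfl
  map_smul' c a := by
    rw [RingHom.id_apply, smul_eq_mul, ← inner_smul_right]
    rfl

theorem matrixCoefficient_elemTensor {E F : Type*} [NormedAddCommGroup E] [InnerProductSpace ℂ E]
    [CompleteSpace E] [NormedAddCommGroup F] [InnerProductSpace ℂ F] [CompleteSpace F]
    {A : StarSubalgebra ℂ (E →L[ℂ] E)} {B : StarSubalgebra ℂ (F →L[ℂ] F)} (v v' : E) (w w' : F)
    (a : A) (b : B) :
    matrixCoefficient (spatialTensor A B) (HilbertTensor.tmul v w) (HilbertTensor.tmul v' w')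
      (elemTensor a b) = inner ℂ v ((a : E →L[ℂ] E) v') * inner ℂ w ((b : F →L[ℂ] F) w') := by
  change inner ℂ _ (opTensor _ _ _) = _
  rw [opTensor_tmul, HilbertTensor.inner_tmul]

/-- Here `δ` is merely an algebra homomorphism, without continuity or compatibility with adjoints.
The relation is therefore evaluated as a finite sum of elementary tensors. -/
theorem sum_inner_mul_inner_eq {E F I : Type*} [Fintype I] [NormedAddCommGroup E]
    [InnerProductSpace ℂ E] [CompleteSpace E] [NormedAddCommGroup F] [InnerProductSpace ℂ F]
    [CompleteSpace F] {H : StarSubalgebra ℂ (E →L[ℂ] E)} {A : StarSubalgebra ℂ (F →L[ℂ] F)}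
    {u : I → I → H} {z : I → A} {δ : A →ₐ[ℂ] spatialTensor H A}
    (hδ : ∀ j, δ (z j) = ∑ k, elemTensor (u j k) (z k)) {c c' : ℂ} {i j : I}
    (h : c • (z j * z i) = c' • (z i * z j)) (v v' : E) (w w' : F) :
    c * ∑ p : I × I, inner ℂ v (((u j p.1 * u i p.2 : H) : E →L[ℂ] E) v') *
        inner ℂ w (((z p.1 * z p.2 : A) : F →L[ℂ] F) w') =
      c' * ∑ p : I × I, inner ℂ v (((u i p.1 * u j p.2 : H) : E →L[ℂ] E) v') *
        inner ℂ w (((z p.1 * z p.2 : A) : F →L[ℂ] F) w') := by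
  have h1 := congrArg (fun a => matrixCoefficient (spatialTensor H A) (HilbertTensor.tmul v w)
    (HilbertTensor.tmul v' w') (δ a)) h
  simpa only [map_smul, map_mul, hδ, Finset.sum_mul_sum, map_sum, elemTensor_mul,
    matrixCoefficient_elemTensor, smul_eq_mul, Fintype.sum_prod_type] using h1

/-- Functions of different weights are orthogonal, so pairing with `z_0 z_0` leaves only the index
`(0, 0)`. There both factors `u_i0`, `u_j0` have column `0`, and the right-hand torus contributes no
phase. -/
theorem inner_mul_inner_eq {θ : ℝ} {θ' : Matrix (Fin 3) (Fin 3) ℝ} (hθ' : θ'.transpose = -θ')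
    (i j : Fin 3) (v : Lp ℂ 2 haarSU3) (p : Fin 3 × Fin 3) :
    inner ℂ v (((u θ i p.1 * u θ j p.2 : CSU3 θ) : Lp ℂ 2 haarSU3 →L[ℂ] Lp ℂ 2 haarSU3)
        (ContinuousMap.toLp 2 haarSU3 ℂ 1)) *
      inner ℂ (ContinuousMap.toLp 2 surfS5 ℂ (coordZ 0 * coordZ 0))
        (((z θ' p.1 * z θ' p.2 : CS5 θ') : Lp ℂ 2 surfS5 →L[ℂ] Lp ℂ 2 surfS5)
          (ContinuousMap.toLp 2 surfS5 ℂ 1)) =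
      if p = (0, 0) then e2pi (1 / 2 * θ * (wt i 1 * wt j 0 - wt i 0 * wt j 1)) *
        (inner ℂ v (ContinuousMap.toLp 2 haarSU3 ℂ (coordU i 0 * coordU j 0)) *
          ‖ContinuousMap.toLp 2 surfS5 ℂ (coordZ 0 * coordZ 0)‖ ^ 2) else 0 := by
  obtain ⟨k, l⟩ := p
  have h1 := mul_apply_one (T := actSU3) (r := weightU i k) (matJ θ) (coordU i k)
    (isIsotypic_coordU j l)
  have h2 := mul_apply_one (T := actS5) (r := Pi.single k 1) θ' (coordZ k) (isIsotypic_coordZ l)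
  have h3 := congrArg₂ (fun x y => inner ℂ v x *
    inner ℂ (ContinuousMap.toLp 2 surfS5 ℂ (coordZ 0 * coordZ 0)) y) h1 h2
  refine h3.trans ?_
  rw [inner_smul_right, inner_smul_right]
  split_ifs with h
  · obtain ⟨rfl, rfl⟩ := Prod.mk.inj h
    have h2 : θ' 0 0 = 0 := by
      have := congrFun (congrFun hθ' 0) 0
      rw [Matrix.transpose_apply, Matrix.neg_apply] at this
      exact self_eq_neg.1 this
    rw [sum_halfShift_weightU, sum_halfShift_single, h2, mul_zero, e2pi_zero, one_mul,
      inner_self_eq_norm_sq_to_K, mul_assoc, mul_comm (wt 0 1 : ℝ), sub_self, sub_zero]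
    rfl
  · rw [inner_eq_zero_of_weight_ne ((isIsotypic_coordZ 0).mul (isIsotypic_coordZ 0))
      ((isIsotypic_coordZ k).mul (isIsotypic_coordZ l)) (single_add_single_ne h), mul_zero,
      mul_zero]

theorem exists_int_of_coaction {θ : ℝ} {θ' : Matrix (Fin 3) (Fin 3) ℝ} (hθ' : θ'.transpose = -θ')
    {δ : CS5 θ' →ₐ[ℂ] spatialTensor (CSU3 θ) (CS5 θ')}
    (hδ : ∀ j, δ (z θ' j) = ∑ k, elemTensor (u θ j k) (z θ' k)) (i j : Fin 3) :
    ∃ n : ℤ, θ' i j + θ * (wt j 1 * wt i 0 - wt j 0 * wt i 1) = n := by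
  have h := sum_inner_mul_inner_eq hδ (z_mul_z i j)
    (ContinuousMap.toLp 2 haarSU3 ℂ (coordU i 0 * coordU j 0)) (ContinuousMap.toLp 2 haarSU3 ℂ 1)
    (ContinuousMap.toLp 2 surfS5 ℂ (coordZ 0 * coordZ 0)) (ContinuousMap.toLp 2 surfS5 ℂ 1)
  simp only [inner_mul_inner_eq hθ', Finset.sum_ite_eq', Finset.mem_univ, if_true] at h
  rw [mul_comm (coordU j 0)] at h
  simp only [← mul_assoc] at h
  have hne : (inner ℂ (ContinuousMap.toLp 2 haarSU3 ℂ (coordU i 0 * coordU j 0))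
      (ContinuousMap.toLp 2 haarSU3 ℂ (coordU i 0 * coordU j 0)) : ℂ) ≠ 0 :=
    inner_self_ne_zero.2 (toLp_coordU_mul_ne_zero i j)
  have hne' : (‖ContinuousMap.toLp 2 surfS5 ℂ (coordZ 0 * coordZ 0)‖ ^ 2 : ℂ) ≠ 0 :=
    pow_ne_zero 2 (Complex.ofReal_ne_zero.2 (norm_ne_zero_iff.2 toLp_coordZ_mul_ne_zero))
  -- Both orders of the product contain the same nonzero norms, so only the phases remain to be
  -- compared.
  have h1 := mul_right_cancel₀ hne (mul_right_cancel₀ hne' h)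
  rw [← e2pi_add, ← e2pi_add] at h1
  obtain ⟨n, hn⟩ := exists_int_of_e2pi_eq h1
  refine ⟨n, ?_⟩
  have h2 : θ' j i = -θ' i j := congrFun (congrFun hθ' i) j
  rw [h2] at hn
  linarith

end Converse

/-! ### Combination of the results -/

section Assembly

theorem IsCoproduct.unique {θ : ℝ} {Δ Δ' : CSU3 θ →⋆ₐ[ℂ] spatialTensor (CSU3 θ) (CSU3 θ)}
    (h : IsCoproduct θ Δ) (h' : IsCoproduct θ Δ') : Δ' = Δ :=
  (generates_u θ).ext fun p => (h' p.1 p.2).trans (h p.1 p.2).symm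

theorem existsUnique_coproduct (θ : ℝ) :
    ∃! Δ : CSU3 θ →⋆ₐ[ℂ] spatialTensor (CSU3 θ) (CSU3 θ), IsCoproduct θ Δ := by
  obtain ⟨Δ, hΔ, -⟩ := exists_coproduct θ
  exact ⟨Δ, hΔ, fun Δ' h => hΔ.unique h⟩

theorem existsUnique_counit (θ : ℝ) : ∃! ε : CSU3 θ →⋆ₐ[ℂ] ℂ, IsCounit θ ε := by
  obtain ⟨ε, hε⟩ := exists_counit θ
  exact ⟨ε, hε, fun ε' h => (generates_u θ).ext fun p => (h p.1 p.2).trans (hε p.1 p.2).symm⟩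

theorem coaction_unique {θ : ℝ} {θ' : Matrix (Fin 3) (Fin 3) ℝ} (hθ' : θ'.transpose = -θ')
    {δ δ' : CS5 θ' →⋆ₐ[ℂ] spatialTensor (CSU3 θ) (CS5 θ')}
    (h : ∀ j, δ (z θ' j) = ∑ k, elemTensor (u θ j k) (z θ' k))
    (h' : ∀ j, δ' (z θ' j) = ∑ k, elemTensor (u θ j k) (z θ' k)) : δ' = δ :=
  (generates_z hθ').ext fun j => (h' j).trans (h j).symm

theorem isLeftCoaction_S5 {θ : ℝ} {θ' : Matrix (Fin 3) (Fin 3) ℝ} (hθ' : θ'.transpose = -θ')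
    {Δ : CSU3 θ →⋆ₐ[ℂ] spatialTensor (CSU3 θ) (CSU3 θ)} (hΔ : IsCoproduct θ Δ)
    {ε : CSU3 θ →⋆ₐ[ℂ] ℂ} (hε : IsCounit θ ε)
    {δ : CS5 θ' →⋆ₐ[ℂ] spatialTensor (CSU3 θ) (CS5 θ')}
    (hδ : ∀ j, δ (z θ' j) = ∑ k, elemTensor (u θ j k) (z θ' k)) (hδi : Implemented δ) :
    IsLeftCoaction (CSU3 θ) (CS5 θ') Δ ε δ := by
  obtain ⟨Δ', hΔ', hΔi⟩ := exists_coproduct θ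
  -- Uniqueness identifies the given coproduct with the constructed one, which is known to be
  -- implemented.
  obtain rfl := hΔ.unique hΔ'
  exact isLeftCoaction (generates_z hθ') hΔ hΔi hε (exists_counit_slice (CS5 θ') hε) hδ hδi

theorem coaction_S5 {θ : ℝ} {θ' : Matrix (Fin 3) (Fin 3) ℝ} (hθ' : θ'.transpose = -θ')
    (h1 : -θ' 0 1 = θ) (h2 : θ' 0 2 = θ) (h3 : -θ' 1 2 = θ) :
    (∃! δ : CS5 θ' →⋆ₐ[ℂ] spatialTensor (CSU3 θ) (CS5 θ'),
        ∀ j, δ (z θ' j) = ∑ k, elemTensor (u θ j k) (z θ' k)) ∧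
      ∀ δ : CS5 θ' →⋆ₐ[ℂ] spatialTensor (CSU3 θ) (CS5 θ'),
        (∀ j, δ (z θ' j) = ∑ k, elemTensor (u θ j k) (z θ' k)) →
        (∀ Δ ε, IsCoproduct θ Δ → IsCounit θ ε → IsLeftCoaction (CSU3 θ) (CS5 θ') Δ ε δ) ∧
        coinvariants δ = Set.range (algebraMap ℂ (CS5 θ')) := by
  have h := exists_coaction_S5 hθ' h1 h2 h3
  rcases h with ⟨δ, h⟩
  have hδ := h.1
  constructor
  · refine ExistsUnique.intro δ hδ ?_
    intro δ' h
    exact coaction_unique hθ' hδ h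
  · intro δ' h'
    have := coaction_unique hθ' h' hδ
    subst this
    constructor
    · intro Δ ε hΔ hε
      exact isLeftCoaction_S5 hθ' hΔ hε hδ h.2.1
    · exact h.2.2

theorem exists_int_of_exists_coaction {θ : ℝ} {θ' : Matrix (Fin 3) (Fin 3) ℝ}
    (hθ' : θ'.transpose = -θ') {δ : CS5 θ' →ₐ[ℂ] spatialTensor (CSU3 θ) (CS5 θ')}
    (hδ : ∀ j, δ (z θ' j) = ∑ k, elemTensor (u θ j k) (z θ' k)) :
    ∃ a b c : ℤ, -θ' 0 1 = θ + a ∧ θ' 0 2 = θ + b ∧ -θ' 1 2 = θ + c := by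
  obtain ⟨a, ha⟩ := exists_int_of_coaction hθ' hδ 0 1
  obtain ⟨b, hb⟩ := exists_int_of_coaction hθ' hδ 0 2
  obtain ⟨c, hc⟩ := exists_int_of_coaction hθ' hδ 1 2
  simp [wt] at ha hb hc
  refine ⟨-a, b, -c, ?_, ?_, ?_⟩ <;> push_cast <;> linarith

end Assembly

end ToricDeformation

end

open ToricDeformation in
theorem theorem5p1 (θ : ℝ) (θ' : Matrix (Fin 3) (Fin 3) ℝ) (hθ' : θ'.transpose = -θ') :
    -- the coproduct and the counit of `C(SU(3)_θ)` exist and are determined by their values on `u`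
    (∃! Δ : CSU3 θ →⋆ₐ[ℂ] spatialTensor (CSU3 θ) (CSU3 θ), IsCoproduct θ Δ) ∧
    (∃! ε : CSU3 θ →⋆ₐ[ℂ] ℂ, IsCounit θ ε) ∧
    -- for the stated parameters, `z_j ↦ ∑ₖ u_{jk} ⊗ z_k` extends to a cotransitive left coaction
    (-θ' 0 1 = θ → θ' 0 2 = θ → -θ' 1 2 = θ →
      (∃! δ : CS5 θ' →⋆ₐ[ℂ] spatialTensor (CSU3 θ) (CS5 θ'),
        ∀ j, δ (z θ' j) = ∑ k, elemTensor (u θ j k) (z θ' k)) ∧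
      ∀ δ : CS5 θ' →⋆ₐ[ℂ] spatialTensor (CSU3 θ) (CS5 θ'),
        (∀ j, δ (z θ' j) = ∑ k, elemTensor (u θ j k) (z θ' k)) →
        (∀ Δ ε, IsCoproduct θ Δ → IsCounit θ ε → IsLeftCoaction (CSU3 θ) (CS5 θ') Δ ε δ) ∧
        coinvariants δ = Set.range (algebraMap ℂ (CS5 θ'))) ∧
    -- conversely, if that map extends to an algebra homomorphism, then the parameters have these
    -- values up to integers
    ((∃ δ : CS5 θ' →ₐ[ℂ] spatialTensor (CSU3 θ) (CS5 θ'),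
        ∀ j, δ (z θ' j) = ∑ k, elemTensor (u θ j k) (z θ' k)) →
      ∃ a b c : ℤ, -θ' 0 1 = θ + a ∧ θ' 0 2 = θ + b ∧ -θ' 1 2 = θ + c) := by
  refine ⟨existsUnique_coproduct θ, existsUnique_counit θ, coaction_S5 hθ', ?_⟩
  rintro ⟨δ, hδ⟩
  exact exists_int_of_exists_coaction hθ' hδ
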